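/- Let $d\ge 1$, let $X_1,\dots,X_n$ be independent random variables on a probability space with values in a measurable space $\mathcal X$, let $h_i\colon\mathcal X\to\mathbb R^d$ ($1\le i\le n$) and $T\colon\mathcal X^n\to\mathbb R^d$ be measurable, and put $$\xi_i=h_i(X_i),\qquad W=\sum_{i=1}^n\xi_i,\qquad T=T(X_1,\dots,X_n),\qquad D=T-W .$$ Assume that the $\xi_i$ are square integrable, that $\mathbb E\,\xi_i=0$ for each $i$, and that $\sum_{i=1}^n\mathbb E\{\xi_i\xi_i^{\intercal}\}=I_d$. Let $\gamma=\sum_{i=1}^n\mathbb E\|\xi_i\|^3\in[0,\infty]$, where $\|\cdot\|$ is the Euclidean norm, let $Z\sim N(0,I_d)$, and let $\mathcal A$ be the collection of all convex subsets of $\mathbb R^d$. Let $\Delta$ and $\Delta^{(1)},\dots,\Delta^{(n)}$ be any real random variables on the same probability space such that $\Delta\ge\|D\|$ almost surely and such that, for each $i$, $X_i$ is independent of the pair $(\Delta^{(i)},\,W-\xi_i)$. Then $$\sup_{A\in\mathcal A}\bigl|\mathbb P(T\in A)-\mathbb P(Z\in A)\bigr|\;\le\;259\,d^{1/2}\gamma+2\,\mathbb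 E\bigl\{\|W\|\Delta\bigr\}+2\sum_{i=1}^n\mathbb E\bigl\{\|\xi_i\|\,|\Delta-\Delta^{(i)}|\bigr\},$$ where the right-hand side may be $+\infty$, and for a convex set $A$ that is not Borel the probabilities are outer probabilities. -/

import Mathlib

open MeasureTheory ProbabilityTheory
open scoped ENNReal

namespace NonlinearStatistic

variable {Ω 𝓧 : Type*} {d n : ℕ}

/-- The summand `ξᵢ = hᵢ(Xᵢ)`. -/
def xi (h : Fin n → 𝓧 → EuclideanSpace ℝ (Fin d)) (X : Fin n → Ω → 𝓧) (i : Fin n) (ω : Ω) :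
    EuclideanSpace ℝ (Fin d) :=
  h i (X i ω)

/-- The linear statistic `W = ∑ᵢ ξᵢ`. -/
def linearPart (h : Fin n → 𝓧 → EuclideanSpace ℝ (Fin d)) (X : Fin n → Ω → 𝓧) (ω : Ω) :
    EuclideanSpace ℝ (Fin d) :=
  ∑ i, xi h X i ω

/-- The nonlinear statistic `T(X₁, …, Xₙ)` as a random vector. -/
def statistic (T : (Fin n → 𝓧) → EuclideanSpace ℝ (Fin d)) (X : Fin n → Ω → 𝓧) (ω : Ω) :
    EuclideanSpace ℝ (Fin d) :=
  T (fun i => X i ω)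

/-- The error term `D = T - W`. -/
def errorTerm (T : (Fin n → 𝓧) → EuclideanSpace ℝ (Fin d))
    (h : Fin n → 𝓧 → EuclideanSpace ℝ (Fin d)) (X : Fin n → Ω → 𝓧) (ω : Ω) :
    EuclideanSpace ℝ (Fin d) :=
  statistic T X ω - linearPart h X ω

/-- `γ = ∑ᵢ E‖ξᵢ‖³`, a number in `[0, ∞]`. -/
noncomputable def gammaSum [MeasurableSpace Ω] (μ : Measure Ω)
    (h : Fin n → 𝓧 → EuclideanSpace ℝ (Fin d)) (X : Fin n → Ω → 𝓧) : ℝ≥0∞ :=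
  ∑ i, ∫⁻ ω, ‖xi h X i ω‖ₑ ^ 3 ∂μ

/-- The matrix `∑ᵢ E[ξᵢ ξᵢᵀ]`; its entries are genuine expectations when the `ξᵢ` are
square integrable. -/
noncomputable def covarianceSum [MeasurableSpace Ω] (μ : Measure Ω)
    (h : Fin n → 𝓧 → EuclideanSpace ℝ (Fin d)) (X : Fin n → Ω → 𝓧) :
    Matrix (Fin d) (Fin d) ℝ :=
  ∑ i, Matrix.of fun j k => ∫ ω, xi h X i ω j * xi h X i ω k ∂μ

/-- `sup_A |P(Y ∈ A) - P(Z ∈ A)|` over all convex `A ⊆ ℝᵈ`, where `Z ∼ N(0, I_d)`. For a convex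
set that is not Borel, both probabilities are read as outer probabilities. -/
noncomputable def convexDistToGaussian [MeasurableSpace Ω] (μ : Measure Ω)
    (Y : Ω → EuclideanSpace ℝ (Fin d)) : ℝ≥0∞ :=
  ⨆ (A : Set (EuclideanSpace ℝ (Fin d))) (_ : Convex ℝ A),
    ENNReal.ofReal |μ.real {ω | Y ω ∈ A} - (stdGaussian (EuclideanSpace ℝ (Fin d))).real A|

end NonlinearStatistic

set_option linter.unusedSectionVars false

namespace NonlinearStatistic

/-! ### Gaussian calculus: Cameron–Martin shifts, integration by parts, Hermite kernels. -/

section GaussianCalculus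

open scoped RealInnerProductSpace

variable {E : Type*} [NormedAddCommGroup E] [InnerProductSpace ℝ E] [FiniteDimensional ℝ E]
  [MeasurableSpace E] [BorelSpace E]

/-! The proof replaces `T` by `W` and then compares `W` with the Gaussian. Both steps work on sets
`{s ≤ 0}`, where `s` is a finite maximum of affine functions with unit gradients. Such an `s` is
convex and 1-Lipschitz and has a measurable field `n` of subgradients of norm exactly one. Every
closed convex set other than the empty set and the whole space is a decreasing intersection of such
sets (`exists_sublevel_sequence`). A general convex set is squeezed between its closure and an
erosion of its closure (`ConvexClose.abs_sub_le`).

Replacing `T` by `W`. Since `s` is 1-Lipschitz, `s(T) ≤ 0` and `s(W) ≤ 0` can differ only if `s(W)`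
lies in `[0, Δ]` or in `[-Δ, 0]`. The probability of such a random strip is bounded in
`IsStandardized.concentration`. Put `f_a = ψ_a(s) n`, where `ψ_a` is a nonnegative truncated linear
function with slope one around a strip of width `a`. As the gradient of a convex function `f_a` is
monotone, and it is bounded by `a + 3δ`, so `E⟨W, f_Δ(W)⟩ ≤ E‖W‖Δ + 3δ√d`. Conversely, independence
gives `E⟨ξᵢ, f_{Δ⁽ⁱ⁾}(W - ξᵢ)⟩ = 0`, so this term may be subtracted from `E⟨ξᵢ, f_Δ(W)⟩`. The change
of width costs at most `E‖ξᵢ‖|Δ - Δ⁽ⁱ⁾|`. The change of point contributes a nonnegative amount,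
which on the strip is at least `⟨n(W), ξᵢ⟩²` when `‖ξᵢ‖ ≤ δ`. The sum of these squares is a
quadratic form of the truncated empirical covariance, which is bounded below in all directions at
once (`exists_covariance_error`), hence also in the random direction `n(W)`. With `δ = 2γ` the cost
is `15√d γ` plus twice the two error terms of the theorem.

Comparing `W` with the Gaussian. `berryEsseen` proves the bound `200√d γ` by induction on the index
set. The indicator is smoothed over a width `ε = 60γ`, and its expectation is followed along the
rotation `cos θ W + sin θ Z`. In the derivative in `θ`, each `ξᵢ` meets the sum of the others, which
is independent of it; Taylor expansion cancels the leading terms and leaves a third-order remainder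
(`abs_interpolationDeriv_le`). After renormalizing its covariance, the leave-one-out sum is again a
standardized sum, so by induction it is within some `κ` of the Gaussian on convex sets. For `θ ≥
30γ` all derivatives are put on Gaussian densities, at a price `κ / sin² θ` from the replacement.
For `θ ≤ 30γ` two derivatives stay on the smoothed indicator, whose gradient vanishes off a strip of
width `ε`, of probability at most `2κ + 1.1√d ε`. Altogether the distance is at most `0.38 κ + O(√d
γ)`; as `κ` is only slightly larger than `200√d γ`, the induction closes. The Gaussian measure of
strips is controlled by the same vector field `ψ(s) n` together with Gaussian integration by parts
(`stdGaussian_strip_le`). -/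

lemma integral_cexp_stdGaussian (v t : E) :
    ∫ z, Complex.exp (⟪v, z⟫ + ⟪z, t⟫ * Complex.I) ∂(stdGaussian E)
      = Complex.exp ((‖v‖ ^ 2 + 2 * ⟪v, t⟫ * Complex.I - ‖t‖ ^ 2) / 2) := by
  rw [stdGaussian, integral_map (Measurable.aemeasurable (by fun_prop))
    (Measurable.aestronglyMeasurable (by fun_prop))]
  set b := stdOrthonormalBasis ℝ E
  have h1 : ∀ x : Fin (Module.finrank ℝ E) → ℝ,
      Complex.exp (⟪v, ∑ i, x i • b i⟫ + ⟪∑ i, x i • b i, t⟫ * Complex.I)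
        = ∏ i, Complex.exp ((⟪v, b i⟫ + ⟪b i, t⟫ * Complex.I) * x i) := by
    intro x
    rw [← Complex.exp_sum]
    congr 1
    simp only [inner_sum, sum_inner, real_inner_smul_left, real_inner_smul_right]
    push_cast
    rw [Finset.sum_mul, ← Finset.sum_add_distrib]
    refine Finset.sum_congr rfl fun i _ => ?_
    ring
  simp_rw [h1]
  rw [integral_fintype_prod_eq_prod
    (f := fun i (x : ℝ) => Complex.exp ((⟪v, b i⟫ + ⟪b i, t⟫ * Complex.I) * x))]
  have h2 : ∀ z : ℂ, ∫ x : ℝ, Complex.exp (z * x) ∂(gaussianReal 0 1) = Complex.exp (z ^ 2 / 2) := by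
    intro z
    have := complexMGF_gaussianReal (p := gaussianReal 0 1) (X := id) (μ := 0) (v := 1) (by simp) z
    simpa [complexMGF] using this
  simp_rw [h2]
  rw [← Complex.exp_sum]
  congr 1
  have e1 : ((‖v‖ ^ 2 : ℝ) : ℂ) = ∑ i, ((⟪v, b i⟫ : ℝ) : ℂ) ^ 2 := by
    rw [← b.sum_sq_inner_left v]; push_cast; rfl
  have e2 : ((‖t‖ ^ 2 : ℝ) : ℂ) = ∑ i, ((⟪b i, t⟫ : ℝ) : ℂ) ^ 2 := by
    rw [← b.sum_sq_inner_right t]; push_cast; rfl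
  have e3 : ((⟪v, t⟫ : ℝ) : ℂ) = ∑ i, ((⟪v, b i⟫ : ℝ) : ℂ) * ((⟪b i, t⟫ : ℝ) : ℂ) := by
    rw [← b.sum_inner_mul_inner v t]; push_cast; rfl
  push_cast at e1 e2
  rw [e1, e2, e3, ← Finset.sum_div]
  congr 1
  simp only [Finset.mul_sum, Finset.sum_mul]
  rw [← Finset.sum_add_distrib, ← Finset.sum_sub_distrib]
  refine Finset.sum_congr rfl fun i _ => ?_
  ring_nf
  simp only [Complex.I_sq]
  ring

/-- Fernique's theorem gives some integrable `exp (C‖z‖²)`; completing the square bounds `a‖z‖` by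
`C‖z‖² + a² / (4C)`. -/
lemma integrable_exp_mul_norm_stdGaussian (a : ℝ) :
    Integrable (fun z : E => Real.exp (a * ‖z‖)) (stdGaussian E) := by
  obtain ⟨C, hC, hint⟩ := IsGaussian.exists_integrable_exp_sq (stdGaussian E)
  refine (hint.const_mul (Real.exp (a ^ 2 / (4 * C)))).mono'
    (Measurable.aestronglyMeasurable (by fun_prop)) (Filter.Eventually.of_forall fun z => ?_)
  rw [Real.norm_eq_abs, Real.abs_exp, ← Real.exp_add]
  apply Real.exp_le_exp.2
  have : a ^ 2 / (4 * C) + C * ‖z‖ ^ 2 - a * ‖z‖ = C * (‖z‖ - a / (2 * C)) ^ 2 := by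
    field_simp; ring
  nlinarith [mul_nonneg hC.le (sq_nonneg (‖z‖ - a / (2 * C)))]

/-- The density of the shifted standard Gaussian with respect to the standard Gaussian. -/
noncomputable def shiftDensity (v z : E) : ℝ := Real.exp (⟪v, z⟫ - ‖v‖ ^ 2 / 2)

lemma shiftDensity_nonneg (v z : E) : 0 ≤ shiftDensity v z := Real.exp_nonneg _

lemma integrable_shiftDensity (v : E) :
    Integrable (fun z => shiftDensity v z) (stdGaussian E) := by
  refine (integrable_exp_mul_norm_stdGaussian ‖v‖).mono'
    (Measurable.aestronglyMeasurable (by unfold shiftDensity; fun_prop))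
    (Filter.Eventually.of_forall fun z => ?_)
  rw [Real.norm_eq_abs, shiftDensity, Real.abs_exp]
  apply Real.exp_le_exp.2
  have := real_inner_le_norm v z
  have := sq_nonneg ‖v‖
  linarith

/-- The Cameron–Martin formula, as an identity of measures. -/
lemma map_add_stdGaussian (v : E) :
    (stdGaussian E).map (fun z => z + v)
      = (stdGaussian E).withDensity (fun z => ENNReal.ofReal (shiftDensity v z)) := by
  have hm : Measurable fun z : E => ENNReal.ofReal (shiftDensity v z) := by
    unfold shiftDensity; fun_prop
  have : IsFiniteMeasure ((stdGaussian E).withDensity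
      (fun z => ENNReal.ofReal (shiftDensity v z))) :=
    isFiniteMeasure_withDensity_ofReal (integrable_shiftDensity v).2
  have : IsFiniteMeasure ((stdGaussian E).map (fun z => z + v)) := by infer_instance
  -- The exponential density turns the second characteristic function into a Gaussian integral with
  -- complex exponent, which `integral_cexp_stdGaussian` evaluates.
  apply Measure.ext_of_charFun
  ext t
  rw [charFun_apply, charFun_apply, integral_map (by fun_prop)
    (Measurable.aestronglyMeasurable (by fun_prop)),
    integral_withDensity_eq_integral_toReal_smul hm
      (Filter.Eventually.of_forall fun _ => ENNReal.ofReal_lt_top)]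
  have h1 : ∀ z : E, (ENNReal.ofReal (shiftDensity v z)).toReal
      • Complex.exp (⟪z, t⟫ * Complex.I)
      = Complex.exp (⟪v, z⟫ + ⟪z, t⟫ * Complex.I) * Complex.exp (-(‖v‖ ^ 2 / 2)) := by
    intro z
    rw [ENNReal.toReal_ofReal (shiftDensity_nonneg v z), shiftDensity, Complex.real_smul,
      Complex.ofReal_exp, ← Complex.exp_add, ← Complex.exp_add]
    congr 1
    push_cast
    ring
  have h2 : ∀ z : E, Complex.exp (⟪z + v, t⟫ * Complex.I)
      = Complex.exp (⟪(0:E), z⟫ + ⟪z, t⟫ * Complex.I) * Complex.exp (⟪v, t⟫ * Complex.I) := by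
    intro z
    rw [inner_add_left, ← Complex.exp_add]
    congr 1
    push_cast [inner_zero_left]
    ring
  simp_rw [h1, h2, integral_mul_const, integral_cexp_stdGaussian, ← Complex.exp_add]
  congr 1
  simp only [norm_zero, inner_zero_left]
  push_cast
  ring

/-- The Cameron–Martin formula. -/
lemma integral_add_stdGaussian (v : E) {f : E → ℝ} (hf : Measurable f) :
    ∫ z, f (z + v) ∂(stdGaussian E) = ∫ z, f z * shiftDensity v z ∂(stdGaussian E) := by
  have hm : Measurable fun z : E => ENNReal.ofReal (shiftDensity v z) := by
    unfold shiftDensity; fun_prop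
  rw [← integral_map (μ := stdGaussian E) (φ := fun z => z + v) (f := f) (by fun_prop)
    hf.aestronglyMeasurable, map_add_stdGaussian,
    integral_withDensity_eq_integral_toReal_smul hm
      (Filter.Eventually.of_forall fun _ => ENNReal.ofReal_lt_top)]
  refine integral_congr_ae (Filter.Eventually.of_forall fun z => ?_)
  simp only [smul_eq_mul]
  rw [ENNReal.toReal_ofReal (shiftDensity_nonneg v z), mul_comm]

/-- Differentiation of a Gaussian average in the direction `v`, with the derivative moved from the
bounded function `k` to the Gaussian density and to the smooth weight `p`. -/
lemma hasDerivAt_integral_stdGaussian {k p D : E → ℝ} (v : E) (hk : Measurable k) {K : ℝ}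
    (hkb : ∀ z, |k z| ≤ K) (hp : Measurable p) (hD : Measurable D) {C : ℝ}
    (hpb : ∀ z, |p z| ≤ C * Real.exp ‖z‖) (hDb : ∀ z, |D z| ≤ C * Real.exp ‖z‖)
    (hpD : ∀ z, ∀ r : ℝ, HasDerivAt (fun r : ℝ => p (z + r • v)) (D (z + r • v)) r) (r₀ : ℝ) :
    HasDerivAt (fun r : ℝ => ∫ z, k (z + r • v) * p z ∂(stdGaussian E))
      (∫ z, k (z + r₀ • v) * (p z * ⟪v, z⟫ - D z) ∂(stdGaussian E)) r₀ := by
  have hK : 0 ≤ K := (abs_nonneg _).trans (hkb 0)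
  have hC : 0 ≤ C := by
    have := (abs_nonneg _).trans (hpb 0)
    simpa using this
  -- the case `r₀ = 0`
  have key : ∀ k : E → ℝ, Measurable k → (∀ z, |k z| ≤ K) →
      HasDerivAt (fun r : ℝ => ∫ z, k (z + r • v) * p z ∂(stdGaussian E))
      (∫ z, k z * (p z * ⟪v, z⟫ - D z) ∂(stdGaussian E)) 0 := by
    intro k hk hkb
    -- As `k` is only bounded and measurable, Cameron–Martin moves the shift to `p` and to the
    -- density, where everything is differentiable in `r`.
    have hrew : ∀ r : ℝ, ∫ z, k (z + r • v) * p z ∂(stdGaussian E)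
        = ∫ z, k z * (p (z + (-r) • v) * shiftDensity (r • v) z) ∂(stdGaussian E) := by
      intro r
      have := integral_add_stdGaussian (r • v) (f := fun z => k z * p (z + (-r) • v)) (by fun_prop)
      simp only [neg_smul, add_neg_cancel_right] at this
      rw [this]
      simp only [neg_smul, mul_assoc]
    simp_rw [hrew]
    have hder : ∀ z : E, ∀ r : ℝ, HasDerivAt
        (fun r : ℝ => k z * (p (z + (-r) • v) * shiftDensity (r • v) z))
        (k z * ((p (z + (-r) • v) * ⟪v, z + (-r) • v⟫ - D (z + (-r) • v))
          * shiftDensity (r • v) z)) r := by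
      intro z r
      have h1 : HasDerivAt (fun r : ℝ => p (z + (-r) • v)) (D (z + (-r) • v) * (-1)) r :=
        HasDerivAt.comp (h₂ := fun r : ℝ => p (z + r • v)) (h := fun r : ℝ => -r) r
          (hpD z (-r)) (hasDerivAt_neg r)
      have h2 : HasDerivAt (fun r : ℝ => shiftDensity (r • v) z)
          (shiftDensity (r • v) z * (⟪v, z⟫ - r * ‖v‖ ^ 2)) r := by
        have h3 : HasDerivAt (fun r : ℝ => r * ⟪v, z⟫ - r ^ 2 * ‖v‖ ^ 2 / 2)
            (⟪v, z⟫ - r * ‖v‖ ^ 2) r := by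
          have := ((hasDerivAt_id r).mul_const ⟪v, z⟫).sub
            ((((hasDerivAt_id r).pow 2).mul_const (‖v‖ ^ 2)).div_const 2)
          refine this.congr_deriv ?_
          simp
          ring
        have := h3.exp
        have e : ∀ r : ℝ, shiftDensity (r • v) z = Real.exp (r * ⟪v, z⟫ - r ^ 2 * ‖v‖ ^ 2 / 2) := by
          intro r
          rw [shiftDensity, real_inner_smul_left, norm_smul, mul_pow, Real.norm_eq_abs, sq_abs]
        simp_rw [e]
        exact this
      have := (h1.mul h2).const_mul (k z)
      refine this.congr_deriv ?_
      rw [inner_add_right, real_inner_smul_right, real_inner_self_eq_norm_sq]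
      ring
    have hres := (hasDerivAt_integral_of_dominated_loc_of_deriv_le (𝕜 := ℝ)
      (μ := stdGaussian E)
      (F := fun r z => k z * (p (z + (-r) • v) * shiftDensity (r • v) z))
      (F' := fun r z => k z * ((p (z + (-r) • v) * ⟪v, z + (-r) • v⟫ - D (z + (-r) • v))
          * shiftDensity (r • v) z)) (x₀ := 0) (s := Metric.ball 0 1)
      (bound := fun z => K * (C * Real.exp (‖v‖ + ‖v‖ * ‖v‖)) * Real.exp ((1 + 2 * ‖v‖) * ‖z‖))
      (Metric.ball_mem_nhds 0 one_pos) ?_ ?_ ?_ ?_ ?_ ?_).2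
    · refine hres.congr_deriv (integral_congr_ae (Filter.Eventually.of_forall fun z => ?_))
      simp [shiftDensity]
    · refine Filter.Eventually.of_forall fun r => Measurable.aestronglyMeasurable ?_
      unfold shiftDensity
      fun_prop
    · refine ((integrable_exp_mul_norm_stdGaussian (E := E) 1).const_mul (K * C)).mono'
        (Measurable.aestronglyMeasurable ?_) (Filter.Eventually.of_forall fun z => ?_)
      · unfold shiftDensity
        fun_prop
      · simp only [neg_zero, zero_smul, add_zero, shiftDensity, inner_zero_left, norm_zero]
        norm_num
        rw [mul_assoc]
        exact mul_le_mul (hkb z) (hpb z) (abs_nonneg _) hK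
    · refine Measurable.aestronglyMeasurable ?_
      unfold shiftDensity
      fun_prop
    · refine Filter.Eventually.of_forall fun z r hr => ?_
      have hr1 : |r| ≤ 1 := by
        have := mem_ball_zero_iff.1 hr
        exact this.le
      have hz' : ‖z + (-r) • v‖ ≤ ‖z‖ + ‖v‖ := by
        refine (norm_add_le _ _).trans ?_
        rw [norm_smul, Real.norm_eq_abs, abs_neg]
        have := mul_le_mul_of_nonneg_right hr1 (norm_nonneg v)
        linarith
      set y := z + (-r) • v
      -- The linear factor is absorbed by `1 + x ≤ exp x`; together with the density bound `exp
      -- (‖v‖‖z‖)` this yields the exponent `(1 + 2‖v‖)‖z‖` of the dominating function.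
      have hb1 : |p y * ⟪v, y⟫ - D y| ≤ C * Real.exp ((‖z‖ + ‖v‖) * (1 + ‖v‖)) := by
        have e1 : |p y * ⟪v, y⟫ - D y| ≤ C * Real.exp ‖y‖ * (‖v‖ * ‖y‖ + 1) := by
          calc |p y * ⟪v, y⟫ - D y| ≤ |p y| * |⟪v, y⟫| + |D y| := by
                rw [← abs_mul]; exact abs_sub _ _
            _ ≤ C * Real.exp ‖y‖ * (‖v‖ * ‖y‖) + C * Real.exp ‖y‖ :=
                add_le_add (mul_le_mul (hpb y) (abs_real_inner_le_norm v y) (abs_nonneg _)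
                  (by positivity)) (hDb y)
            _ = _ := by ring
        refine e1.trans ?_
        rw [mul_assoc]
        refine mul_le_mul_of_nonneg_left ?_ hC
        calc Real.exp ‖y‖ * (‖v‖ * ‖y‖ + 1) ≤ Real.exp ‖y‖ * Real.exp (‖v‖ * ‖y‖) :=
              mul_le_mul_of_nonneg_left (Real.add_one_le_exp _) (Real.exp_nonneg _)
          _ = Real.exp (‖y‖ * (1 + ‖v‖)) := by rw [← Real.exp_add]; ring_nf
          _ ≤ _ := Real.exp_le_exp.2 (mul_le_mul_of_nonneg_right hz' (by positivity))
      have hb2 : |shiftDensity (r • v) z| ≤ Real.exp (‖v‖ * ‖z‖) := by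
        rw [shiftDensity, Real.abs_exp]
        apply Real.exp_le_exp.2
        have h1 := real_inner_le_norm (r • v) z
        have h2 : ‖r • v‖ ≤ ‖v‖ := by
          rw [norm_smul, Real.norm_eq_abs]
          have := mul_le_mul_of_nonneg_right hr1 (norm_nonneg v)
          linarith
        have h3 := mul_le_mul_of_nonneg_right h2 (norm_nonneg z)
        have h4 := sq_nonneg ‖r • v‖
        linarith
      rw [Real.norm_eq_abs, abs_mul, abs_mul, mul_assoc]
      refine mul_le_mul (hkb z) ?_ (by positivity) hK
      refine (mul_le_mul hb1 hb2 (abs_nonneg _) (by positivity)).trans (le_of_eq ?_)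
      rw [mul_assoc, mul_assoc, ← Real.exp_add, ← Real.exp_add]
      ring_nf
    · exact (integrable_exp_mul_norm_stdGaussian _).const_mul _
    · exact Filter.Eventually.of_forall fun z r _ => hder z r
  have h0 := key (fun z => k (z + r₀ • v)) (by fun_prop) (fun z => hkb _)
  have h1 : HasDerivAt (fun r : ℝ => r - r₀) 1 r₀ := (hasDerivAt_id r₀).sub_const r₀
  have h2 := HasDerivAt.comp (h := fun r : ℝ => r - r₀) r₀ (by simpa using h0) h1
  rw [mul_one] at h2
  refine h2.congr_of_eventuallyEq (Filter.Eventually.of_forall fun r => ?_)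
  simp only [Function.comp]
  refine integral_congr_ae (Filter.Eventually.of_forall fun z => ?_)
  simp only
  congr 2
  rw [sub_smul]
  abel

end GaussianCalculus

/-- The Cauchy–Schwarz inequality for real integrals. -/
lemma integral_abs_mul_le_sqrt {α : Type*} [MeasurableSpace α] {μ : Measure α} {X Y : α → ℝ}
    (hX : MemLp X 2 μ) (hY : MemLp Y 2 μ) :
    ∫ a, |X a * Y a| ∂μ ≤ Real.sqrt (∫ a, X a ^ 2 ∂μ) * Real.sqrt (∫ a, Y a ^ 2 ∂μ) := by
  have h := integral_mul_norm_le_Lp_mul_Lq (μ := μ) (f := X) (g := Y) (p := 2) (q := 2)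
    ⟨by norm_num, by norm_num, by norm_num⟩ (by simpa using hX) (by simpa using hY)
  simp only [Real.norm_eq_abs, Real.rpow_two, sq_abs] at h
  simp only [abs_mul, Real.sqrt_eq_rpow]
  exact h

section GaussianCalculus

open scoped RealInnerProductSpace

variable {E : Type*} [NormedAddCommGroup E] [InnerProductSpace ℝ E] [FiniteDimensional ℝ E]
  [MeasurableSpace E] [BorelSpace E]

lemma integrable_of_le_exp_norm {p : E → ℝ} (hp : Measurable p) {C : ℝ}
    (hpb : ∀ z, |p z| ≤ C * Real.exp ‖z‖) : Integrable p (stdGaussian E) := by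
  refine ((integrable_exp_mul_norm_stdGaussian (E := E) 1).const_mul C).mono'
    hp.aestronglyMeasurable (Filter.Eventually.of_forall fun z => ?_)
  simpa using hpb z

lemma pow_le_factorial_mul_exp {x : ℝ} (hx : 0 ≤ x) (n : ℕ) :
    x ^ n ≤ n.factorial * Real.exp x := by
  have := Real.pow_div_factorial_le_exp x hx n
  rwa [div_le_iff₀ (by positivity), mul_comm] at this

lemma memLp_inner_stdGaussian (v : E) (p : ℝ≥0∞) (hp : p ≠ ⊤) :
    MemLp (fun z : E => ⟪v, z⟫) p (stdGaussian E) := by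
  have := (IsGaussian.memLp_id (stdGaussian E) p hp).const_inner (𝕜 := ℝ) v
  simpa using this

lemma integrable_norm_pow_stdGaussian (n : ℕ) :
    Integrable (fun z : E => ‖z‖ ^ n) (stdGaussian E) := by
  refine integrable_of_le_exp_norm (C := n.factorial) (by fun_prop) fun z => ?_
  rw [abs_of_nonneg (by positivity)]
  exact pow_le_factorial_mul_exp (norm_nonneg _) n

lemma hasDerivAt_inner_add_smul (u v z : E) (r : ℝ) :
    HasDerivAt (fun r : ℝ => ⟪u, z + r • v⟫) ⟪u, v⟫ r := by
  simp_rw [inner_add_right, real_inner_smul_right]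
  simpa using ((hasDerivAt_id r).mul_const ⟪u, v⟫).const_add ⟪u, z⟫

/-- Gaussian integration by parts with a smooth weight. -/
lemma integral_mul_inner_stdGaussian {p D : E → ℝ} (v : E) (hp : Measurable p) (hD : Measurable D)
    {C : ℝ} (hpb : ∀ z, |p z| ≤ C * Real.exp ‖z‖) (hDb : ∀ z, |D z| ≤ C * Real.exp ‖z‖)
    (hpD : ∀ z, ∀ r : ℝ, HasDerivAt (fun r : ℝ => p (z + r • v)) (D (z + r • v)) r) :
    ∫ z, (p z * ⟪v, z⟫ - D z) ∂(stdGaussian E) = 0 := by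
  have h := hasDerivAt_integral_stdGaussian (k := fun _ => 1) (K := 1) v (by fun_prop) (by simp)
    hp hD hpb hDb hpD 0
  simp only [one_mul] at h
  exact (h.unique (hasDerivAt_const 0 _))

lemma abs_inner_pow_le_exp (v z : E) (n : ℕ) :
    |⟪v, z⟫ ^ n| ≤ ‖v‖ ^ n * n.factorial * Real.exp ‖z‖ := by
  rw [abs_pow, mul_assoc]
  calc |⟪v, z⟫| ^ n ≤ (‖v‖ * ‖z‖) ^ n := by gcongr; exact abs_real_inner_le_norm v z
    _ = ‖v‖ ^ n * ‖z‖ ^ n := mul_pow _ _ _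
    _ ≤ _ := by gcongr; exact pow_le_factorial_mul_exp (norm_nonneg _) n

lemma integrable_inner_pow_stdGaussian (v : E) (n : ℕ) :
    Integrable (fun z : E => ⟪v, z⟫ ^ n) (stdGaussian E) :=
  integrable_of_le_exp_norm (by fun_prop) fun z => abs_inner_pow_le_exp v z n

/-- Integration by parts with weight `⟪v, z⟫ ^ (n + 1)`; the cases `n = 0` and `n = 2` give the
second and fourth moments. -/
lemma integral_inner_pow_add_two (v : E) (n : ℕ) :
    ∫ z : E, ⟪v, z⟫ ^ (n + 2) ∂(stdGaussian E)
      = (n + 1) * ‖v‖ ^ 2 * ∫ z : E, ⟪v, z⟫ ^ n ∂(stdGaussian E) := by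
  have h := integral_mul_inner_stdGaussian (E := E) (p := fun z => ⟪v, z⟫ ^ (n + 1))
    (D := fun z => (n + 1) * ‖v‖ ^ 2 * ⟪v, z⟫ ^ n) v (by fun_prop) (by fun_prop)
    (C := ‖v‖ ^ (n + 1) * (n + 1).factorial + (n + 1) * ‖v‖ ^ 2 * (‖v‖ ^ n * n.factorial))
    (fun z => ?_) (fun z => ?_) (fun z r => ?_)
  · rw [integral_sub, integral_const_mul] at h
    · rw [← sub_eq_zero, ← h]
      congr 1
    · convert integrable_inner_pow_stdGaussian v (n + 2) using 2
      ring
    · exact (integrable_inner_pow_stdGaussian v n).const_mul _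
  · refine (abs_inner_pow_le_exp v z (n + 1)).trans ?_
    gcongr
    exact le_add_of_nonneg_right (by positivity)
  · rw [abs_mul, abs_of_nonneg (by positivity)]
    refine (mul_le_mul_of_nonneg_left (abs_inner_pow_le_exp v z n) (by positivity)).trans ?_
    rw [← mul_assoc]
    gcongr
    exact le_add_of_nonneg_left (by positivity)
  · refine ((hasDerivAt_inner_add_smul v v z r).pow (n + 1)).congr_deriv ?_
    rw [real_inner_self_eq_norm_sq]
    push_cast
    ring

lemma integral_inner_sq_stdGaussian (v : E) :
    ∫ z : E, ⟪v, z⟫ ^ 2 ∂(stdGaussian E) = ‖v‖ ^ 2 := by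
  have := integral_inner_pow_add_two v 0
  simpa using this

lemma integral_inner_pow_four_stdGaussian (v : E) :
    ∫ z : E, ⟪v, z⟫ ^ 4 ∂(stdGaussian E) = 3 * ‖v‖ ^ 4 := by
  have := integral_inner_pow_add_two v 2
  rw [integral_inner_sq_stdGaussian] at this
  rw [show (4 : ℕ) = 2 + 2 from rfl, this]
  push_cast
  ring

lemma integral_abs_inner_stdGaussian_le (v : E) :
    ∫ z : E, |⟪v, z⟫| ∂(stdGaussian E) ≤ ‖v‖ := by
  have h := integral_abs_mul_le_sqrt (memLp_inner_stdGaussian v 2 (by simp))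
    (memLp_const (μ := stdGaussian E) (1 : ℝ))
  simp only [mul_one, integral_inner_sq_stdGaussian] at h
  simpa using h

lemma integral_norm_sq_stdGaussian :
    ∫ z : E, ‖z‖ ^ 2 ∂(stdGaussian E) = Module.finrank ℝ E := by
  have h : ∀ z : E, ‖z‖ ^ 2 = ∑ i, ⟪stdOrthonormalBasis ℝ E i, z⟫ ^ 2 :=
    fun z => ((stdOrthonormalBasis ℝ E).sum_sq_inner_right z).symm
  simp_rw [h]
  rw [integral_finsetSum _ fun i _ => integrable_inner_pow_stdGaussian _ 2]
  simp [integral_inner_sq_stdGaussian]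

lemma integral_norm_stdGaussian_le :
    ∫ z : E, ‖z‖ ∂(stdGaussian E) ≤ Real.sqrt (Module.finrank ℝ E) := by
  have h := integral_abs_mul_le_sqrt (IsGaussian.memLp_id (stdGaussian E) 2 (by simp)).norm
    (memLp_const (μ := stdGaussian E) (1 : ℝ))
  simp only [mul_one, id, integral_norm_sq_stdGaussian, abs_norm] at h
  simpa using h

/-- The second Hermite polynomial in the direction `u`. -/
noncomputable def hermiteTwo (u z : E) : ℝ := ⟪u, z⟫ ^ 2 - ‖u‖ ^ 2

@[fun_prop]
lemma measurable_hermiteTwo (u : E) : Measurable (hermiteTwo u) := by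
  unfold hermiteTwo; fun_prop

lemma abs_hermiteTwo_le (u z : E) : |hermiteTwo u z| ≤ 3 * ‖u‖ ^ 2 * Real.exp ‖z‖ := by
  have h1 := abs_inner_pow_le_exp u z 2
  have h2 : ‖u‖ ^ 2 ≤ ‖u‖ ^ 2 * Real.exp ‖z‖ :=
    le_mul_of_one_le_right (by positivity) (Real.one_le_exp (norm_nonneg _))
  have h3 := abs_sub (⟪u, z⟫ ^ 2) (‖u‖ ^ 2)
  rw [abs_of_nonneg (sq_nonneg ‖u‖)] at h3
  simp only [Nat.factorial] at h1
  push_cast at h1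
  unfold hermiteTwo
  linarith

lemma integrable_hermiteTwo (u : E) : Integrable (hermiteTwo u) (stdGaussian E) :=
  integrable_of_le_exp_norm (by fun_prop) (abs_hermiteTwo_le u)

lemma integral_hermiteTwo_sq (u : E) :
    ∫ z, hermiteTwo u z ^ 2 ∂(stdGaussian E) = 2 * ‖u‖ ^ 4 := by
  have h : ∀ z : E, hermiteTwo u z ^ 2 = ⟪u, z⟫ ^ 4 - 2 * ‖u‖ ^ 2 * ⟪u, z⟫ ^ 2 + ‖u‖ ^ 4 := by
    intro z; unfold hermiteTwo; ring
  simp_rw [h]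
  have i4 := integrable_inner_pow_stdGaussian u 4
  have i2 := (integrable_inner_pow_stdGaussian u 2).const_mul (2 * ‖u‖ ^ 2)
  have i42 : Integrable (fun z : E => ⟪u, z⟫ ^ 4 - 2 * ‖u‖ ^ 2 * ⟪u, z⟫ ^ 2) (stdGaussian E) :=
    i4.sub i2
  rw [integral_add i42 (integrable_const _), integral_sub i4 i2, integral_const_mul,
    integral_inner_sq_stdGaussian, integral_inner_pow_four_stdGaussian]
  simp
  ring

lemma memLp_hermiteTwo (u : E) : MemLp (hermiteTwo u) 2 (stdGaussian E) := by
  have h1 : MemLp (fun z : E => ⟪u, z⟫ ^ 2) 2 (stdGaussian E) := by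
    rw [memLp_two_iff_integrable_sq (Measurable.aestronglyMeasurable (by fun_prop))]
    simp_rw [← pow_mul]
    exact integrable_inner_pow_stdGaussian u 4
  exact h1.sub (memLp_const _)

lemma hasDerivAt_integral_comp_add {k : E → ℝ} (v : E) (hk : Measurable k) {K : ℝ}
    (hkb : ∀ z, |k z| ≤ K) (r : ℝ) :
    HasDerivAt (fun r : ℝ => ∫ z, k (z + r • v) ∂(stdGaussian E))
      (∫ z, k (z + r • v) * ⟪v, z⟫ ∂(stdGaussian E)) r := by
  have h := hasDerivAt_integral_stdGaussian (p := fun _ => 1) (D := fun _ => 0) (C := 1) v hk hkb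
    (by fun_prop) (by fun_prop) (fun z => by simp) (fun z => by simp; positivity)
    (fun z r => hasDerivAt_const _ _) r
  simpa using h

lemma hasDerivAt_integral_comp_add_mul_inner {k : E → ℝ} (v : E) (hk : Measurable k) {K : ℝ}
    (hkb : ∀ z, |k z| ≤ K) (r : ℝ) :
    HasDerivAt (fun r : ℝ => ∫ z, k (z + r • v) * ⟪v, z⟫ ∂(stdGaussian E))
      (∫ z, k (z + r • v) * hermiteTwo v z ∂(stdGaussian E)) r := by
  have h := hasDerivAt_integral_stdGaussian (p := fun z => ⟪v, z⟫) (D := fun _ => ‖v‖ ^ 2)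
    (C := ‖v‖ + ‖v‖ ^ 2) v hk hkb
    (by fun_prop) (by fun_prop) (fun z => ?_) (fun z => ?_)
    (fun z r => ?_) r
  · refine h.congr_deriv ?_
    simp only [hermiteTwo, sq]
  · have := abs_inner_pow_le_exp v z 1
    simp only [pow_one, Nat.factorial, Nat.cast_one, mul_one] at this
    refine this.trans ?_
    gcongr
    exact le_add_of_nonneg_right (by positivity)
  · rw [abs_of_nonneg (by positivity)]
    refine le_mul_of_le_mul_of_nonneg_right ?_ (le_add_of_nonneg_left (norm_nonneg v))
      (Real.exp_nonneg _)
    exact le_mul_of_one_le_right (by positivity) (Real.one_le_exp (norm_nonneg _))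
  · exact (hasDerivAt_inner_add_smul v v z r).congr_deriv (real_inner_self_eq_norm_sq v)

/-- Averages of a bounded function against the second Hermite polynomial are Lipschitz in the
shift. -/
lemma abs_integral_comp_add_mul_hermiteTwo_sub_le {k : E → ℝ} (u w : E) (hk : Measurable k) {K : ℝ}
    (hkb : ∀ z, |k z| ≤ K) :
    |∫ z, k (z + w) * hermiteTwo u z ∂(stdGaussian E)
        - ∫ z, k z * hermiteTwo u z ∂(stdGaussian E)| ≤ 3.42 * K * ‖u‖ ^ 2 * ‖w‖ := by
  have hK : 0 ≤ K := (abs_nonneg _).trans (hkb 0)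
  -- The new kernel `hermiteTwo u z * ⟪w, z⟫ - 2 ⟪u, z⟫ ⟪u, w⟫` is a mixed third Hermite polynomial.
  -- Bounding its first absolute moment suffices, by the mean value inequality.
  have hder := hasDerivAt_integral_stdGaussian (p := hermiteTwo u)
    (D := fun z => 2 * ⟪u, z⟫ * ⟪u, w⟫)
    (C := 3 * ‖u‖ ^ 2 + 2 * ‖u‖ * |⟪u, w⟫|) w hk hkb (by fun_prop) (by fun_prop) (fun z => ?_)
    (fun z => ?_) (fun z r => ?_)
  · have hI : ∀ r : ℝ, ‖∫ z, k (z + r • w) * (hermiteTwo u z * ⟪w, z⟫ - 2 * ⟪u, z⟫ * ⟪u, w⟫)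
        ∂(stdGaussian E)‖ ≤ 3.42 * K * ‖u‖ ^ 2 * ‖w‖ := by
      intro r
      have i1 : Integrable (fun z => |hermiteTwo u z * ⟪w, z⟫|) (stdGaussian E) :=
        ((memLp_hermiteTwo u).integrable_mul (memLp_inner_stdGaussian w 2 (by simp))).abs
      have i2 : Integrable (fun z => |⟪u, z⟫| * (2 * |⟪u, w⟫|)) (stdGaussian E) :=
        ((memLp_inner_stdGaussian u 1 (by simp)).integrable le_rfl).abs.mul_const _
      calc _ ≤ ∫ z, K * (|hermiteTwo u z * ⟪w, z⟫| + |⟪u, z⟫| * (2 * |⟪u, w⟫|))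
              ∂(stdGaussian E) := by
            refine norm_integral_le_of_norm_le ((i1.add i2).const_mul K)
              (Filter.Eventually.of_forall fun z => ?_)
            rw [Real.norm_eq_abs, abs_mul]
            refine mul_le_mul (hkb _) ?_ (abs_nonneg _) hK
            refine (abs_sub _ _).trans (le_of_eq ?_)
            rw [abs_mul (2 * _), abs_mul 2, abs_two]
            ring
        -- Cauchy–Schwarz with `E (hermiteTwo u)² = 2‖u‖⁴` for the first product; the total `√2 + 2`
        -- is rounded up to `3.42`.
        _ ≤ K * (Real.sqrt 2 * ‖u‖ ^ 2 * ‖w‖ + ‖u‖ * (2 * (‖u‖ * ‖w‖))) := by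
            rw [integral_const_mul, integral_add i1 i2, integral_mul_const]
            refine mul_le_mul_of_nonneg_left (add_le_add ?_ ?_) hK
            · refine (integral_abs_mul_le_sqrt (memLp_hermiteTwo u)
                (memLp_inner_stdGaussian w 2 (by simp))).trans (le_of_eq ?_)
              rw [integral_hermiteTwo_sq, integral_inner_sq_stdGaussian,
                Real.sqrt_sq (norm_nonneg _), Real.sqrt_mul (by norm_num),
                show ‖u‖ ^ 4 = (‖u‖ ^ 2) ^ 2 by ring, Real.sqrt_sq (by positivity)]
            · refine mul_le_mul (integral_abs_inner_stdGaussian_le u) ?_ (by positivity)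
                (norm_nonneg _)
              gcongr
              exact abs_real_inner_le_norm u w
        _ = (Real.sqrt 2 + 2) * (K * ‖u‖ ^ 2 * ‖w‖) := by ring
        _ ≤ 3.42 * (K * ‖u‖ ^ 2 * ‖w‖) := by
            gcongr
            have : Real.sqrt 2 ≤ 1.42 := Real.sqrt_le_iff.2 ⟨by norm_num, by norm_num⟩
            linarith
        _ = _ := by ring
    have := (convex_univ (𝕜 := ℝ) (E := ℝ)).norm_image_sub_le_of_norm_hasDerivWithin_le
      (fun r _ => (hder r).hasDerivWithinAt) (fun r _ => hI r) (Set.mem_univ 0) (Set.mem_univ 1)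
    simpa using this
  · refine (abs_hermiteTwo_le u z).trans ?_
    gcongr
    exact le_add_of_nonneg_right (by positivity)
  · have := abs_inner_pow_le_exp u z 1
    simp only [pow_one, Nat.factorial, Nat.cast_one, mul_one] at this
    rw [abs_mul, abs_mul, abs_two]
    calc 2 * |⟪u, z⟫| * |⟪u, w⟫| ≤ 2 * (‖u‖ * Real.exp ‖z‖) * |⟪u, w⟫| := by gcongr
      _ = 2 * ‖u‖ * |⟪u, w⟫| * Real.exp ‖z‖ := by ring
      _ ≤ _ := by gcongr; exact le_add_of_nonneg_left (by positivity)
  · refine (((hasDerivAt_inner_add_smul u w z r).pow 2).sub_const (‖u‖ ^ 2)).congr_deriv ?_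
    simp

end GaussianCalculus

/-! ### Subgradient fields of convex functions and the Gaussian measure of boundary strips. -/

section ConvexFields

open scoped RealInnerProductSpace

variable {E : Type*} [NormedAddCommGroup E] [InnerProductSpace ℝ E] [MeasurableSpace E]

/-- `n` is a measurable selection of subgradients, of norm at most one, of the function `s`. -/
structure IsSubgradientField (s : E → ℝ) (n : E → E) : Prop where
  measurable_fun : Measurable s
  measurable_field : Measurable n
  norm_le : ∀ x, ‖n x‖ ≤ 1
  le : ∀ x y, s x + ⟪n x, y - x⟫ ≤ s y

lemma IsSubgradientField.sub_le_norm {s : E → ℝ} {n : E → E} (h : IsSubgradientField s n)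
    (x y : E) : s x - s y ≤ ‖x - y‖ := by
  have h1 := h.le x y
  have h2 := real_inner_le_norm (n x) (x - y)
  have h3 := mul_le_mul_of_nonneg_right (h.norm_le x) (norm_nonneg (x - y))
  rw [← neg_sub x y, inner_neg_right] at h1
  linarith

lemma IsSubgradientField.abs_sub_le_norm {s : E → ℝ} {n : E → E} (h : IsSubgradientField s n)
    (x y : E) : |s x - s y| ≤ ‖x - y‖ :=
  abs_le.2 ⟨by have := h.sub_le_norm y x; rw [norm_sub_rev] at this; linarith, h.sub_le_norm x y⟩

/-- Monotonicity of the gradient of an increasing convex function of `s`. -/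
lemma IsSubgradientField.inner_nonneg {s : E → ℝ} {n : E → E} (h : IsSubgradientField s n)
    {ψ : ℝ → ℝ} (hψ : Monotone ψ) (hψ0 : ∀ t, 0 ≤ ψ t) (x y : E) :
    0 ≤ ⟪y - x, ψ (s y) • n y - ψ (s x) • n x⟫ := by
  rw [inner_sub_right, real_inner_smul_right, real_inner_smul_right, real_inner_comm,
    real_inner_comm (n x)]
  have h1 := h.le y x
  have h2 := h.le x y
  rw [← neg_sub y x, inner_neg_right] at h1
  have h3 : ψ (s y) * (s y - s x) ≤ ψ (s y) * ⟪n y, y - x⟫ :=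
    mul_le_mul_of_nonneg_left (by linarith) (hψ0 _)
  have h4 : ψ (s x) * ⟪n x, y - x⟫ ≤ ψ (s x) * (s y - s x) :=
    mul_le_mul_of_nonneg_left (by linarith) (hψ0 _)
  have h5 : 0 ≤ (ψ (s y) - ψ (s x)) * (s y - s x) := by
    rcases le_total (s x) (s y) with hxy | hxy
    · exact mul_nonneg (sub_nonneg.2 (hψ hxy)) (sub_nonneg.2 hxy)
    · exact mul_nonneg_of_nonpos_of_nonpos (sub_nonpos.2 (hψ hxy)) (sub_nonpos.2 hxy)
  linarith

/-- Strong monotonicity in the normal direction, where `ψ` has slope one and is not too small. -/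
lemma IsSubgradientField.sq_le_inner {s : E → ℝ} {n : E → E} (h : IsSubgradientField s n)
    {ψ : ℝ → ℝ} (hψ0 : ∀ t, 0 ≤ ψ t) {δ : ℝ} {x y : E} (hxy : ‖y - x‖ ≤ δ)
    (hy : 2 * δ ≤ ψ (s y)) (hlin : ψ (s y) - ψ (s x) = s y - s x) :
    ⟪n y, y - x⟫ ^ 2 ≤ ⟪y - x, ψ (s y) • n y - ψ (s x) • n x⟫ := by
  have e : ⟪y - x, ψ (s y) • n y - ψ (s x) • n x⟫
      = ψ (s y) * ⟪n y, y - x⟫ - ψ (s x) * ⟪n x, y - x⟫ := by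
    rw [inner_sub_right, real_inner_smul_right, real_inner_smul_right, real_inner_comm,
      real_inner_comm (n x)]
  rw [e]
  have h1 := h.le y x
  have h2 := h.le x y
  rw [← neg_sub y x, inner_neg_right] at h1
  have h4 : ψ (s x) * ⟪n x, y - x⟫ ≤ ψ (s x) * (s y - s x) :=
    mul_le_mul_of_nonneg_left (by linarith) (hψ0 _)
  have h5 : ⟪n y, y - x⟫ ≤ δ := by
    have := real_inner_le_norm (n y) (y - x)
    have := mul_le_mul_of_nonneg_right (h.norm_le y) (norm_nonneg (y - x))
    linarith
  have h6 : s y - s x ≤ δ := (h.sub_le_norm y x).trans hxy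
  -- With `p = ⟪n y, y - x⟫` and `q = s y - s x`, convexity gives `q ≤ p`, and the inner product is
  -- at least `ψ(s y)(p - q) + q²`. This exceeds `p²` exactly when the present product is
  -- nonnegative; `p, q ≤ δ` explains the requirement `ψ(s y) ≥ 2δ`.
  have h7 : 0 ≤ (⟪n y, y - x⟫ - (s y - s x)) * (ψ (s y) - (⟪n y, y - x⟫ + (s y - s x))) :=
    mul_nonneg (by linarith) (by linarith)
  have h8 : ψ (s x) = ψ (s y) - (s y - s x) := by linarith
  rw [h8] at h4 ⊢
  nlinarith

/-- Truncation of the real line to `[0, u]` after a shift. -/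
noncomputable def clamp (c u t : ℝ) : ℝ := min (max (t + c) 0) u

lemma clamp_mono (c u : ℝ) : Monotone (clamp c u) := by
  intro x y hxy
  unfold clamp
  gcongr

lemma clamp_nonneg {u : ℝ} (hu : 0 ≤ u) (c t : ℝ) : 0 ≤ clamp c u t :=
  le_min (le_max_right _ _) hu

lemma clamp_le (c u t : ℝ) : clamp c u t ≤ u := min_le_right _ _

lemma clamp_eq {c u t : ℝ} (h0 : 0 ≤ t + c) (h1 : t + c ≤ u) : clamp c u t = t + c := by
  rw [clamp, max_eq_left h0, min_eq_left h1]

lemma abs_clamp_sub_le (c c' u u' t : ℝ) :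
    |clamp c u t - clamp c' u' t| ≤ max |c - c'| |u - u'| := by
  unfold clamp
  refine (abs_min_sub_min_le_max _ _ _ _).trans (max_le_max ?_ le_rfl)
  refine (abs_max_sub_max_le_max _ _ _ _).trans ?_
  simp

variable [FiniteDimensional ℝ E] [BorelSpace E]

/-- The standard Gaussian measure of a strip of width `a` around the boundary of a convex set. -/
lemma stdGaussian_strip_le {s : E → ℝ} {n : E → E} (h : IsSubgradientField s n) {m : ℝ}
    (hm : 0 ≤ m) (hn : ∀ x, m ≤ ‖n x‖) {a : ℝ} (ha : 0 ≤ a) :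
    m ^ 2 * (stdGaussian E).real {x | 0 ≤ s x ∧ s x ≤ a}
      ≤ Real.sqrt (Module.finrank ℝ E) * a := by
  have hs := h.measurable_fun
  have hnm := h.measurable_field
  set S : Set E := {x | 0 ≤ s x ∧ s x ≤ a}
  have hS : MeasurableSet S :=
    (measurableSet_le measurable_const hs).inter (measurableSet_le hs measurable_const)
  suffices H : ∀ δ : ℝ, 0 < δ → m ^ 2 * (stdGaussian E).real S
      ≤ (a + 3 * δ) * Real.sqrt (Module.finrank ℝ E) by
    refine le_of_forall_pos_le_add fun η hη => ?_
    set R := Real.sqrt (Module.finrank ℝ E)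
    have hR : 0 ≤ R := Real.sqrt_nonneg _
    have := H (η / (3 * (R + 1))) (by positivity)
    have h2 : 3 * (η / (3 * (R + 1))) * R ≤ η := by
      rw [show 3 * (η / (3 * (R + 1))) * R = η * (R / (R + 1)) by field_simp]
      exact mul_le_of_le_one_right hη.le (by rw [div_le_one (by positivity)]; linarith)
    linarith
  intro δ hδ
  -- Points within `δ` of the strip satisfy `-δ ≤ s ≤ a + δ`, so `s + 2δ` is not truncated there; on
  -- the strip itself it is at least `2δ`, as `sq_le_inner` requires.
  set ψ := clamp (2 * δ) (a + 3 * δ)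
  have hψ0 : ∀ t, 0 ≤ ψ t := fun t => clamp_nonneg (by positivity) _ t
  have hψm : Measurable ψ := (clamp_mono _ _).measurable
  set f : E → E := fun z => ψ (s z) • n z
  have hfm : Measurable f := (hψm.comp hs).smul hnm
  have hfb : ∀ z, ‖f z‖ ≤ a + 3 * δ := by
    intro z
    rw [norm_smul, Real.norm_eq_abs, abs_of_nonneg (hψ0 _)]
    have h1 := clamp_le (2 * δ) (a + 3 * δ) (s z)
    have := mul_le_mul h1 (h.norm_le z) (norm_nonneg _) (by positivity)
    linarith
  set b := stdOrthonormalBasis ℝ E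
  have hkb : ∀ k z, |⟪b k, f z⟫| ≤ a + 3 * δ := fun k z => by
    have := abs_real_inner_le_norm (b k) (f z)
    rw [b.norm_eq_one k, one_mul] at this
    exact this.trans (hfb z)
  have hkm : ∀ k, Measurable fun z => ⟪b k, f z⟫ := fun k => by fun_prop
  have hint : ∀ k (v : E), Integrable (fun z => ⟪b k, f (z + v)⟫) (stdGaussian E) := fun k v =>
    Integrable.of_bound (Measurable.aestronglyMeasurable (by fun_prop)) (a + 3 * δ)
      (Filter.Eventually.of_forall fun z => hkb k _)
  -- The right side is the derivative at `0` of the average of `⟪b k, f⟫` shifted along `b k`,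
  -- although `f` need not be differentiable. The difference quotients are nonnegative by
  -- monotonicity and at least `⟪n, b k⟫²` on the strip, so one-sided quotients give the bound.
  have hder : ∀ k, ∫ z, S.indicator (fun z => ⟪n z, b k⟫ ^ 2) z ∂(stdGaussian E)
      ≤ ∫ z, ⟪b k, f z⟫ * ⟪b k, z⟫ ∂(stdGaussian E) := by
    intro k
    have hd := hasDerivAt_integral_comp_add (b k) (hkm k) (hkb k) 0
    simp only [zero_smul, add_zero] at hd
    have hd' := (hasDerivAt_iff_tendsto_slope.1 hd).mono_left
      (nhdsWithin_mono 0 (show Set.Iio (0:ℝ) ⊆ {0}ᶜ from fun x hx => ne_of_lt hx))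
    refine ge_of_tendsto hd' ?_
    have hmem : Set.Ioo (-δ) 0 ∈ nhdsWithin (0:ℝ) (Set.Iio 0) :=
      Ioo_mem_nhdsLT (by linarith)
    filter_upwards [hmem] with r hr
    rw [slope_def_field, zero_smul]
    simp only [add_zero, sub_zero]
    rw [← neg_div_neg_eq, le_div_iff₀ (by linarith [hr.2]), neg_sub,
      ← integral_sub (by simpa using hint k 0) (hint k _), ← integral_mul_const]
    refine integral_mono_of_nonneg (Filter.Eventually.of_forall fun z => ?_)
      ((by simpa using hint k 0 : Integrable (fun z => ⟪b k, f z⟫) _).sub (hint k _))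
      (Filter.Eventually.of_forall fun z => ?_)
    · exact mul_nonneg (Set.indicator_nonneg (fun _ _ => sq_nonneg _) _) (by linarith [hr.2])
    · have e1 : z - (z + r • b k) = (-r) • b k := by rw [neg_smul]; abel
      have e2 : ⟪z - (z + r • b k), f z - f (z + r • b k)⟫
          = (-r) * (⟪b k, f z⟫ - ⟪b k, f (z + r • b k)⟫) := by
        rw [e1, real_inner_smul_left, inner_sub_right]
      have hr0 : 0 < -r := by linarith [hr.2]
      simp only
      by_cases hz : z ∈ S
      · rw [Set.indicator_of_mem hz]
        have hnorm : ‖z - (z + r • b k)‖ ≤ δ := by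
          rw [e1, norm_smul, b.norm_eq_one, Real.norm_eq_abs, abs_of_pos hr0]
          linarith [hr.1]
        have hsz := abs_le.1 ((h.abs_sub_le_norm z (z + r • b k)).trans hnorm)
        have h1 : ψ (s z) = s z + 2 * δ := clamp_eq (by linarith [hz.1]) (by linarith [hz.2])
        have h2 : ψ (s (z + r • b k)) = s (z + r • b k) + 2 * δ :=
          clamp_eq (by linarith [hz.1]) (by linarith [hz.2])
        have := h.sq_le_inner hψ0 hnorm (by rw [h1]; linarith [hz.1]) (by rw [h1, h2]; ring)
        rw [e2, e1, real_inner_smul_right, mul_pow, sq (-r), mul_assoc] at this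
        have := le_of_mul_le_mul_left this hr0
        linarith
      · rw [Set.indicator_of_notMem hz, zero_mul]
        have := h.inner_nonneg (clamp_mono (2 * δ) (a + 3 * δ)) hψ0 (z + r • b k) z
        rw [e2] at this
        exact nonneg_of_mul_nonneg_right this hr0
  have hnint : ∀ k, Integrable (S.indicator (fun z => ⟪n z, b k⟫ ^ 2)) (stdGaussian E) := by
    intro k
    refine Integrable.of_bound (Measurable.aestronglyMeasurable
      (Measurable.indicator (by fun_prop) hS)) 1 (Filter.Eventually.of_forall fun z => ?_)
    refine (norm_indicator_le_norm_self _ _).trans ?_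
    have := abs_real_inner_le_norm (n z) (b k)
    rw [b.norm_eq_one k, mul_one] at this
    rw [Real.norm_eq_abs, abs_of_nonneg (sq_nonneg _), ← sq_abs]
    exact pow_le_one₀ (abs_nonneg _) (this.trans (h.norm_le z))
  have hfz : ∀ k, Integrable (fun z => ⟪b k, f z⟫ * ⟪b k, z⟫) (stdGaussian E) := by
    intro k
    refine Integrable.bdd_mul (c := a + 3 * δ)
      ((memLp_inner_stdGaussian (b k) 1 (by simp)).integrable le_rfl)
      (hkm k).aestronglyMeasurable (Filter.Eventually.of_forall fun z => hkb k z)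
  have hnormint : Integrable (fun z : E => ‖z‖) (stdGaussian E) := by
    simpa using integrable_norm_pow_stdGaussian (E := E) 1
  calc m ^ 2 * (stdGaussian E).real S
      = ∫ z, S.indicator (fun _ => m ^ 2) z ∂(stdGaussian E) := by
        rw [integral_indicator_const _ hS, smul_eq_mul, mul_comm]
    _ ≤ ∫ z, ∑ k, S.indicator (fun z => ⟪n z, b k⟫ ^ 2) z ∂(stdGaussian E) := by
        refine integral_mono_of_nonneg (Filter.Eventually.of_forall fun z =>
          Set.indicator_nonneg (fun _ _ => sq_nonneg _) _)
          (integrable_finsetSum _ fun k _ => hnint k) (Filter.Eventually.of_forall fun z => ?_)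
        simp only
        by_cases hz : z ∈ S
        · simp only [Set.indicator_of_mem hz]
          rw [b.sum_sq_inner_left]
          exact pow_le_pow_left₀ hm (hn z) 2
        · simp [Set.indicator_of_notMem hz]
    _ = ∑ k, ∫ z, S.indicator (fun z => ⟪n z, b k⟫ ^ 2) z ∂(stdGaussian E) :=
        integral_finsetSum _ fun k _ => hnint k
    _ ≤ ∑ k, ∫ z, ⟪b k, f z⟫ * ⟪b k, z⟫ ∂(stdGaussian E) := Finset.sum_le_sum fun k _ => hder k
    -- Together with the previous steps, an integrated form of `E div f(Z) = E⟨f(Z), Z⟩`, whose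
    -- right side is at most `sup ‖f‖ · E‖Z‖`.
    _ = ∫ z, ⟪f z, z⟫ ∂(stdGaussian E) := by
        rw [← integral_finsetSum _ fun k _ => hfz k]
        refine integral_congr_ae (Filter.Eventually.of_forall fun z => ?_)
        simp only
        rw [← b.sum_inner_mul_inner (f z) z]
        simp_rw [real_inner_comm]
    _ ≤ ∫ z, (a + 3 * δ) * ‖z‖ ∂(stdGaussian E) := by
        refine (Real.le_norm_self _).trans (norm_integral_le_of_norm_le (hnormint.const_mul _)
          (Filter.Eventually.of_forall fun z => ?_))
        exact (abs_real_inner_le_norm _ _).trans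
          (mul_le_mul_of_nonneg_right (hfb z) (norm_nonneg _))
    _ ≤ (a + 3 * δ) * Real.sqrt (Module.finrank ℝ E) := by
        rw [integral_const_mul]
        exact mul_le_mul_of_nonneg_left integral_norm_stdGaussian_le (by positivity)

end ConvexFields

/-! ### Standardized families: moments and the truncated empirical covariance. -/

section Standardized

open scoped RealInnerProductSpace

variable {E : Type*} [NormedAddCommGroup E] [InnerProductSpace ℝ E] [FiniteDimensional ℝ E]
  [MeasurableSpace E] [BorelSpace E]

variable {Ω ι : Type*} [MeasurableSpace Ω]

/-- Independent centred random vectors with finite third moments such that those indexed by `S`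
have total covariance equal to the identity. -/
structure IsStandardized (μ : Measure Ω) (S : Finset ι) (ξ : ι → Ω → E) : Prop where
  measurable : ∀ i, Measurable (ξ i)
  indep : iIndepFun ξ μ
  memLp : ∀ i, MemLp (ξ i) 3 μ
  mean : ∀ i, ∫ ω, ξ i ω ∂μ = 0
  cov : ∀ u v : E, ∑ i ∈ S, ∫ ω, ⟪ξ i ω, u⟫ * ⟪ξ i ω, v⟫ ∂μ = ⟪u, v⟫

/-- The sum of the third absolute moments. -/
noncomputable def thirdMoment (μ : Measure Ω) (S : Finset ι) (ξ : ι → Ω → E) : ℝ :=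
  ∑ i ∈ S, ∫ ω, ‖ξ i ω‖ ^ 3 ∂μ

lemma thirdMoment_nonneg (μ : Measure Ω) (S : Finset ι) (ξ : ι → Ω → E) :
    0 ≤ thirdMoment μ S ξ :=
  Finset.sum_nonneg fun _ _ => integral_nonneg fun _ => by positivity

variable {μ : Measure Ω} [IsProbabilityMeasure μ] {S : Finset ι} {ξ : ι → Ω → E}

namespace IsStandardized

lemma integrable_pow_three (h : IsStandardized μ S ξ) (i : ι) :
    Integrable (fun ω => ‖ξ i ω‖ ^ 3) μ := by
  have := (h.memLp i).integrable_norm_pow (p := 3) (by norm_num)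
  simpa using this

lemma memLp_two (h : IsStandardized μ S ξ) (i : ι) : MemLp (ξ i) 2 μ :=
  (h.memLp i).mono_exponent (by norm_num)

lemma integrable_sq (h : IsStandardized μ S ξ) (i : ι) :
    Integrable (fun ω => ‖ξ i ω‖ ^ 2) μ := by
  have := (h.memLp_two i).integrable_norm_pow (p := 2) (by norm_num)
  simpa using this

lemma integrable (h : IsStandardized μ S ξ) (i : ι) : Integrable (ξ i) μ :=
  (h.memLp i).integrable (by norm_num)

lemma memLp_inner (h : IsStandardized μ S ξ) (i : ι) (v : E) :
    MemLp (fun ω => ⟪ξ i ω, v⟫) 2 μ :=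
  (h.memLp_two i).inner_const (𝕜 := ℝ) v

lemma integral_inner_eq_zero (h : IsStandardized μ S ξ) (i : ι) (v : E) :
    ∫ ω, ⟪ξ i ω, v⟫ ∂μ = 0 := by
  have := integral_inner (𝕜 := ℝ) (h.integrable i) v
  rw [h.mean, inner_zero_right] at this
  simp_rw [real_inner_comm] at this ⊢
  exact this

lemma sum_integral_inner_sq (h : IsStandardized μ S ξ) (v : E) :
    ∑ i ∈ S, ∫ ω, ⟪ξ i ω, v⟫ ^ 2 ∂μ = ‖v‖ ^ 2 := by
  rw [← real_inner_self_eq_norm_sq, ← h.cov v v]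
  simp_rw [sq]

lemma measurable_sum (h : IsStandardized μ S ξ) (S' : Finset ι) :
    Measurable fun ω => ∑ i ∈ S', ξ i ω :=
  Finset.measurable_sum _ fun i _ => h.measurable i

lemma integrable_norm_sum (h : IsStandardized μ S ξ) (S' : Finset ι) :
    Integrable (fun ω => ‖∑ i ∈ S', ξ i ω‖) μ :=
  (integrable_finsetSum _ fun i _ => h.integrable i).norm

lemma memLp_two_sum (h : IsStandardized μ S ξ) (S' : Finset ι) :
    MemLp (fun ω => ∑ i ∈ S', ξ i ω) 2 μ :=
  memLp_finsetSum _ fun i _ => h.memLp_two i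

lemma integral_inner_sum_sq (h : IsStandardized μ S ξ) (v : E) :
    ∫ ω, ⟪∑ i ∈ S, ξ i ω, v⟫ ^ 2 ∂μ = ‖v‖ ^ 2 := by
  classical
  have hvar := IndepFun.variance_sum (μ := μ) (X := fun i ω => ⟪ξ i ω, v⟫) (s := S)
    (fun i _ => h.memLp_inner i v) (fun i _ j _ hij =>
      (h.indep.indepFun hij).comp (φ := fun x => ⟪x, v⟫) (ψ := fun x => ⟪x, v⟫)
        (by fun_prop) (by fun_prop))
  have hm := h.measurable
  have hms := h.measurable_sum S
  have e1 : ∀ i, Var[fun ω => ⟪ξ i ω, v⟫; μ] = ∫ ω, ⟪ξ i ω, v⟫ ^ 2 ∂μ := by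
    intro i
    rw [variance_eq_integral (Measurable.aemeasurable (by fun_prop)), h.integral_inner_eq_zero]
    simp
  have e2 : (∑ i ∈ S, fun ω => ⟪ξ i ω, v⟫) = fun ω => ⟪∑ i ∈ S, ξ i ω, v⟫ := by
    ext ω
    simp [sum_inner]
  have e3 : ∫ ω, ⟪∑ i ∈ S, ξ i ω, v⟫ ∂μ = 0 := by
    simp_rw [sum_inner]
    rw [integral_finsetSum _ fun i _ => (h.memLp_inner i v).integrable (by norm_num)]
    exact Finset.sum_eq_zero fun i _ => h.integral_inner_eq_zero i v
  rw [e2, variance_eq_integral (Measurable.aemeasurable (by fun_prop)), e3] at hvar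
  simp only [sub_zero] at hvar
  rw [hvar]
  simp_rw [e1]
  exact h.sum_integral_inner_sq v

lemma integral_norm_sum_sq (h : IsStandardized μ S ξ) :
    ∫ ω, ‖∑ i ∈ S, ξ i ω‖ ^ 2 ∂μ = Module.finrank ℝ E := by
  set b := stdOrthonormalBasis ℝ E
  have e : ∀ ω, ‖∑ i ∈ S, ξ i ω‖ ^ 2 = ∑ k, ⟪∑ i ∈ S, ξ i ω, b k⟫ ^ 2 :=
    fun ω => (b.sum_sq_inner_left _).symm
  simp_rw [e]
  rw [integral_finsetSum _ fun k _ => ((h.memLp_two_sum S).inner_const (𝕜 := ℝ) (b k)).integrable_sq]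
  simp [h.integral_inner_sum_sq]

lemma integral_norm_sum_le (h : IsStandardized μ S ξ) :
    ∫ ω, ‖∑ i ∈ S, ξ i ω‖ ∂μ ≤ Real.sqrt (Module.finrank ℝ E) := by
  have := integral_abs_mul_le_sqrt (h.memLp_two_sum S).norm (memLp_const (μ := μ) (1 : ℝ))
  simp only [mul_one, h.integral_norm_sum_sq, abs_norm] at this
  simpa using this

/-- If it vanished, all summands in `S` would vanish almost surely, against the covariance
condition. Positivity is needed because smoothing widths and truncation levels are multiples of the
third moment. -/
lemma thirdMoment_pos [Nontrivial E] (h : IsStandardized μ S ξ) : 0 < thirdMoment μ S ξ := by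
  refine lt_of_le_of_ne (thirdMoment_nonneg _ _ _) fun h0 => ?_
  have h1 := (Finset.sum_eq_zero_iff_of_nonneg
    (fun i _ => integral_nonneg fun _ => by positivity)).1 h0.symm
  obtain ⟨v, hv⟩ := exists_ne (0 : E)
  have h2 := h.sum_integral_inner_sq v
  rw [Finset.sum_eq_zero] at h2
  · have := norm_pos_iff.2 hv
    nlinarith
  intro i hi
  have h3 := (integral_eq_zero_iff_of_nonneg (fun _ => by positivity)
    (h.integrable_pow_three i)).1 (h1 i hi)
  refine integral_eq_zero_of_ae ?_
  filter_upwards [h3] with ω hω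
  have : ξ i ω = 0 := by simpa using hω
  simp [this]

/-- The truncated empirical covariance is close to the identity in Hilbert–Schmidt norm. -/
lemma exists_covariance_error (h : IsStandardized μ S ξ) {δ : ℝ} (hδ : 0 < δ) :
    ∃ H : Ω → ℝ, Integrable H μ ∧ (∀ ω, 0 ≤ H ω) ∧
      ∫ ω, H ω ∂μ ≤ Real.sqrt (δ * thirdMoment μ S ξ) ∧
      ∀ ω (u : E), ‖u‖ = 1 → 1 - thirdMoment μ S ξ / δ - H ω
        ≤ ∑ i ∈ S, if ‖ξ i ω‖ ≤ δ then ⟪u, ξ i ω⟫ ^ 2 else 0 := by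
  classical
  set b := stdOrthonormalBasis ℝ E
  -- Truncation supplies the fourth moments that the hypotheses do not, with `‖ζ‖⁴ ≤ δ‖ξ‖³`.
  set trunc : E → E := fun x => if ‖x‖ ≤ δ then x else 0
  have htm : Measurable trunc :=
    Measurable.ite (measurableSet_le measurable_norm measurable_const) measurable_id
      measurable_const
  have htn : ∀ x, ‖trunc x‖ ≤ δ := by
    intro x
    simp only [trunc]
    split_ifs with hx
    · exact hx
    · simpa using hδ.le
  have hm := h.measurable
  set ζ : ι → Ω → E := fun i ω => trunc (ξ i ω)
  have hζm : ∀ i, Measurable (ζ i) := fun i => htm.comp (hm i)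
  have hζn : ∀ i ω, ‖ζ i ω‖ ≤ δ := fun i ω => htn _
  have hprod : ∀ i (u v : E), MemLp (fun ω => ⟪u, ζ i ω⟫ * ⟪v, ζ i ω⟫) 2 μ := by
    intro i u v
    refine MemLp.of_bound (Measurable.aestronglyMeasurable (by fun_prop))
      ((‖u‖ * δ) * (‖v‖ * δ)) (Filter.Eventually.of_forall fun ω => ?_)
    rw [norm_mul]
    have h1 : ‖⟪u, ζ i ω⟫‖ ≤ ‖u‖ * δ :=
      (norm_inner_le_norm (𝕜 := ℝ) _ _).trans (by gcongr; exact hζn i ω)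
    have h2 : ‖⟪v, ζ i ω⟫‖ ≤ ‖v‖ * δ :=
      (norm_inner_le_norm (𝕜 := ℝ) _ _).trans (by gcongr; exact hζn i ω)
    exact mul_le_mul h1 h2 (norm_nonneg _) (by positivity)
  have hprodi : ∀ i (u v : E), Integrable (fun ω => ⟪u, ζ i ω⟫ * ⟪v, ζ i ω⟫) μ :=
    fun i u v => (hprod i u v).integrable (by norm_num)
  set e : Fin (Module.finrank ℝ E) → Fin (Module.finrank ℝ E) → ℝ := fun k l =>
    ∑ i ∈ S, ∫ ω, ⟪b k, ζ i ω⟫ * ⟪b l, ζ i ω⟫ ∂μ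
  set m : Fin (Module.finrank ℝ E) → Fin (Module.finrank ℝ E) → Ω → ℝ := fun k l ω =>
    ∑ i ∈ S, ⟪b k, ζ i ω⟫ * ⟪b l, ζ i ω⟫ - e k l
  have hmL : ∀ k l, MemLp (m k l) 2 μ := fun k l =>
    (memLp_finsetSum _ fun i _ => hprod i (b k) (b l)).sub (memLp_const _)
  have hmsq : ∀ k l, ∫ ω, m k l ω ^ 2 ∂μ
      ≤ ∑ i ∈ S, ∫ ω, ⟪b k, ζ i ω⟫ ^ 2 * ⟪b l, ζ i ω⟫ ^ 2 ∂μ := by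
    intro k l
    have hvar := IndepFun.variance_sum (μ := μ) (X := fun i ω => ⟪b k, ζ i ω⟫ * ⟪b l, ζ i ω⟫)
      (s := S) (fun i _ => hprod i _ _) (fun i _ j _ hij =>
        (h.indep.indepFun hij).comp (φ := fun x => ⟪b k, trunc x⟫ * ⟪b l, trunc x⟫)
          (ψ := fun x => ⟪b k, trunc x⟫ * ⟪b l, trunc x⟫) (by fun_prop) (by fun_prop))
    have e2 : (∑ i ∈ S, fun ω => ⟪b k, ζ i ω⟫ * ⟪b l, ζ i ω⟫)
        = fun ω => ∑ i ∈ S, ⟪b k, ζ i ω⟫ * ⟪b l, ζ i ω⟫ := by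
      ext ω
      simp
    rw [e2, variance_eq_integral (Measurable.aemeasurable (by fun_prop)),
      integral_finsetSum _ fun i _ => hprodi i _ _] at hvar
    rw [show ∫ ω, m k l ω ^ 2 ∂μ = _ from hvar]
    refine Finset.sum_le_sum fun i _ => ?_
    refine (variance_le_expectation_sq (hprod i _ _).1).trans (le_of_eq ?_)
    refine integral_congr_ae (Filter.Eventually.of_forall fun ω => ?_)
    simp only [Pi.pow_apply]
    ring
  -- The squared Hilbert–Schmidt norm of the centred truncated covariance. It does not depend on a
  -- direction, so the resulting bound holds for all `u` simultaneously, even for a random `u`.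
  set Q : Ω → ℝ := fun ω => ∑ k, ∑ l, m k l ω ^ 2
  have hQ0 : ∀ ω, 0 ≤ Q ω := fun ω => by positivity
  have hQi : Integrable Q μ :=
    integrable_finsetSum _ fun k _ => integrable_finsetSum _ fun l _ => (hmL k l).integrable_sq
  have hmm : ∀ k l, Measurable (m k l) := fun k l => by fun_prop
  have hQm : Measurable Q := by fun_prop
  have hζ4 : ∀ i k l, Integrable (fun ω => ⟪b k, ζ i ω⟫ ^ 2 * ⟪b l, ζ i ω⟫ ^ 2) μ := by
    intro i k l
    have := (hprod i (b k) (b l)).integrable_sq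
    simpa [mul_pow] using this
  have hQle : ∫ ω, Q ω ∂μ ≤ δ * thirdMoment μ S ξ := by
    calc ∫ ω, Q ω ∂μ = ∑ k, ∑ l, ∫ ω, m k l ω ^ 2 ∂μ := by
          rw [integral_finsetSum _ fun k _ => integrable_finsetSum _ fun l _ =>
            (hmL k l).integrable_sq]
          exact Finset.sum_congr rfl fun k _ =>
            integral_finsetSum _ fun l _ => (hmL k l).integrable_sq
      _ ≤ ∑ k, ∑ l, ∑ i ∈ S, ∫ ω, ⟪b k, ζ i ω⟫ ^ 2 * ⟪b l, ζ i ω⟫ ^ 2 ∂μ :=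
          Finset.sum_le_sum fun k _ => Finset.sum_le_sum fun l _ => hmsq k l
      _ = ∑ i ∈ S, ∑ k, ∑ l, ∫ ω, ⟪b k, ζ i ω⟫ ^ 2 * ⟪b l, ζ i ω⟫ ^ 2 ∂μ := by
          simp_rw [Finset.sum_comm (s := Finset.univ) (t := S)]
      _ = ∑ i ∈ S, ∫ ω, ‖ζ i ω‖ ^ 4 ∂μ := by
          refine Finset.sum_congr rfl fun i _ => ?_
          have e4 : ∀ ω, ‖ζ i ω‖ ^ 4 = ∑ k, ∑ l, ⟪b k, ζ i ω⟫ ^ 2 * ⟪b l, ζ i ω⟫ ^ 2 := by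
            intro ω
            rw [← Finset.sum_mul_sum, b.sum_sq_inner_right]
            ring
          simp_rw [e4]
          rw [integral_finsetSum _ fun k _ => integrable_finsetSum _ fun l _ => hζ4 i k l]
          exact (Finset.sum_congr rfl fun k _ => integral_finsetSum _ fun l _ => hζ4 i k l).symm
      _ ≤ ∑ i ∈ S, δ * ∫ ω, ‖ξ i ω‖ ^ 3 ∂μ := by
          refine Finset.sum_le_sum fun i _ => ?_
          rw [← integral_const_mul]
          refine integral_mono_of_nonneg (Filter.Eventually.of_forall fun _ => by positivity)
            ((h.integrable_pow_three i).const_mul δ) (Filter.Eventually.of_forall fun ω => ?_)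
          simp only
          have h1 : ‖ζ i ω‖ ≤ ‖ξ i ω‖ := by
            simp only [ζ, trunc]
            split_ifs <;> simp
          calc ‖ζ i ω‖ ^ 4 = ‖ζ i ω‖ * ‖ζ i ω‖ ^ 3 := by ring
            _ ≤ δ * ‖ξ i ω‖ ^ 3 := by gcongr; exact hζn i ω
      _ = δ * thirdMoment μ S ξ := by rw [thirdMoment, Finset.mul_sum]
  have hsqrtL : MemLp (fun ω => Real.sqrt (Q ω)) 2 μ := by
    rw [memLp_two_iff_integrable_sq (Measurable.aestronglyMeasurable (by fun_prop))]
    simpa [Real.sq_sqrt (hQ0 _)] using hQi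
  refine ⟨fun ω => Real.sqrt (Q ω), hsqrtL.integrable (by norm_num),
    fun ω => Real.sqrt_nonneg _, ?_, ?_⟩
  · have := integral_abs_mul_le_sqrt hsqrtL (memLp_const (μ := μ) (1 : ℝ))
    simp only [mul_one, abs_of_nonneg (Real.sqrt_nonneg _), Real.sq_sqrt (hQ0 _)] at this
    refine this.trans ?_
    simp only [one_pow, integral_const, probReal_univ, smul_eq_mul, mul_one, Real.sqrt_one]
    exact Real.sqrt_le_sqrt hQle
  · intro ω u hu
    have hterm : ∀ i, (if ‖ξ i ω‖ ≤ δ then ⟪u, ξ i ω⟫ ^ 2 else 0) = ⟪u, ζ i ω⟫ ^ 2 := by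
      intro i
      simp only [ζ, trunc]
      split_ifs <;> simp
    simp_rw [hterm]
    have hexp : ∀ x : E, ⟪u, x⟫ ^ 2 = ∑ k, ∑ l, (⟪u, b k⟫ * ⟪u, b l⟫) * (⟪b k, x⟫ * ⟪b l, x⟫) := by
      intro x
      rw [← b.sum_inner_mul_inner u x, sq, Finset.sum_mul_sum]
      refine Finset.sum_congr rfl fun k _ => Finset.sum_congr rfl fun l _ => ?_
      ring
    have h1 : ∑ i ∈ S, ⟪u, ζ i ω⟫ ^ 2 = ∑ i ∈ S, ∫ ω, ⟪u, ζ i ω⟫ ^ 2 ∂μ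
        + ∑ k, ∑ l, (⟪u, b k⟫ * ⟪u, b l⟫) * m k l ω := by
      have h2 : ∑ i ∈ S, ∫ ω, ⟪u, ζ i ω⟫ ^ 2 ∂μ = ∑ k, ∑ l, (⟪u, b k⟫ * ⟪u, b l⟫) * e k l := by
        simp_rw [hexp, e, Finset.mul_sum]
        have : ∀ i, ∫ ω, ∑ k, ∑ l, (⟪u, b k⟫ * ⟪u, b l⟫) * (⟪b k, ζ i ω⟫ * ⟪b l, ζ i ω⟫) ∂μ
            = ∑ k, ∑ l, (⟪u, b k⟫ * ⟪u, b l⟫) * ∫ ω, ⟪b k, ζ i ω⟫ * ⟪b l, ζ i ω⟫ ∂μ := by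
          intro i
          rw [integral_finsetSum _ fun k _ => integrable_finsetSum _ fun l _ =>
            (hprodi i _ _).const_mul _]
          refine Finset.sum_congr rfl fun k _ => ?_
          rw [integral_finsetSum _ fun l _ => (hprodi i _ _).const_mul _]
          exact Finset.sum_congr rfl fun l _ => integral_const_mul _ _
        simp_rw [this]
        rw [Finset.sum_comm]
        exact Finset.sum_congr rfl fun k _ => Finset.sum_comm
      rw [h2]
      simp_rw [m, mul_sub, Finset.sum_sub_distrib]
      simp_rw [hexp, Finset.mul_sum]
      rw [Finset.sum_comm]
      simp_rw [Finset.sum_comm (s := S) (t := Finset.univ)]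
      ring
    -- The second moment lost by truncation is at most `γ / δ`, since `⟪ξ, u⟫² ≤ ‖ξ‖³ / δ` where
    -- `‖ξ‖ > δ`.
    have h2 : 1 - thirdMoment μ S ξ / δ ≤ ∑ i ∈ S, ∫ ω, ⟪u, ζ i ω⟫ ^ 2 ∂μ := by
      have h3 := h.sum_integral_inner_sq u
      rw [hu, one_pow] at h3
      rw [← h3, thirdMoment, Finset.sum_div, ← Finset.sum_sub_distrib]
      refine Finset.sum_le_sum fun i _ => ?_
      rw [sub_le_iff_le_add, ← integral_div, ← integral_add
        (by simpa [sq] using hprodi i u u) ((h.integrable_pow_three i).div_const δ)]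
      refine integral_mono_of_nonneg (Filter.Eventually.of_forall fun _ => by positivity)
        ((by simpa [sq] using hprodi i u u : Integrable (fun ω => ⟪u, ζ i ω⟫ ^ 2) μ).add
          ((h.integrable_pow_three i).div_const δ)) (Filter.Eventually.of_forall fun ω => ?_)
      simp only [ζ, trunc]
      split_ifs with hle
      · rw [real_inner_comm]
        exact le_add_of_nonneg_right (by positivity)
      · push Not at hle
        simp only [inner_zero_right]
        rw [zero_pow two_ne_zero, zero_add, le_div_iff₀ hδ, ← sq_abs]
        have := abs_real_inner_le_norm (ξ i ω) u
        rw [hu, mul_one] at this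
        calc |⟪ξ i ω, u⟫| ^ 2 * δ ≤ ‖ξ i ω‖ ^ 2 * ‖ξ i ω‖ := by gcongr
          _ = _ := by ring
    -- Cauchy–Schwarz over pairs of indices; the coefficients have squared sum `‖u‖⁴ = 1`.
    have h3 : |∑ k, ∑ l, (⟪u, b k⟫ * ⟪u, b l⟫) * m k l ω| ≤ Real.sqrt (Q ω) := by
      apply Real.abs_le_sqrt
      simp only [Q, ← Finset.sum_product']
      refine (Finset.sum_mul_sq_le_sq_mul_sq _ _ _).trans (le_of_eq ?_)
      have : ∑ x : Fin (Module.finrank ℝ E) × Fin (Module.finrank ℝ E),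
          (⟪u, b x.1⟫ * ⟪u, b x.2⟫) ^ 2 = 1 := by
        simp_rw [mul_pow]
        rw [← Finset.univ_product_univ, Finset.sum_product' (f := fun k l => ⟪u, b k⟫ ^ 2 * ⟪u, b l⟫ ^ 2),
          ← Finset.sum_mul_sum, b.sum_sq_inner_left, hu]
        norm_num
      rw [Finset.univ_product_univ, this, one_mul]
    have h4 := (abs_le.1 h3).1
    rw [h1]
    linarith

end IsStandardized

end Standardized

/-! ### The randomized concentration inequality. -/

section Concentration

open scoped RealInnerProductSpace

variable {E : Type*} [NormedAddCommGroup E] [InnerProductSpace ℝ E] [FiniteDimensional ℝ E]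
  [MeasurableSpace E] [BorelSpace E]

variable {Ω ι : Type*} [MeasurableSpace Ω] {μ : Measure Ω} [IsProbabilityMeasure μ] {S : Finset ι}
  {ξ : ι → Ω → E}

/-- The randomized concentration inequality, for bounded random widths. -/
lemma IsStandardized.concentration (h : IsStandardized μ S ξ) {s : E → ℝ} {n : E → E}
    (hs : IsSubgradientField s n) (hn : ∀ x, ‖n x‖ = 1) {σ : ℝ} (hσ0 : 0 ≤ σ) (hσ1 : σ ≤ 1)
    {Δ : Ω → ℝ} (hΔ : Measurable Δ) {Δ' : ι → Ω → ℝ} (hΔ' : ∀ i, Measurable (Δ' i)) {K : ℝ}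
    (hΔ0 : ∀ ω, 0 ≤ Δ ω) (hΔK : ∀ ω, Δ ω ≤ K) (hΔ'0 : ∀ i ω, 0 ≤ Δ' i ω)
    (hΔ'K : ∀ i ω, Δ' i ω ≤ K)
    (hindep : ∀ i ∈ S, IndepFun (ξ i) (fun ω => (Δ' i ω, ∑ j ∈ S, ξ j ω - ξ i ω)) μ)
    {δ : ℝ} (hδ : 0 < δ) :
    (1 - thirdMoment μ S ξ / δ) * μ.real {ω | -(σ * Δ ω) ≤ s (∑ i ∈ S, ξ i ω)
        ∧ s (∑ i ∈ S, ξ i ω) ≤ Δ ω - σ * Δ ω}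
      ≤ ∫ ω, ‖∑ i ∈ S, ξ i ω‖ * Δ ω ∂μ + ∑ i ∈ S, ∫ ω, ‖ξ i ω‖ * |Δ ω - Δ' i ω| ∂μ
        + 3 * δ * Real.sqrt (Module.finrank ℝ E) + Real.sqrt (δ * thirdMoment μ S ξ) := by
  classical
  obtain ⟨H, hHi, hH0, hHle, hH⟩ := h.exists_covariance_error hδ
  have hm := h.measurable
  have hsm := hs.measurable_fun
  have hnm := hs.measurable_field
  set W : Ω → E := fun ω => ∑ i ∈ S, ξ i ω with hW
  have hWm : Measurable W := h.measurable_sum S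
  have hWi : Integrable (fun ω => ‖W ω‖) μ := h.integrable_norm_sum S
  set G : Set Ω := {ω | -(σ * Δ ω) ≤ s (W ω) ∧ s (W ω) ≤ Δ ω - σ * Δ ω}
  have hG : MeasurableSet G :=
    (measurableSet_le (f := fun ω => -(σ * Δ ω)) (g := fun ω => s (W ω)) (by fun_prop)
      (by fun_prop)).inter (measurableSet_le (f := fun ω => s (W ω))
        (g := fun ω => Δ ω - σ * Δ ω) (by fun_prop) (by fun_prop))
  -- The field of `stdGaussian_strip_le`, moved to the strip `-σa ≤ s ≤ a - σa`. Both the offset and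
  -- the upper cut are Lipschitz in `a` with constant at most one because `0 ≤ σ ≤ 1`, so `f` is
  -- 1-Lipschitz in the width.
  set f : ℝ → E → E := fun a x => clamp (2 * δ + σ * a) (a + 3 * δ) (s x) • n x
  have hfm : Measurable (Function.uncurry f) := by
    simp only [f, clamp, Function.uncurry_def]
    fun_prop
  have hfb : ∀ a, 0 ≤ a → ∀ x, ‖f a x‖ ≤ a + 3 * δ := by
    intro a ha x
    rw [norm_smul, hn, mul_one, Real.norm_eq_abs, abs_of_nonneg (clamp_nonneg (by positivity) _ _)]
    exact clamp_le _ _ _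
  have hfl : ∀ a b x, ‖f a x - f b x‖ ≤ |a - b| := by
    intro a b x
    rw [← sub_smul, norm_smul, hn, mul_one, Real.norm_eq_abs]
    refine (abs_clamp_sub_le _ _ _ _ _).trans (max_le ?_ ?_)
    · rw [show 2 * δ + σ * a - (2 * δ + σ * b) = σ * (a - b) by ring, abs_mul, abs_of_nonneg hσ0]
      exact mul_le_of_le_one_left (abs_nonneg _) hσ1
    · rw [add_sub_add_right_eq_sub]
  -- integrability of the products that occur
  have hprod : ∀ i (a : Ω → ℝ) (Y : Ω → E), Measurable a → Measurable Y → (∀ ω, 0 ≤ a ω) →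
      (∀ ω, a ω ≤ K) → Integrable (fun ω => ⟪ξ i ω, f (a ω) (Y ω)⟫) μ := by
    intro i a Y ha hY ha0 haK
    refine ((h.integrable i).norm.mul_const (K + 3 * δ)).mono' ?_
      (Filter.Eventually.of_forall fun ω => ?_)
    · have : Measurable fun ω => f (a ω) (Y ω) := hfm.comp (ha.prodMk hY)
      exact Measurable.aestronglyMeasurable (by fun_prop)
    · refine (norm_inner_le_norm (𝕜 := ℝ) _ _).trans ?_
      gcongr
      refine (hfb _ (ha0 ω) _).trans ?_
      linarith [haK ω]
  have hxiΔ : ∀ i, Integrable (fun ω => ‖ξ i ω‖ * |Δ ω - Δ' i ω|) μ := by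
    intro i
    have := hΔ' i
    refine ((h.integrable i).norm.mul_const (2 * K)).mono'
      (Measurable.aestronglyMeasurable (by fun_prop)) (Filter.Eventually.of_forall fun ω => ?_)
    rw [norm_mul, norm_norm, Real.norm_eq_abs, abs_abs]
    gcongr
    rw [abs_le]
    constructor <;> linarith [hΔ0 ω, hΔK ω, hΔ'0 i ω, hΔ'K i ω]
  -- the decoupled terms vanish
  have hzero : ∀ i ∈ S, ∫ ω, ⟪ξ i ω, f (Δ' i ω) (W ω - ξ i ω)⟫ ∂μ = 0 := by
    intro i hi
    have hY : Integrable (fun ω => f (Δ' i ω) (W ω - ξ i ω)) μ := by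
      have h1 : Measurable fun ω => f (Δ' i ω) (W ω - ξ i ω) :=
        hfm.comp ((hΔ' i).prodMk (hWm.sub (hm i)))
      refine Integrable.of_bound h1.aestronglyMeasurable (K + 3 * δ)
        (Filter.Eventually.of_forall fun ω => ?_)
      refine (hfb _ (hΔ'0 i ω) _).trans ?_
      linarith [hΔ'K i ω]
    have hind : IndepFun (ξ i) (fun ω => f (Δ' i ω) (W ω - ξ i ω)) μ :=
      (hindep i hi).comp measurable_id hfm
    have e : ∫ ω, ⟪ξ i ω, f (Δ' i ω) (W ω - ξ i ω)⟫ ∂μ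
        = ⟪∫ ω, ξ i ω ∂μ, ∫ ω, f (Δ' i ω) (W ω - ξ i ω) ∂μ⟫ :=
      hind.integral_bilin (h.integrable i) hY (innerSL ℝ)
    rw [e, h.mean, inner_zero_left]
  -- the lower bound for a single summand
  have hterm : ∀ i ∈ S, ∫ ω, G.indicator
      (fun ω => if ‖ξ i ω‖ ≤ δ then ⟪n (W ω), ξ i ω⟫ ^ 2 else 0) ω ∂μ
      ≤ ∫ ω, ⟪ξ i ω, f (Δ ω) (W ω)⟫ ∂μ + ∫ ω, ‖ξ i ω‖ * |Δ ω - Δ' i ω| ∂μ := by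
    intro i hi
    have i1 := hprod i Δ W hΔ hWm hΔ0 hΔK
    have i2 := hprod i (Δ' i) (fun ω => W ω - ξ i ω) (hΔ' i) (hWm.sub (hm i)) (hΔ'0 i) (hΔ'K i)
    have i12 : Integrable (fun ω => ⟪ξ i ω, f (Δ ω) (W ω)⟫ + ‖ξ i ω‖ * |Δ ω - Δ' i ω|) μ :=
      i1.add (hxiΔ i)
    have e0 : ∫ ω, ⟪ξ i ω, f (Δ ω) (W ω)⟫ ∂μ + ∫ ω, ‖ξ i ω‖ * |Δ ω - Δ' i ω| ∂μ
        = ∫ ω, (⟪ξ i ω, f (Δ ω) (W ω)⟫ + ‖ξ i ω‖ * |Δ ω - Δ' i ω|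
            - ⟪ξ i ω, f (Δ' i ω) (W ω - ξ i ω)⟫) ∂μ := by
      rw [integral_sub i12 i2, integral_add i1 (hxiΔ i), hzero i hi, sub_zero]
    rw [e0]
    refine integral_mono_of_nonneg (Filter.Eventually.of_forall fun ω =>
      Set.indicator_nonneg (fun ω _ => by split_ifs <;> positivity) _)
      (i12.sub i2) (Filter.Eventually.of_forall fun ω => ?_)
    -- The change from `(Δ, W)` to `(Δ', W - ξᵢ)` is split: first the point moves at fixed width,
    -- where monotonicity acts, then the width moves at a fixed point, where the Lipschitz bound is
    -- compensated by the added term.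
    have e1 : ⟪ξ i ω, f (Δ ω) (W ω)⟫ + ‖ξ i ω‖ * |Δ ω - Δ' i ω|
        - ⟪ξ i ω, f (Δ' i ω) (W ω - ξ i ω)⟫
        = ⟪ξ i ω, f (Δ ω) (W ω) - f (Δ ω) (W ω - ξ i ω)⟫
          + (⟪ξ i ω, f (Δ ω) (W ω - ξ i ω) - f (Δ' i ω) (W ω - ξ i ω)⟫
            + ‖ξ i ω‖ * |Δ ω - Δ' i ω|) := by
      rw [inner_sub_right, inner_sub_right]; ring
    have e2 : 0 ≤ ⟪ξ i ω, f (Δ ω) (W ω - ξ i ω) - f (Δ' i ω) (W ω - ξ i ω)⟫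
            + ‖ξ i ω‖ * |Δ ω - Δ' i ω| := by
      have h1 := abs_real_inner_le_norm (ξ i ω)
        (f (Δ ω) (W ω - ξ i ω) - f (Δ' i ω) (W ω - ξ i ω))
      have h2 := mul_le_mul_of_nonneg_left (hfl (Δ ω) (Δ' i ω) (W ω - ξ i ω))
        (norm_nonneg (ξ i ω))
      have h3 := (abs_le.1 (h1.trans h2)).1
      linarith
    have hsub : W ω - (W ω - ξ i ω) = ξ i ω := by abel
    have hψ0 : ∀ t, 0 ≤ clamp (2 * δ + σ * Δ ω) (Δ ω + 3 * δ) t := fun t =>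
      clamp_nonneg (add_nonneg (hΔ0 ω) (by positivity)) _ t
    have e3 : 0 ≤ ⟪ξ i ω, f (Δ ω) (W ω) - f (Δ ω) (W ω - ξ i ω)⟫ := by
      have := hs.inner_nonneg (clamp_mono (2 * δ + σ * Δ ω) (Δ ω + 3 * δ)) hψ0
        (W ω - ξ i ω) (W ω)
      rwa [hsub] at this
    simp only
    rw [e1]
    by_cases hω : ω ∈ G
    · rw [Set.indicator_of_mem hω]
      split_ifs with hle
      · have hle' : ‖W ω - (W ω - ξ i ω)‖ ≤ δ := by rwa [hsub]
        have hsz := abs_le.1 ((hs.abs_sub_le_norm (W ω) (W ω - ξ i ω)).trans hle')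
        obtain ⟨hω1, hω2⟩ := hω
        have hp : 0 ≤ σ * Δ ω := mul_nonneg hσ0 (hΔ0 ω)
        have c1 : clamp (2 * δ + σ * Δ ω) (Δ ω + 3 * δ) (s (W ω))
            = s (W ω) + (2 * δ + σ * Δ ω) := clamp_eq (by linarith) (by linarith)
        have c2 : clamp (2 * δ + σ * Δ ω) (Δ ω + 3 * δ) (s (W ω - ξ i ω))
            = s (W ω - ξ i ω) + (2 * δ + σ * Δ ω) := clamp_eq (by linarith) (by linarith)
        have := hs.sq_le_inner hψ0 (x := W ω - ξ i ω) (y := W ω) hle'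
          (by rw [c1]; linarith) (by rw [c1, c2]; ring)
        rw [hsub] at this
        refine this.trans ?_
        change ⟪ξ i ω, f (Δ ω) (W ω) - f (Δ ω) (W ω - ξ i ω)⟫ ≤ _
        linarith
      · linarith
    · rw [Set.indicator_of_notMem hω]
      linarith
  have hquadi : ∀ i, Integrable (G.indicator
      (fun ω => if ‖ξ i ω‖ ≤ δ then ⟪n (W ω), ξ i ω⟫ ^ 2 else 0)) μ := by
    intro i
    refine (h.integrable_sq i).mono' (Measurable.aestronglyMeasurable
      (Measurable.indicator (Measurable.ite (measurableSet_le (by fun_prop) measurable_const)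
        (by fun_prop) measurable_const) hG)) (Filter.Eventually.of_forall fun ω => ?_)
    refine (norm_indicator_le_norm_self _ _).trans ?_
    have := abs_real_inner_le_norm (n (W ω)) (ξ i ω)
    rw [hn, one_mul] at this
    split_ifs
    · rw [norm_pow, Real.norm_eq_abs]
      gcongr
    · simp
  -- summation
  have hlow : (1 - thirdMoment μ S ξ / δ) * μ.real G - ∫ ω, H ω ∂μ
      ≤ ∑ i ∈ S, ∫ ω, G.indicator
          (fun ω => if ‖ξ i ω‖ ≤ δ then ⟪n (W ω), ξ i ω⟫ ^ 2 else 0) ω ∂μ := by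
    rw [← integral_finsetSum _ fun i _ => hquadi i]
    have e : (1 - thirdMoment μ S ξ / δ) * μ.real G
        = ∫ ω, G.indicator (fun _ => 1 - thirdMoment μ S ξ / δ) ω ∂μ := by
      rw [integral_indicator_const _ hG, smul_eq_mul, mul_comm]
    rw [e, ← integral_sub ((integrable_const _).indicator hG) hHi]
    refine integral_mono (((integrable_const _).indicator hG).sub hHi)
      (integrable_finsetSum _ fun i _ => hquadi i) fun ω => ?_
    simp only
    by_cases hω : ω ∈ G
    · simp only [Set.indicator_of_mem hω]
      exact hH ω _ (hn _)
    · simp only [Set.indicator_of_notMem hω, Finset.sum_const_zero, zero_sub]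
      linarith [hH0 ω]
  have hup : ∑ i ∈ S, ∫ ω, ⟪ξ i ω, f (Δ ω) (W ω)⟫ ∂μ
      ≤ ∫ ω, ‖W ω‖ * Δ ω ∂μ + 3 * δ * Real.sqrt (Module.finrank ℝ E) := by
    rw [← integral_finsetSum _ fun i _ => hprod i Δ W hΔ hWm hΔ0 hΔK]
    have iWΔ : Integrable (fun ω => ‖W ω‖ * Δ ω) μ := by
      refine (hWi.mul_const K).mono' (Measurable.aestronglyMeasurable (by fun_prop))
        (Filter.Eventually.of_forall fun ω => ?_)
      rw [norm_mul, norm_norm, Real.norm_eq_abs, abs_of_nonneg (hΔ0 ω)]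
      gcongr
      exact hΔK ω
    calc ∫ ω, ∑ i ∈ S, ⟪ξ i ω, f (Δ ω) (W ω)⟫ ∂μ
        ≤ ∫ ω, (‖W ω‖ * Δ ω + ‖W ω‖ * (3 * δ)) ∂μ := by
          refine integral_mono (integrable_finsetSum _ fun i _ => hprod i Δ W hΔ hWm hΔ0 hΔK)
            (iWΔ.add (hWi.mul_const _)) fun ω => ?_
          simp only
          rw [← sum_inner, ← mul_add]
          refine (real_inner_le_norm _ _).trans ?_
          gcongr
          exact hfb _ (hΔ0 ω) _
      _ = ∫ ω, ‖W ω‖ * Δ ω ∂μ + 3 * δ * ∫ ω, ‖W ω‖ ∂μ := by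
          rw [integral_add iWΔ (hWi.mul_const _), integral_mul_const, mul_comm (3 * δ)]
      _ ≤ _ := by
          gcongr
          exact h.integral_norm_sum_le
  have hsum := Finset.sum_le_sum hterm
  rw [Finset.sum_add_distrib] at hsum
  linarith

end Concentration

/-! ### Smoothed indicators of closed convex sets, built from the metric projection. -/

section Smoothing

open scoped RealInnerProductSpace

variable {E : Type*} [NormedAddCommGroup E] [InnerProductSpace ℝ E]

/-- `h` is a smoothed indicator function of `A`, supported in the `ε`-neighbourhood of `A`, with
gradient `g`. -/
structure IsSmoothing (A : Set E) (ε : ℝ) (h : E → ℝ) (g : E → E) : Prop where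
  nonneg : ∀ x, 0 ≤ h x
  le_one : ∀ x, h x ≤ 1
  eq_one : ∀ x ∈ A, h x = 1
  eq_zero : ∀ x, ε ≤ Metric.infDist x A → h x = 0
  convex : ∀ t, Convex ℝ {x | t ≤ h x}
  hasFDerivAt : ∀ x, HasFDerivAt h (innerSL ℝ (g x)) x
  lipschitz : ∀ x y, ‖g x - g y‖ ≤ 4 / ε ^ 2 * ‖x - y‖
  grad_eq_zero_of_mem : ∀ x ∈ A, g x = 0
  grad_eq_zero : ∀ x, ε ≤ Metric.infDist x A → g x = 0

namespace IsSmoothing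

variable {A : Set E} {ε : ℝ} {h : E → ℝ} {g : E → E}

lemma continuous (H : IsSmoothing A ε h g) : Continuous h :=
  continuous_iff_continuousAt.2 fun x => (H.hasFDerivAt x).continuousAt

lemma continuous_grad (H : IsSmoothing A ε h g) : Continuous g := by
  have : LipschitzWith (Real.toNNReal (4 / ε ^ 2)) g := LipschitzWith.of_dist_le_mul fun x y => by
    rw [dist_eq_norm, dist_eq_norm, Real.coe_toNNReal _ (by positivity)]
    exact H.lipschitz x y
  exact this.continuous

end IsSmoothing

/-- The profile of the gradient of the smoothed indicator. -/
noncomputable def tent (ε r : ℝ) : ℝ := max 0 (min r (ε - r))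

lemma tent_nonneg (ε r : ℝ) : 0 ≤ tent ε r := le_max_left _ _

lemma tent_le {r : ℝ} (hr : 0 ≤ r) (ε : ℝ) : tent ε r ≤ r := max_le hr (min_le_left _ _)

lemma abs_tent_sub_le (ε r s : ℝ) : |tent ε r - tent ε s| ≤ |r - s| := by
  unfold tent
  refine (abs_max_sub_max_le_max _ _ _ _).trans (max_le (by simp) ?_)
  refine (abs_min_sub_min_le_max _ _ _ _).trans (max_le le_rfl ?_)
  rw [show ε - r - (ε - s) = -(r - s) by ring, abs_neg]

lemma tent_eq_zero {ε r : ℝ} (h : ε ≤ r) : tent ε r = 0 :=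
  max_eq_left ((min_le_right _ _).trans (by linarith))

/-- The radial truncation of a vector according to `tent`. -/
noncomputable def radialTent (ε : ℝ) (v : E) : E := (tent ε ‖v‖ / ‖v‖) • v

lemma norm_radialTent (ε : ℝ) (v : E) : ‖radialTent ε v‖ = tent ε ‖v‖ := by
  rw [radialTent, norm_smul, norm_div, norm_norm, Real.norm_eq_abs,
    abs_of_nonneg (tent_nonneg _ _)]
  rcases eq_or_ne v 0 with rfl | hv
  · simp [tent]
  · field_simp [norm_ne_zero_iff.2 hv]

/-- In `‖a - b‖² = (‖a‖ - ‖b‖)² + 2(‖a‖‖b‖ - ⟪a, b⟫)` the first term does not grow because `tent` is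
1-Lipschitz, and the second is multiplied by scaling factors at most one. -/
lemma norm_radialTent_sub_le (ε : ℝ) (a b : E) :
    ‖radialTent ε a - radialTent ε b‖ ≤ ‖a - b‖ := by
  rcases eq_or_ne a 0 with rfl | ha
  · simp only [radialTent, smul_zero, zero_sub, norm_neg]
    exact (norm_radialTent ε b).le.trans (tent_le (norm_nonneg _) _)
  rcases eq_or_ne b 0 with rfl | hb
  · simp only [radialTent, smul_zero, sub_zero]
    exact (norm_radialTent ε a).le.trans (tent_le (norm_nonneg _) _)
  have ha' := norm_pos_iff.2 ha
  have hb' := norm_pos_iff.2 hb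
  refine abs_le_of_sq_le_sq' ?_ (norm_nonneg _) |>.2
  rw [norm_sub_sq_real, norm_sub_sq_real, norm_radialTent, norm_radialTent, radialTent, radialTent,
    real_inner_smul_left, real_inner_smul_right]
  have hle := real_inner_le_norm a b
  set p := tent ε ‖a‖
  set q := tent ε ‖b‖
  have hp : 0 ≤ p := tent_nonneg _ _
  have hq : 0 ≤ q := tent_nonneg _ _
  have hpa : p / ‖a‖ ≤ 1 := by rw [div_le_one ha']; exact tent_le ha'.le _
  have hqb : q / ‖b‖ ≤ 1 := by rw [div_le_one hb']; exact tent_le hb'.le _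
  have h1 : (p - q) ^ 2 ≤ (‖a‖ - ‖b‖) ^ 2 := sq_le_sq.2 (abs_tent_sub_le _ _ _)
  have h2 : (p / ‖a‖) * (q / ‖b‖) * (‖a‖ * ‖b‖ - ⟪a, b⟫) ≤ 1 * (‖a‖ * ‖b‖ - ⟪a, b⟫) :=
    mul_le_mul_of_nonneg_right (mul_le_one₀ hpa (by positivity) hqb) (by linarith)
  have h3 : (p / ‖a‖) * (q / ‖b‖) * (‖a‖ * ‖b‖) = p * q := by field_simp
  nlinarith

lemma hasDerivAt_max_zero_sq (x : ℝ) :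
    HasDerivAt (fun x : ℝ => (max x 0) ^ 2) (2 * max x 0) x := by
  rcases lt_trichotomy x 0 with hx | rfl | hx
  · rw [max_eq_right hx.le, mul_zero]
    refine (hasDerivAt_const x (0:ℝ)).congr_of_eventuallyEq ?_
    filter_upwards [Iio_mem_nhds hx] with y hy
    rw [max_eq_right (le_of_lt hy)]
    norm_num
  · rw [max_self, mul_zero, hasDerivAt_iff_isLittleO]
    simp only [max_self, sub_zero, smul_zero]
    have : (fun x : ℝ => x ^ 2) =o[nhds 0] fun x => x := by
      simpa using Asymptotics.isLittleO_pow_id (𝕜 := ℝ) one_lt_two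
    refine Asymptotics.IsBigO.trans_isLittleO ?_ this
    refine Asymptotics.IsBigO.of_bound 1 (Filter.Eventually.of_forall fun y => ?_)
    have h1 : |max y 0| ≤ |y| := by
      rw [abs_of_nonneg (le_max_right _ _)]
      exact max_le (le_abs_self _) (abs_nonneg _)
    simp only [one_mul, norm_pow, Real.norm_eq_abs]
    rw [show ((0:ℝ) ^ 2) = 0 by norm_num, sub_zero, abs_pow]
    gcongr
  · rw [max_eq_left hx.le]
    have := (hasDerivAt_id x).pow 2
    simp only [id, Nat.cast_ofNat, mul_one] at this
    refine (this.congr_deriv (by norm_num)).congr_of_eventuallyEq ?_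
    filter_upwards [Ioi_mem_nhds hx] with y hy
    rw [max_eq_left (le_of_lt hy)]
    rfl

/-- The radial profile of the smoothed indicator. -/
noncomputable def profile (ε r : ℝ) : ℝ :=
  1 - 4 / ε ^ 2 * (r ^ 2 / 2 - (max (r - ε / 2) 0) ^ 2 + (max (r - ε) 0) ^ 2 / 2)

/-- Written with positive parts, `tent` has an explicit antiderivative; `profile` is made from it.
-/
lemma tent_eq {ε r : ℝ} (hε : 0 < ε) (hr : 0 ≤ r) :
    tent ε r = r - 2 * max (r - ε / 2) 0 + max (r - ε) 0 := by
  unfold tent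
  rcases le_total r (ε / 2) with h1 | h1
  · rw [max_eq_right (by linarith : r - ε / 2 ≤ 0), max_eq_right (by linarith : r - ε ≤ 0),
      min_eq_left (by linarith), max_eq_right hr]
    ring
  rcases le_total r ε with h2 | h2
  · rw [max_eq_left (by linarith : 0 ≤ r - ε / 2), max_eq_right (by linarith : r - ε ≤ 0),
      min_eq_right (by linarith), max_eq_right (by linarith)]
    ring
  · rw [max_eq_left (by linarith : 0 ≤ r - ε / 2), max_eq_left (by linarith : 0 ≤ r - ε),
      min_eq_right (by linarith), max_eq_left (by linarith)]
    ring

lemma hasDerivAt_profile {ε r : ℝ} (hε : 0 < ε) (hr : 0 ≤ r) :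
    HasDerivAt (profile ε) (-(4 / ε ^ 2 * tent ε r)) r := by
  have h1 : HasDerivAt (fun r : ℝ => r ^ 2 / 2) r r := by
    refine (((hasDerivAt_id r).pow 2).div_const 2).congr_deriv ?_
    simp
  have h2 : HasDerivAt (fun r : ℝ => (max (r - ε / 2) 0) ^ 2) (2 * max (r - ε / 2) 0 * 1) r :=
    HasDerivAt.comp (h₂ := fun x : ℝ => (max x 0) ^ 2) (h := fun r : ℝ => r - ε / 2) r
      (hasDerivAt_max_zero_sq (r - ε / 2)) ((hasDerivAt_id' r).sub_const _)
  have h3 : HasDerivAt (fun r : ℝ => (max (r - ε) 0) ^ 2) (2 * max (r - ε) 0 * 1) r :=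
    HasDerivAt.comp (h₂ := fun x : ℝ => (max x 0) ^ 2) (h := fun r : ℝ => r - ε) r
      (hasDerivAt_max_zero_sq (r - ε)) ((hasDerivAt_id' r).sub_const _)
  have h4 := (((h1.sub h2).add (h3.div_const 2)).const_mul (4 / ε ^ 2)).const_sub 1
  refine (h4.congr_deriv ?_).congr_of_eventuallyEq (Filter.Eventually.of_forall fun r => ?_)
  · rw [tent_eq hε hr]; ring
  · simp [profile]

lemma profile_zero {ε : ℝ} (hε : 0 < ε) : profile ε 0 = 1 := by
  rw [profile, max_eq_right (by linarith), max_eq_right (by linarith)]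
  ring

lemma profile_of_le {ε r : ℝ} (hε : 0 < ε) (hr : r ≤ ε / 2) :
    profile ε r = 1 - 4 / ε ^ 2 * (r ^ 2 / 2) := by
  rw [profile, max_eq_right (by linarith), max_eq_right (by linarith)]
  ring

lemma profile_eq_zero {ε r : ℝ} (hε : 0 < ε) (hr : ε ≤ r) : profile ε r = 0 := by
  rw [profile, max_eq_left (by linarith), max_eq_left (by linarith)]
  field_simp
  ring

lemma profile_antitoneOn {ε : ℝ} (hε : 0 < ε) : AntitoneOn (profile ε) (Set.Ici 0) := by
  refine antitoneOn_of_deriv_nonpos (convex_Ici 0)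
    (fun r hr => (hasDerivAt_profile hε hr).continuousAt.continuousWithinAt)
    (fun r hr => ?_) (fun r hr => ?_)
  · rw [interior_Ici] at hr
    exact (hasDerivAt_profile hε (le_of_lt hr)).differentiableAt.differentiableWithinAt
  · rw [interior_Ici] at hr
    rw [(hasDerivAt_profile hε (le_of_lt hr)).deriv]
    have := tent_nonneg ε r
    have : 0 ≤ 4 / ε ^ 2 * tent ε r := by positivity
    linarith

lemma profile_nonneg {ε r : ℝ} (hε : 0 < ε) (hr : 0 ≤ r) : 0 ≤ profile ε r := by
  rw [← profile_eq_zero hε (le_max_right r ε)]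
  exact profile_antitoneOn hε hr (hr.trans (le_max_left _ _)) (le_max_left _ _)

lemma profile_le_one {ε r : ℝ} (hε : 0 < ε) (hr : 0 ≤ r) : profile ε r ≤ 1 := by
  rw [← profile_zero hε]
  exact profile_antitoneOn hε (Set.mem_Ici.2 le_rfl) hr hr

variable [CompleteSpace E]

/-- The vector from the metric projection onto a closed convex set to the point. -/
lemma exists_projection_residual {A : Set E} (hA : Convex ℝ A) (hc : IsClosed A)
    (hne : A.Nonempty) :
    ∃ v : E → E, (∀ x, ‖v x‖ = Metric.infDist x A) ∧
      (∀ x y, ‖v x - v y‖ ^ 2 ≤ ⟪v x - v y, x - y⟫) ∧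
      ∀ x, HasFDerivAt (fun x => ‖v x‖ ^ 2 / 2) (innerSL ℝ (v x)) x := by
  have hex : ∀ x, ∃ p ∈ A, ‖x - p‖ = ⨅ w : A, ‖x - w‖ := fun x =>
    exists_norm_eq_iInf_of_complete_convex hne hc.isComplete hA x
  choose p hpA hp using hex
  have hineq : ∀ x, ∀ w ∈ A, ⟪x - p x, w - p x⟫ ≤ 0 := fun x =>
    (norm_eq_iInf_iff_real_inner_le_zero hA (hpA x)).1 (hp x)
  have hmin : ∀ x, ∀ w ∈ A, ‖x - p x‖ ≤ ‖x - w‖ := by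
    intro x w hw
    rw [hp]
    exact ciInf_le ⟨0, by rintro _ ⟨w, rfl⟩; positivity⟩ (⟨w, hw⟩ : A)
  have hfirm : ∀ x y, ‖(x - p x) - (y - p y)‖ ^ 2 ≤ ⟪(x - p x) - (y - p y), x - y⟫ := by
    intro x y
    have h1 := hineq x (p y) (hpA y)
    have h2 := hineq y (p x) (hpA x)
    have h3 : x - y = ((x - p x) - (y - p y)) + (p x - p y) := by abel
    have h4 : ⟪(x - p x) - (y - p y), p x - p y⟫
        = -⟪x - p x, p y - p x⟫ - ⟪y - p y, p x - p y⟫ := by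
      rw [inner_sub_left, ← inner_neg_right, neg_sub]
    conv_rhs => rw [h3, inner_add_right, real_inner_self_eq_norm_sq, h4]
    linarith
  refine ⟨fun x => x - p x, fun x => ?_, hfirm, fun x => ?_⟩
  · refine le_antisymm ?_ ?_
    · refine (Metric.le_infDist hne).2 fun w hw => ?_
      rw [dist_eq_norm]
      exact hmin x w hw
    · rw [← dist_eq_norm]
      exact Metric.infDist_le_dist_of_mem (hpA x)
  -- Comparing `y` with the projection of `x` bounds the first-order error above by `‖y - x‖² / 2`.
  -- Exchanging `x` and `y` and using monotonicity of the residual gives the lower bound.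
  · have hup : ∀ x y, ‖y - p y‖ ^ 2 / 2 - ‖x - p x‖ ^ 2 / 2 - ⟪x - p x, y - x⟫
        ≤ ‖y - x‖ ^ 2 / 2 := by
      intro x y
      have h1 := hmin y (p x) (hpA x)
      have h2 : y - p x = (x - p x) + (y - x) := by abel
      have h3 : ‖y - p y‖ ^ 2 ≤ ‖y - p x‖ ^ 2 := by gcongr
      rw [h2, norm_add_sq_real] at h3
      linarith
    have hlow : ∀ x y, -(‖y - x‖ ^ 2 / 2)
        ≤ ‖y - p y‖ ^ 2 / 2 - ‖x - p x‖ ^ 2 / 2 - ⟪x - p x, y - x⟫ := by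
      intro x y
      have h1 := hup y x
      have h2 := (sq_nonneg _).trans (hfirm y x)
      rw [inner_sub_left] at h2
      rw [← neg_sub y x, inner_neg_right, norm_neg] at h1
      linarith
    rw [hasFDerivAt_iff_isLittleO]
    have : (fun y : E => ‖y - x‖ ^ 2) =o[nhds x] fun y => y - x := by
      have h1 : (fun y : E => ‖y‖ ^ 2) =o[nhds 0] fun y => y :=
        Asymptotics.isLittleO_norm_pow_id one_lt_two
      have h2 : Filter.Tendsto (fun y : E => y - x) (nhds x) (nhds 0) := by
        have : Filter.Tendsto (fun y : E => y - x) (nhds x) (nhds (x - x)) :=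
          Filter.Tendsto.sub_const Filter.tendsto_id x
        rwa [sub_self] at this
      exact h1.comp_tendsto h2
    refine Asymptotics.IsBigO.trans_isLittleO ?_ this
    refine Asymptotics.IsBigO.of_bound (1 / 2) (Filter.Eventually.of_forall fun y => ?_)
    rw [Real.norm_eq_abs, innerSL_apply_apply, norm_pow, norm_norm, abs_le]
    constructor
    · linarith [hlow x y]
    · linarith [hup x y]

/-- Combine the nearest points of `x` and `y` with the same weights. This makes the smoothed
indicator quasiconcave. -/
lemma convex_infDist_le {A : Set E} (hA : Convex ℝ A) (hc : IsClosed A) (hne : A.Nonempty)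
    {x y : E} {a b : ℝ} (ha : 0 ≤ a) (hb : 0 ≤ b) (hab : a + b = 1) :
    Metric.infDist (a • x + b • y) A ≤ max (Metric.infDist x A) (Metric.infDist y A) := by
  obtain ⟨p, hp, hpx⟩ := exists_norm_eq_iInf_of_complete_convex hne hc.isComplete hA x
  obtain ⟨q, hq, hqy⟩ := exists_norm_eq_iInf_of_complete_convex hne hc.isComplete hA y
  have hd : ∀ (x p : E), p ∈ A → ‖x - p‖ = ⨅ w : A, ‖x - w‖ → ‖x - p‖ ≤ Metric.infDist x A := by
    intro x p _ hpx
    refine (Metric.le_infDist hne).2 fun w hw => ?_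
    rw [dist_eq_norm, hpx]
    exact ciInf_le ⟨0, by rintro _ ⟨w, rfl⟩; positivity⟩ (⟨w, hw⟩ : A)
  have h1 := hd x p hp hpx
  have h2 := hd y q hq hqy
  refine (Metric.infDist_le_dist_of_mem (hA hp hq ha hb hab)).trans ?_
  rw [dist_eq_norm, show a • x + b • y - (a • p + b • q) = a • (x - p) + b • (y - q) by
    simp only [smul_sub]; abel]
  refine (norm_add_le _ _).trans ?_
  rw [norm_smul, norm_smul, Real.norm_eq_abs, Real.norm_eq_abs, abs_of_nonneg ha, abs_of_nonneg hb]
  set M := max (Metric.infDist x A) (Metric.infDist y A)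
  have h3 := mul_le_mul_of_nonneg_left (h1.trans (le_max_left _ (Metric.infDist y A))) ha
  have h4 := mul_le_mul_of_nonneg_left (h2.trans (le_max_right (Metric.infDist x A) _)) hb
  have h5 : a * M + b * M = M := by rw [← add_mul, hab, one_mul]
  linarith

/-- A function of the distance `r` to `A`: `1 - 2r²/ε²` up to `ε/2`, then `2(1 - r/ε)²` up to `ε`.
Its gradient is `-4/ε²` times `radialTent` of the projection residual, a composition of two
nonexpansive maps, whence the Lipschitz constant `4/ε²`. -/
lemma exists_isSmoothing {A : Set E} (hA : Convex ℝ A) (hc : IsClosed A) (hne : A.Nonempty)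
    {ε : ℝ} (hε : 0 < ε) : ∃ h g, IsSmoothing A ε h g := by
  obtain ⟨v, hv, hfirm, hder⟩ := exists_projection_residual hA hc hne
  have hlip : ∀ x y, ‖v x - v y‖ ≤ ‖x - y‖ := by
    intro x y
    have h1 := (hfirm x y).trans (real_inner_le_norm _ _)
    rcases (norm_nonneg (v x - v y)).eq_or_lt with h0 | h0
    · rw [← h0]; positivity
    · rw [sq] at h1
      exact le_of_mul_le_mul_left h1 h0
  have hcont : Continuous v := by
    have : LipschitzWith 1 v := LipschitzWith.of_dist_le_mul fun x y => by
      simpa [dist_eq_norm] using hlip x y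
    exact this.continuous
  have hmem : ∀ x ∈ A, v x = 0 := fun x hx => by
    rw [← norm_eq_zero, hv, Metric.infDist_zero_of_mem hx]
  refine ⟨fun x => profile ε ‖v x‖, fun x => -((4 / ε ^ 2) • radialTent ε (v x)), ?_⟩
  refine ⟨fun x => profile_nonneg hε (norm_nonneg _), fun x => profile_le_one hε (norm_nonneg _),
    fun x hx => ?_, fun x hx => ?_, fun t => ?_, fun x => ?_, fun x y => ?_, fun x hx => ?_,
    fun x hx => ?_⟩
  · simp only [hmem x hx, norm_zero, profile_zero hε]
  · exact profile_eq_zero hε (by rwa [hv])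
  · intro x hx y hy a b ha hb hab
    simp only [Set.mem_ofPred_eq] at hx hy ⊢
    have h1 := convex_infDist_le hA hc hne (x := x) (y := y) ha hb hab
    rw [← hv, ← hv, ← hv] at h1
    refine le_trans ?_ (profile_antitoneOn hε (Set.mem_Ici.2 (norm_nonneg _))
      (Set.mem_Ici.2 ((norm_nonneg _).trans h1)) h1)
    rcases max_choice ‖v x‖ ‖v y‖ with h2 | h2 <;> rw [h2] <;> assumption
  -- The distance may fail to be differentiable on the boundary of `A`, but close to `A` the profile
  -- involves only its differentiable square. Farther away the distance is the square root of a
  -- positive differentiable function.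
  · rcases lt_or_ge ‖v x‖ (ε / 2) with hx | hx
    · have h1 := ((hder x).const_mul (4 / ε ^ 2)).const_sub 1
      have h2 : tent ε ‖v x‖ = ‖v x‖ := by
        rw [tent, min_eq_left (by linarith), max_eq_right (norm_nonneg _)]
      have h3 : radialTent ε (v x) = v x := by
        rw [radialTent, h2]
        rcases eq_or_ne (v x) 0 with h0 | h0
        · simp [h0]
        · rw [div_self (norm_ne_zero_iff.2 h0), one_smul]
      rw [h3, map_neg, map_smul]
      refine h1.congr_of_eventuallyEq ?_
      filter_upwards [hcont.norm.continuousAt.eventually (Iio_mem_nhds hx)] with y hy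
      rw [profile_of_le hε (le_of_lt hy)]
    · have hpos : 0 < ‖v x‖ := by linarith
      have h1 : HasFDerivAt (fun y => ‖v y‖) ((1 / ‖v x‖) • innerSL ℝ (v x)) x := by
        have h2 : HasDerivAt (fun τ : ℝ => Real.sqrt (2 * τ)) (1 / ‖v x‖) (‖v x‖ ^ 2 / 2) := by
          have h3 : HasDerivAt (fun τ : ℝ => 2 * τ) 2 (‖v x‖ ^ 2 / 2) := by
            exact ((hasDerivAt_id' (‖v x‖ ^ 2 / 2)).const_mul 2).congr_deriv (mul_one 2)
          refine (h3.sqrt (by positivity)).congr_deriv ?_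
          rw [mul_div_cancel₀ _ (two_ne_zero), Real.sqrt_sq hpos.le]
          field_simp
        refine (h2.comp_hasFDerivAt x (hder x)).congr_of_eventuallyEq
          (Filter.Eventually.of_forall fun y => ?_)
        simp only [Function.comp]
        rw [mul_div_cancel₀ _ (two_ne_zero), Real.sqrt_sq (norm_nonneg _)]
      refine ((hasDerivAt_profile hε hpos.le).comp_hasFDerivAt x h1).congr_fderiv ?_
      ext w
      simp only [radialTent, map_neg, map_smul, smul_smul, smul_apply,
        neg_apply, smul_eq_mul]
      ring
  · rw [← neg_sub_neg, neg_neg, neg_neg, ← smul_sub, norm_smul, Real.norm_eq_abs,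
      abs_of_nonneg (by positivity), norm_sub_rev]
    gcongr
    exact (norm_radialTent_sub_le _ _ _).trans (hlip x y)
  · simp [hmem x hx, radialTent]
  · rw [radialTent, tent_eq_zero (by rwa [hv])]
    simp

end Smoothing

/-! ### Second derivatives of Gaussian averages of smooth functions. -/

section SmoothAverages

open scoped RealInnerProductSpace

variable {E : Type*} [NormedAddCommGroup E] [InnerProductSpace ℝ E] [FiniteDimensional ℝ E]
  [MeasurableSpace E] [BorelSpace E]

/-- A bounded differentiable function `h` with bounded continuous gradient `g`. -/
structure IsSmoothPair (h : E → ℝ) (g : E → E) (G : ℝ) : Prop where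
  abs_le_one : ∀ x, |h x| ≤ 1
  hasFDerivAt : ∀ x, HasFDerivAt h (innerSL ℝ (g x)) x
  continuous_grad : Continuous g
  norm_grad_le : ∀ x, ‖g x‖ ≤ G

/-- The second derivative in the direction `v = M (N v)` of the average of `h` over the Gaussian
perturbation `M z`, written in terms of the gradient `g`. -/
noncomputable def secondDeriv (g : E → E) (M N : E →L[ℝ] E) (x v : E) : ℝ :=
  ∫ z, ⟪g (x + M z), v⟫ * ⟪N v, z⟫ ∂(stdGaussian E)

namespace IsSmoothPair

variable {h : E → ℝ} {g : E → E} {G : ℝ}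

lemma bound_nonneg (H : IsSmoothPair h g G) : 0 ≤ G := (norm_nonneg _).trans (H.norm_grad_le 0)

lemma continuous (H : IsSmoothPair h g G) : Continuous h :=
  continuous_iff_continuousAt.2 fun x => (H.hasFDerivAt x).continuousAt

lemma abs_inner_grad_le (H : IsSmoothPair h g G) (x v : E) : |⟪g x, v⟫| ≤ G * ‖v‖ :=
  (abs_real_inner_le_norm _ _).trans (by gcongr; exact H.norm_grad_le x)

lemma hasDerivAt_line (H : IsSmoothPair h g G) (x v : E) (r : ℝ) :
    HasDerivAt (fun r : ℝ => h (x + r • v)) ⟪g (x + r • v), v⟫ r := by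
  have h1 : HasDerivAt (fun r : ℝ => x + r • v) v r := by
    simpa using ((hasDerivAt_id r).smul_const v).const_add x
  exact (H.hasFDerivAt (x + r • v)).comp_hasDerivAt r h1

/-- Translation of a smooth pair averaged over a random vector. -/
lemma average (H : IsSmoothPair h g G) {Ω : Type*} [MeasurableSpace Ω] {μ : Measure Ω}
    [IsProbabilityMeasure μ] {Y : Ω → E} (hY : Measurable Y) :
    IsSmoothPair (fun x => ∫ ω, h (Y ω + x) ∂μ) (fun x => ∫ ω, g (Y ω + x) ∂μ) G := by
  have hgc := H.continuous_grad
  have hhc := H.continuous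
  have hgm := hgc.measurable
  have hhm := hhc.measurable
  have hgi : ∀ x, Integrable (fun ω => g (Y ω + x)) μ := fun x =>
    Integrable.of_bound (Measurable.aestronglyMeasurable (by fun_prop)) G
      (Filter.Eventually.of_forall fun ω => H.norm_grad_le _)
  refine ⟨fun x => ?_, fun x => ?_, ?_, fun x => ?_⟩
  · have := norm_integral_le_of_norm_le_const (μ := μ) (f := fun ω => h (Y ω + x)) (C := 1)
      (Filter.Eventually.of_forall fun ω => H.abs_le_one _)
    simpa using this
  · have h1 := hasFDerivAt_integral_of_dominated_of_fderiv_le (𝕜 := ℝ) (μ := μ)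
      (F := fun x ω => h (Y ω + x)) (F' := fun x ω => innerSL ℝ (g (Y ω + x))) (x₀ := x)
      (s := Set.univ) (bound := fun _ => G) Filter.univ_mem
      (Filter.Eventually.of_forall fun x => Measurable.aestronglyMeasurable (by fun_prop))
      (Integrable.of_bound (Measurable.aestronglyMeasurable (by fun_prop)) 1
        (Filter.Eventually.of_forall fun ω => H.abs_le_one _))
      (Measurable.aestronglyMeasurable (by fun_prop))
      (Filter.Eventually.of_forall fun ω y _ => by
        rw [innerSL_apply_norm]; exact H.norm_grad_le _)
      (integrable_const _)
      (Filter.Eventually.of_forall fun ω y _ => by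
        exact (HasFDerivAt.comp (f := fun y => Y ω + y) y (H.hasFDerivAt (Y ω + y))
          ((hasFDerivAt_id y).const_add (Y ω))).congr_fderiv (by simp))
    refine h1.congr_fderiv ?_
    exact (innerSL ℝ).integral_comp_comm (hgi x)
  · exact continuous_of_dominated (bound := fun _ => G)
      (fun x => Measurable.aestronglyMeasurable (by fun_prop))
      (fun x => Filter.Eventually.of_forall fun ω => H.norm_grad_le _) (integrable_const _)
      (Filter.Eventually.of_forall fun ω => by fun_prop)
  · have := norm_integral_le_of_norm_le_const (μ := μ) (f := fun ω => g (Y ω + x)) (C := G)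
      (Filter.Eventually.of_forall fun ω => H.norm_grad_le _)
    simpa using this

lemma hasDerivAt_integral_grad (H : IsSmoothPair h g G) {M N : E →L[ℝ] E}
    (hMN : ∀ v, M (N v) = v) (x v : E) (r : ℝ) :
    HasDerivAt (fun r : ℝ => ∫ z, ⟪g (x + r • v + M z), v⟫ ∂(stdGaussian E))
      (secondDeriv g M N (x + r • v) v) r := by
  have hgm := H.continuous_grad.measurable
  have h1 := hasDerivAt_integral_comp_add (k := fun z => ⟪g (x + M z), v⟫) (N v) (by fun_prop)
    (K := G * ‖v‖) (fun z => H.abs_inner_grad_le _ _) r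
  have e : ∀ (r : ℝ) (z : E), x + M (z + r • N v) = x + r • v + M z := by
    intro r z
    rw [map_add, map_smul, hMN]
    abel
  simp_rw [e] at h1
  exact h1

/-- Gaussian integration by parts moves the remaining derivative to the Gaussian density. -/
lemma secondDeriv_eq (H : IsSmoothPair h g G) {M N : E →L[ℝ] E} (hMN : ∀ v, M (N v) = v)
    (x v : E) :
    secondDeriv g M N x v = ∫ z, h (x + M z) * hermiteTwo (N v) z ∂(stdGaussian E) := by
  have hgm := H.continuous_grad.measurable
  have hhm := H.continuous.measurable
  have h1 := hasDerivAt_integral_comp_add_mul_inner (k := fun z => h (x + M z)) (N v) (by fun_prop)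
    (K := 1) (fun z => H.abs_le_one _) 0
  have e : ∀ (r : ℝ) (z : E), x + M (z + r • N v) = x + M z + r • v := by
    intro r z
    rw [map_add, map_smul, hMN]
    abel
  simp_rw [e] at h1
  have hint : Integrable (fun z => ⟪N v, z⟫) (stdGaussian E) :=
    (memLp_inner_stdGaussian (N v) 1 (by simp)).integrable le_rfl
  -- The average of `h (x + M z + r • v) * ⟪N v, z⟫` is differentiated at `r = 0` twice: in `h1` on
  -- the density, here on `h`. Uniqueness of the derivative is the asserted identity.
  have h2 := (hasDerivAt_integral_of_dominated_loc_of_deriv_le (𝕜 := ℝ) (μ := stdGaussian E)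
    (F := fun r z => h (x + M z + r • v) * ⟪N v, z⟫)
    (F' := fun r z => ⟪g (x + M z + r • v), v⟫ * ⟪N v, z⟫) (x₀ := 0) (s := Set.univ)
    (bound := fun z => G * ‖v‖ * |⟪N v, z⟫|) Filter.univ_mem
    (Filter.Eventually.of_forall fun r => Measurable.aestronglyMeasurable (by fun_prop))
    (Integrable.bdd_mul (c := 1) hint (Measurable.aestronglyMeasurable (by fun_prop))
      (Filter.Eventually.of_forall fun z => H.abs_le_one _))
    (Measurable.aestronglyMeasurable (by fun_prop))
    (Filter.Eventually.of_forall fun z r _ => by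
      rw [norm_mul]
      exact mul_le_mul_of_nonneg_right (H.abs_inner_grad_le _ _) (abs_nonneg _))
    (hint.abs.const_mul _)
    (Filter.Eventually.of_forall fun z r _ => (H.hasDerivAt_line (x + M z) v r).mul_const _)).2
  have := h2.unique h1
  simpa [secondDeriv] using this

end IsSmoothPair

/-- A Lipschitz bound for the averages of a bounded function against the second Hermite
polynomial. -/
lemma abs_integral_hermiteTwo_sub_le {k : E → ℝ} (hk : Measurable k) {K : ℝ}
    (hkb : ∀ z, |k z| ≤ K) {M N : E →L[ℝ] E} (hMN : ∀ v, M (N v) = v) (x v w : E) :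
    |∫ z, k (x + w + M z) * hermiteTwo (N v) z ∂(stdGaussian E)
      - ∫ z, k (x + M z) * hermiteTwo (N v) z ∂(stdGaussian E)|
      ≤ 3.42 * K * ‖N v‖ ^ 2 * ‖N w‖ := by
  have h := abs_integral_comp_add_mul_hermiteTwo_sub_le (k := fun z => k (x + M z)) (N v) (N w)
    (by fun_prop) (fun z => hkb _)
  have e : ∀ z : E, x + M (z + N w) = x + w + M z := by
    intro z
    rw [map_add, hMN]
    abel
  simp_rw [e] at h
  exact h

namespace IsSmoothPair

variable {h : E → ℝ} {g : E → E} {G : ℝ}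

lemma abs_secondDeriv_sub_le (H : IsSmoothPair h g G) {M N : E →L[ℝ] E} (hMN : ∀ v, M (N v) = v)
    (x v w : E) :
    |secondDeriv g M N (x + w) v - secondDeriv g M N x v| ≤ 3.42 * ‖N v‖ ^ 2 * ‖N w‖ := by
  rw [H.secondDeriv_eq hMN, H.secondDeriv_eq hMN]
  have := abs_integral_hermiteTwo_sub_le H.continuous.measurable H.abs_le_one hMN x v w
  simpa using this

/-- Comparison of the second derivatives of two functions that are uniformly close. -/
lemma abs_secondDeriv_sub_le_of_close (H : IsSmoothPair h g G) {h' : E → ℝ} {g' : E → E} {G' : ℝ}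
    (H' : IsSmoothPair h' g' G') {κ : ℝ} (hκ : ∀ x, |h x - h' x| ≤ κ)
    {M N : E →L[ℝ] E} (hMN : ∀ v, M (N v) = v) (x v w : E) :
    |secondDeriv g M N (x + w) v - secondDeriv g M N x v|
      ≤ 3.42 * κ * ‖N v‖ ^ 2 * ‖N w‖
        + |secondDeriv g' M N (x + w) v - secondDeriv g' M N x v| := by
  have hhm := H.continuous.measurable
  have hhm' := H'.continuous.measurable
  have h1 := abs_integral_hermiteTwo_sub_le (k := fun x => h x - h' x) (by fun_prop) hκ hMN x v w
  have hi : ∀ y (f : E → ℝ), Measurable f → (∀ x, |f x| ≤ 1) →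
      Integrable (fun z => f (y + M z) * hermiteTwo (N v) z) (stdGaussian E) := fun y f hf hfb =>
    Integrable.bdd_mul (c := 1) (integrable_hermiteTwo _)
      (Measurable.aestronglyMeasurable (by fun_prop)) (Filter.Eventually.of_forall fun z => hfb _)
  simp only [sub_mul] at h1
  rw [integral_sub (hi _ _ hhm H.abs_le_one) (hi _ _ hhm' H'.abs_le_one),
    integral_sub (hi _ _ hhm H.abs_le_one) (hi _ _ hhm' H'.abs_le_one),
    ← H.secondDeriv_eq hMN, ← H.secondDeriv_eq hMN, ← H'.secondDeriv_eq hMN,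
    ← H'.secondDeriv_eq hMN] at h1
  set a := secondDeriv g M N (x + w) v
  set b := secondDeriv g M N x v
  set a' := secondDeriv g' M N (x + w) v
  set b' := secondDeriv g' M N x v
  have : a - b = (a - a' - (b - b')) + (a' - b') := by ring
  rw [this]
  exact (abs_add_le _ _).trans (add_le_add_left h1 _)

/-- The bound obtained by putting all derivatives but one on the function. -/
lemma abs_secondDeriv_sub_le_of_lipschitz (H : IsSmoothPair h g G) {L : ℝ} (hL0 : 0 ≤ L)
    (hL : ∀ x y, ‖g x - g y‖ ≤ L * ‖x - y‖) (M N : E →L[ℝ] E) (x v w : E) :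
    |secondDeriv g M N (x + w) v - secondDeriv g M N x v| ≤ L * ‖w‖ * ‖v‖ * ‖N v‖ := by
  have hgm := H.continuous_grad.measurable
  have hint : Integrable (fun z => ⟪N v, z⟫) (stdGaussian E) :=
    (memLp_inner_stdGaussian (N v) 1 (by simp)).integrable le_rfl
  have hi : ∀ y, Integrable (fun z => ⟪g (y + M z), v⟫ * ⟪N v, z⟫) (stdGaussian E) := fun y =>
    Integrable.bdd_mul (c := G * ‖v‖) hint
      (Measurable.aestronglyMeasurable (by fun_prop))
      (Filter.Eventually.of_forall fun z => H.abs_inner_grad_le _ _)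
  rw [secondDeriv, secondDeriv, ← integral_sub (hi _) (hi _), ← Real.norm_eq_abs]
  calc _ ≤ ∫ z, L * ‖w‖ * ‖v‖ * |⟪N v, z⟫| ∂(stdGaussian E) := by
        refine norm_integral_le_of_norm_le (hint.abs.const_mul _)
          (Filter.Eventually.of_forall fun z => ?_)
        rw [← sub_mul, ← inner_sub_left, norm_mul]
        refine mul_le_mul_of_nonneg_right ((norm_inner_le_norm (𝕜 := ℝ) _ _).trans ?_)
          (norm_nonneg _)
        gcongr
        refine (hL _ _).trans (le_of_eq ?_)
        rw [add_sub_add_right_eq_sub, add_sub_cancel_left]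
    _ ≤ _ := by
        rw [integral_const_mul]
        exact mul_le_mul_of_nonneg_left (integral_abs_inner_stdGaussian_le _) (by positivity)

end IsSmoothPair

end SmoothAverages

/-! ### Taylor expansion, a moment inequality and decoupling of one summand. -/

section Interpolation

open scoped RealInnerProductSpace

variable {E : Type*} [NormedAddCommGroup E] [InnerProductSpace ℝ E] [FiniteDimensional ℝ E]
  [MeasurableSpace E] [BorelSpace E]

variable {Ω ι : Type*} [MeasurableSpace Ω] {μ : Measure Ω} [IsProbabilityMeasure μ] {S : Finset ι}
  {ξ : ι → Ω → E} {h : E → ℝ} {g : E → E} {G : ℝ}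

/-- Average of a vector field over the scaled sum with one summand left out. -/
noncomputable def leaveOneOutAverage [DecidableEq ι] (μ : Measure Ω) (S : Finset ι)
    (ξ : ι → Ω → E) (g : E → E) (c : ℝ) (i : ι) (x : E) : E :=
  ∫ ω, g (c • ∑ j ∈ S.erase i, ξ j ω + x) ∂μ

/-- `M r² / 2 ± (f r - r f' 0)` are nondecreasing for `r ≥ 0`; no second derivative of `f` is
needed. -/
lemma taylor_second_order {f f' : ℝ → ℝ} {c M : ℝ} (hc : 0 ≤ c)
    (hf : ∀ r, HasDerivAt f (f' r) r) (hM : ∀ r, 0 ≤ r → |f' r - f' 0| ≤ M * r) :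
    |f c - f 0 - c * f' 0| ≤ M * c ^ 2 / 2 := by
  have hsq : ∀ r : ℝ, HasDerivAt (fun r : ℝ => M * r ^ 2 / 2) (M * r) r := by
    intro r
    refine ((((hasDerivAt_id' r).pow 2).const_mul M).div_const 2).congr_deriv ?_
    simp
    ring
  have hlin : ∀ r : ℝ, HasDerivAt (fun r : ℝ => r * f' 0) (f' 0) r := by
    intro r
    simpa using (hasDerivAt_id' r).mul_const (f' 0)
  have key : ∀ F F' : ℝ → ℝ, (∀ r, HasDerivAt F (F' r) r) → (∀ r, 0 ≤ r → 0 ≤ F' r) →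
      F 0 ≤ F c := by
    intro F F' hF hF'
    refine monotoneOn_of_deriv_nonneg (convex_Ici (0:ℝ))
      (fun r _ => (hF r).continuousAt.continuousWithinAt)
      (fun r _ => (hF r).differentiableAt.differentiableWithinAt) (fun r hr => ?_)
      (Set.mem_Ici.2 le_rfl) (Set.mem_Ici.2 hc) hc
    rw [interior_Ici] at hr
    rw [(hF r).deriv]
    exact hF' r (le_of_lt hr)
  have h1 := key (fun r => M * r ^ 2 / 2 - (f r - r * f' 0)) _
    (fun r => (hsq r).sub ((hf r).sub (hlin r)))
    (fun r hr => by have := (abs_le.1 (hM r hr)).2; linarith)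
  have h2 := key (fun r => M * r ^ 2 / 2 + (f r - r * f' 0)) _
    (fun r => (hsq r).add ((hf r).sub (hlin r)))
    (fun r hr => by have := (abs_le.1 (hM r hr)).1; linarith)
  rw [abs_le]
  constructor <;> norm_num at h1 h2 <;> linarith

/-- Integrate `(X - a)²(X + a) ≥ 0` with `a = E X`. -/
lemma integral_mul_integral_sq_le {X : Ω → ℝ} (hX : ∀ ω, 0 ≤ X ω) (h1 : Integrable X μ)
    (h2 : Integrable (fun ω => X ω ^ 2) μ) (h3 : Integrable (fun ω => X ω ^ 3) μ) :
    (∫ ω, X ω ∂μ) * ∫ ω, X ω ^ 2 ∂μ ≤ ∫ ω, X ω ^ 3 ∂μ := by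
  set a := ∫ ω, X ω ∂μ
  have ha : 0 ≤ a := integral_nonneg hX
  have h : 0 ≤ ∫ ω, (X ω ^ 3 - a * X ω ^ 2 - (a ^ 2 * X ω - a ^ 3)) ∂μ := by
    refine integral_nonneg fun ω => ?_
    have : X ω ^ 3 - a * X ω ^ 2 - (a ^ 2 * X ω - a ^ 3) = (X ω - a) ^ 2 * (X ω + a) := by ring
    simp only [Pi.zero_apply]
    rw [this]
    exact mul_nonneg (sq_nonneg _) (add_nonneg (hX ω) ha)
  have i1 : Integrable (fun ω => X ω ^ 3 - a * X ω ^ 2) μ := h3.sub (h2.const_mul a)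
  have i2 : Integrable (fun ω => a ^ 2 * X ω - a ^ 3) μ := (h1.const_mul _).sub (integrable_const _)
  rw [integral_sub i1 i2, integral_sub h3 (h2.const_mul a),
    integral_sub (h1.const_mul _) (integrable_const _), integral_const_mul, integral_const_mul] at h
  simp only [integral_const, probReal_univ, one_smul] at h
  change 0 ≤ _ - (a ^ 2 * a - a ^ 3) at h
  linarith

namespace IsStandardized

/-- Quadratic forms evaluated at the summands average to the trace. -/
lemma sum_integral_quadratic (hξ : IsStandardized μ S ξ) {κ : Type*} [Fintype κ]
    (b : OrthonormalBasis κ ℝ E) (m : κ → κ → ℝ) :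
    ∑ i ∈ S, ∫ ω, ∑ k, ∑ l, ⟪ξ i ω, b k⟫ * ⟪ξ i ω, b l⟫ * m k l ∂μ = ∑ k, m k k := by
  classical
  have hi : ∀ i k l, Integrable (fun ω => ⟪ξ i ω, b k⟫ * ⟪ξ i ω, b l⟫) μ := fun i k l =>
    (hξ.memLp_inner i (b k)).integrable_mul (hξ.memLp_inner i (b l))
  have e : ∀ i, ∫ ω, ∑ k, ∑ l, ⟪ξ i ω, b k⟫ * ⟪ξ i ω, b l⟫ * m k l ∂μ
      = ∑ k, ∑ l, (∫ ω, ⟪ξ i ω, b k⟫ * ⟪ξ i ω, b l⟫ ∂μ) * m k l := by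
    intro i
    rw [integral_finsetSum _ fun k _ => integrable_finsetSum _ fun l _ => (hi i k l).mul_const _]
    refine Finset.sum_congr rfl fun k _ => ?_
    rw [integral_finsetSum _ fun l _ => (hi i k l).mul_const _]
    exact Finset.sum_congr rfl fun l _ => integral_mul_const _ _
  simp_rw [e]
  rw [Finset.sum_comm]
  refine Finset.sum_congr rfl fun k _ => ?_
  rw [Finset.sum_comm]
  simp_rw [← Finset.sum_mul, hξ.cov, b.inner_eq_ite]
  simp

/-- Fubini for the joint law of `ξᵢ` and the sum of the other summands, which is a product by
independence; integrating out the others first produces the leave-one-out field. -/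
lemma integral_decouple [DecidableEq ι] (hξ : IsStandardized μ S ξ) (H : IsSmoothPair h g G)
    (c : ℝ) {i : ι} (hi : i ∈ S) {a : E → E} (ha : Measurable a)
    (hai : Integrable (fun ω => a (ξ i ω)) μ) (y : E) :
    ∫ ω, ⟪g (c • ∑ j ∈ S, ξ j ω + y), a (ξ i ω)⟫ ∂μ
      = ∫ ω, ⟪leaveOneOutAverage μ S ξ g c i (c • ξ i ω + y), a (ξ i ω)⟫ ∂μ := by
  have hgm := H.continuous_grad.measurable
  have hm := hξ.measurable
  set V : Ω → E := fun ω => ∑ j ∈ S.erase i, ξ j ω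
  have hV : Measurable V := hξ.measurable_sum _
  have hind : IndepFun (ξ i) V μ := by
    have := (hξ.indep.indepFun_finsetSum_of_notMem hm (Finset.notMem_erase i S)).symm
    convert this using 1
    ext ω
    simp [V]
  have hmap := (indepFun_iff_map_prod_eq_prod_map_map (hm i).aemeasurable hV.aemeasurable).1 hind
  set φ : E × E → ℝ := fun p => ⟪g (c • (p.1 + p.2) + y), a p.1⟫
  have hφm : Measurable φ := by fun_prop
  have e1 : ∀ ω, ⟪g (c • ∑ j ∈ S, ξ j ω + y), a (ξ i ω)⟫ = φ (ξ i ω, V ω) := by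
    intro ω
    simp only [φ, V]
    rw [Finset.add_sum_erase S (fun j => ξ j ω) hi]
  have hφi : Integrable φ ((μ.map (ξ i)).prod (μ.map V)) := by
    rw [← hmap]
    rw [integrable_map_measure hφm.aestronglyMeasurable
      ((hm i).prodMk hV).aemeasurable]
    refine (hai.norm.const_mul G).mono' (Measurable.aestronglyMeasurable (by fun_prop))
      (Filter.Eventually.of_forall fun ω => ?_)
    exact H.abs_inner_grad_le _ _
  have := Measure.isProbabilityMeasure_map (μ := μ) hV.aemeasurable
  have := Measure.isProbabilityMeasure_map (μ := μ) (hm i).aemeasurable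
  calc ∫ ω, ⟪g (c • ∑ j ∈ S, ξ j ω + y), a (ξ i ω)⟫ ∂μ
      = ∫ p, φ p ∂((μ.map (ξ i)).prod (μ.map V)) := by
        simp_rw [e1]
        rw [← hmap, integral_map ((hm i).prodMk hV).aemeasurable hφm.aestronglyMeasurable]
    _ = ∫ v, ∫ w, φ (v, w) ∂(μ.map V) ∂(μ.map (ξ i)) := integral_prod _ hφi
    _ = ∫ ω, ∫ w, φ (ξ i ω, w) ∂(μ.map V) ∂μ := by
        rw [integral_map (hm i).aemeasurable]
        exact (hφm.stronglyMeasurable.integral_prod_right').aestronglyMeasurable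
    _ = _ := by
        refine integral_congr_ae (Filter.Eventually.of_forall fun ω => ?_)
        simp only
        rw [integral_map hV.aemeasurable (Measurable.aestronglyMeasurable (by fun_prop)),
          leaveOneOutAverage, real_inner_comm, ← integral_inner (𝕜 := ℝ)]
        · refine integral_congr_ae (Filter.Eventually.of_forall fun ω' => ?_)
          simp only [φ, V]
          rw [real_inner_comm, smul_add]
          congr 2
          abel
        · exact Integrable.of_bound (Measurable.aestronglyMeasurable (by fun_prop)) G
            (Filter.Eventually.of_forall fun ω => H.norm_grad_le _)

lemma isSmoothPair_leaveOneOut [DecidableEq ι] (hξ : IsStandardized μ S ξ)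
    (H : IsSmoothPair h g G) (c : ℝ) (i : ι) :
    IsSmoothPair (fun x => ∫ ω, h (c • ∑ j ∈ S.erase i, ξ j ω + x) ∂μ)
      (leaveOneOutAverage μ S ξ g c i) G :=
  H.average ((hξ.measurable_sum _).const_smul c)

lemma integral_prod_decouple [DecidableEq ι] (hξ : IsStandardized μ S ξ)
    (H : IsSmoothPair h g G) (c s : ℝ) {i : ι} (hi : i ∈ S) {a : E → E} (ha : Measurable a)
    (hai : Integrable (fun ω => a (ξ i ω)) μ) {ψ : E → ℝ} (hψ : Measurable ψ)
    (hψi : Integrable ψ (stdGaussian E)) :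
    ∫ p : Ω × E, ⟪g (c • ∑ j ∈ S, ξ j p.1 + s • p.2), a (ξ i p.1)⟫ * ψ p.2
        ∂(μ.prod (stdGaussian E))
      = ∫ ω, ∫ z, ⟪leaveOneOutAverage μ S ξ g c i (c • ξ i ω + s • z), a (ξ i ω)⟫ * ψ z
          ∂(stdGaussian E) ∂μ := by
  have hgm := H.continuous_grad.measurable
  have hm := hξ.measurable
  have hsm := hξ.measurable_sum S
  have Hi := hξ.isSmoothPair_leaveOneOut H c i
  have him := Hi.continuous_grad.measurable
  have i1 : Integrable (fun p : Ω × E => ⟪g (c • ∑ j ∈ S, ξ j p.1 + s • p.2), a (ξ i p.1)⟫ * ψ p.2)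
      (μ.prod (stdGaussian E)) := by
    refine ((hai.norm.const_mul G).mul_prod hψi.norm).mono'
      (Measurable.aestronglyMeasurable ?_) (Filter.Eventually.of_forall fun p => ?_)
    · have : Measurable fun p : Ω × E => ∑ j ∈ S, ξ j p.1 := hsm.comp measurable_fst
      fun_prop
    · rw [norm_mul]
      exact mul_le_mul_of_nonneg_right (H.abs_inner_grad_le _ _) (norm_nonneg _)
  have i2 : Integrable (Function.uncurry fun (ω : Ω) (z : E) =>
      ⟪leaveOneOutAverage μ S ξ g c i (c • ξ i ω + s • z), a (ξ i ω)⟫ * ψ z)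
      (μ.prod (stdGaussian E)) := by
    refine ((hai.norm.const_mul G).mul_prod hψi.norm).mono'
      (Measurable.aestronglyMeasurable ?_) (Filter.Eventually.of_forall fun p => ?_)
    · simp only [Function.uncurry_def]
      fun_prop
    · simp only [Function.uncurry_def]
      rw [norm_mul]
      exact mul_le_mul_of_nonneg_right (Hi.abs_inner_grad_le _ _) (norm_nonneg _)
  rw [integral_integral_swap i2, integral_prod_symm _ i1]
  refine integral_congr_ae (Filter.Eventually.of_forall fun z => ?_)
  simp only
  rw [integral_mul_const, integral_mul_const, hξ.integral_decouple H c hi ha hai]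

end IsStandardized

end Interpolation

/-! ### The rotation from the sum to the Gaussian and its derivative. -/

section Interpolation

open scoped RealInnerProductSpace

variable {E : Type*} [NormedAddCommGroup E] [InnerProductSpace ℝ E] [FiniteDimensional ℝ E]
  [MeasurableSpace E] [BorelSpace E]

variable {Ω ι : Type*} [MeasurableSpace Ω] {μ : Measure Ω} [IsProbabilityMeasure μ] {S : Finset ι}
  {ξ : ι → Ω → E} {h : E → ℝ} {g : E → E} {G : ℝ}

/-- The expectation of `h` along the rotation from the standardized sum to the Gaussian. -/
noncomputable def interpolation (μ : Measure Ω) (S : Finset ι) (ξ : ι → Ω → E) (h : E → ℝ)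
    (θ : ℝ) : ℝ :=
  ∫ p : Ω × E, h (Real.cos θ • ∑ j ∈ S, ξ j p.1 + Real.sin θ • p.2) ∂(μ.prod (stdGaussian E))

/-- The derivative of `interpolation`. -/
noncomputable def interpolationDeriv (μ : Measure Ω) (S : Finset ι) (ξ : ι → Ω → E) (g : E → E)
    (θ : ℝ) : ℝ :=
  ∫ p : Ω × E, ⟪g (Real.cos θ • ∑ j ∈ S, ξ j p.1 + Real.sin θ • p.2),
    -Real.sin θ • ∑ j ∈ S, ξ j p.1 + Real.cos θ • p.2⟫ ∂(μ.prod (stdGaussian E))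

namespace IsStandardized

lemma hasDerivAt_interpolation (hξ : IsStandardized μ S ξ) (H : IsSmoothPair h g G) (θ : ℝ) :
    HasDerivAt (interpolation μ S ξ h) (interpolationDeriv μ S ξ g θ) θ := by
  have hgm := H.continuous_grad.measurable
  have hhm := H.continuous.measurable
  have hsm : Measurable fun p : Ω × E => ∑ j ∈ S, ξ j p.1 :=
    (hξ.measurable_sum S).comp measurable_fst
  have hz : Integrable (fun z : E => ‖z‖) (stdGaussian E) := by
    simpa using integrable_norm_pow_stdGaussian (E := E) 1
  refine (hasDerivAt_integral_of_dominated_loc_of_deriv_le (𝕜 := ℝ)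
    (μ := μ.prod (stdGaussian E))
    (F := fun θ p => h (Real.cos θ • ∑ j ∈ S, ξ j p.1 + Real.sin θ • p.2))
    (F' := fun θ p => ⟪g (Real.cos θ • ∑ j ∈ S, ξ j p.1 + Real.sin θ • p.2),
      -Real.sin θ • ∑ j ∈ S, ξ j p.1 + Real.cos θ • p.2⟫)
    (bound := fun p => G * (‖∑ j ∈ S, ξ j p.1‖ + ‖p.2‖)) (s := Set.univ) Filter.univ_mem
    (Filter.Eventually.of_forall fun θ => Measurable.aestronglyMeasurable (by fun_prop))
    (Integrable.of_bound (Measurable.aestronglyMeasurable (by fun_prop)) 1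
      (Filter.Eventually.of_forall fun p => H.abs_le_one _))
    (Measurable.aestronglyMeasurable (by fun_prop))
    (Filter.Eventually.of_forall fun p θ _ => ?_) ?_
    (Filter.Eventually.of_forall fun p θ _ => ?_)).2
  · refine (H.abs_inner_grad_le _ _).trans ?_
    have := H.bound_nonneg
    gcongr
    refine (norm_add_le _ _).trans (add_le_add ?_ ?_)
    · rw [norm_smul, norm_neg, Real.norm_eq_abs]
      exact mul_le_of_le_one_left (norm_nonneg _) (Real.abs_sin_le_one _)
    · rw [norm_smul, Real.norm_eq_abs]
      exact mul_le_of_le_one_left (norm_nonneg _) (Real.abs_cos_le_one _)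
  · exact (((hξ.integrable_norm_sum S).comp_fst _).add (hz.comp_snd _)).const_mul G
  · have h1 : HasDerivAt (fun θ : ℝ => Real.cos θ • ∑ j ∈ S, ξ j p.1 + Real.sin θ • p.2)
        (-Real.sin θ • ∑ j ∈ S, ξ j p.1 + Real.cos θ • p.2) θ :=
      ((Real.hasDerivAt_cos θ).smul_const _).add ((Real.hasDerivAt_sin θ).smul_const _)
    exact (H.hasFDerivAt _).comp_hasDerivAt θ h1

/-- The derivative of the interpolation is controlled by the oscillation of the second derivatives
of the leave-one-out averages. -/
lemma abs_interpolationDeriv_le [DecidableEq ι] (hξ : IsStandardized μ S ξ)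
    (H : IsSmoothPair h g G) {θ Λ : ℝ} (hc : 0 ≤ Real.cos θ) (hs : 0 < Real.sin θ) (hΛ0 : 0 ≤ Λ)
    (hΛ : ∀ i ∈ S, ∀ x v w, |secondDeriv (leaveOneOutAverage μ S ξ g (Real.cos θ) i)
        (Real.sin θ • ContinuousLinearMap.id ℝ E) ((Real.sin θ)⁻¹ • ContinuousLinearMap.id ℝ E)
          (x + w) v
      - secondDeriv (leaveOneOutAverage μ S ξ g (Real.cos θ) i)
        (Real.sin θ • ContinuousLinearMap.id ℝ E) ((Real.sin θ)⁻¹ • ContinuousLinearMap.id ℝ E)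
          x v| ≤ Λ * ‖v‖ ^ 2 * ‖w‖) :
    |interpolationDeriv μ S ξ g θ|
      ≤ 3 / 2 * Real.sin θ * Real.cos θ ^ 2 * Λ * thirdMoment μ S ξ := by
  set c := Real.cos θ
  set s := Real.sin θ
  set M : E →L[ℝ] E := s • ContinuousLinearMap.id ℝ E
  set N : E →L[ℝ] E := s⁻¹ • ContinuousLinearMap.id ℝ E
  have hMz : ∀ z, M z = s • z := fun z => rfl
  have hNz : ∀ z, N z = s⁻¹ • z := fun z => rfl
  have hMN : ∀ v, M (N v) = v := fun v => by rw [hMz, hNz, smul_inv_smul₀ hs.ne']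
  have hgm := H.continuous_grad.measurable
  have hm := hξ.measurable
  have hG := H.bound_nonneg
  have hsm : Measurable fun p : Ω × E => ∑ j ∈ S, ξ j p.1 :=
    (hξ.measurable_sum S).comp measurable_fst
  have hz : Integrable (fun z : E => ‖z‖) (stdGaussian E) := by
    simpa using integrable_norm_pow_stdGaussian (E := E) 1
  set P := μ.prod (stdGaussian E) with hP
  set U : Ω × E → E := fun p => c • ∑ j ∈ S, ξ j p.1 + s • p.2
  have hUm : Measurable U := by fun_prop
  set b := stdOrthonormalBasis ℝ E
  set g' : ι → E → E := fun i => leaveOneOutAverage μ S ξ g c i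
  have H' : ∀ i, IsSmoothPair (fun x => ∫ ω, h (c • ∑ j ∈ S.erase i, ξ j ω + x) ∂μ) (g' i) G :=
    fun i => hξ.isSmoothPair_leaveOneOut H c i
  have hg'm : ∀ i, Measurable (g' i) := fun i => (H' i).continuous_grad.measurable
  have hzv : ∀ v : E, Integrable (fun z => ⟪v, z⟫) (stdGaussian E) := fun v =>
    (memLp_inner_stdGaussian v 1 (by simp)).integrable le_rfl
  -- the expectation of the second derivative at the origin
  set q : ι → ℝ := fun i => ∫ ω, secondDeriv (g' i) M N 0 (ξ i ω) ∂μ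
  have hq_int : ∀ i (x : Ω → E), Measurable x →
      Integrable (fun ω => secondDeriv (g' i) M N (x ω) (ξ i ω)) μ := by
    intro i x hx
    refine Integrable.integral_prod_left (ν := stdGaussian E)
      (f := fun p : Ω × E => ⟪g' i (x p.1 + M p.2), ξ i p.1⟫ * ⟪N (ξ i p.1), p.2⟫) ?_
    refine (((hξ.integrable_sq i).const_mul (G * s⁻¹)).mul_prod hz).mono'
      (Measurable.aestronglyMeasurable (by fun_prop)) (Filter.Eventually.of_forall fun p => ?_)
    rw [norm_mul, hNz]
    have h1 := (H' i).abs_inner_grad_le (x p.1 + M p.2) (ξ i p.1)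
    have h2 := norm_inner_le_norm (𝕜 := ℝ) (s⁻¹ • ξ i p.1) p.2
    rw [norm_smul, norm_inv, Real.norm_of_nonneg hs.le] at h2
    refine (mul_le_mul h1 h2 (norm_nonneg _) (by positivity)).trans (le_of_eq ?_)
    ring
  -- the part coming from the sum
  have hT1 : ∀ i ∈ S, |∫ p, ⟪g (U p), ξ i p.1⟫ ∂P - c * q i|
      ≤ Λ * c ^ 2 / 2 * ∫ ω, ‖ξ i ω‖ ^ 3 ∂μ := by
    intro i hi
    have e1 := hξ.integral_prod_decouple H c s hi (a := id) measurable_id (hξ.integrable i)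
      (ψ := fun _ => 1) measurable_const (integrable_const _)
    simp only [mul_one, id] at e1
    rw [e1]
    have hbi : ∀ r : ℝ, Integrable (fun ω => ∫ z, ⟪g' i (r • ξ i ω + s • z), ξ i ω⟫ ∂(stdGaussian E))
        μ := by
      intro r
      refine Integrable.integral_prod_left (ν := stdGaussian E)
        (f := fun p : Ω × E => ⟪g' i (r • ξ i p.1 + s • p.2), ξ i p.1⟫) ?_
      refine (((hξ.integrable i).norm.const_mul G).comp_fst _).mono'
        (Measurable.aestronglyMeasurable (by fun_prop)) (Filter.Eventually.of_forall fun p => ?_)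
      exact (H' i).abs_inner_grad_le _ _
    -- The zeroth-order Taylor term: a fixed vector paired with the centred `ξᵢ`.
    have hb0 : ∫ ω, ∫ z, ⟪g' i ((0:ℝ) • ξ i ω + s • z), ξ i ω⟫ ∂(stdGaussian E) ∂μ = 0 := by
      have hgi : Integrable (fun z => g' i (s • z)) (stdGaussian E) :=
        Integrable.of_bound (Measurable.aestronglyMeasurable (by fun_prop)) G
          (Filter.Eventually.of_forall fun z => (H' i).norm_grad_le _)
      have : ∀ ω, ∫ z, ⟪g' i ((0:ℝ) • ξ i ω + s • z), ξ i ω⟫ ∂(stdGaussian E)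
          = ⟪ξ i ω, ∫ z, g' i (s • z) ∂(stdGaussian E)⟫ := by
        intro ω
        rw [← integral_inner (𝕜 := ℝ) hgi]
        refine integral_congr_ae (Filter.Eventually.of_forall fun z => ?_)
        simp only [zero_smul, zero_add]
        exact real_inner_comm _ _
      simp_rw [this]
      exact hξ.integral_inner_eq_zero i _
    have e2 : ∫ ω, ∫ z, ⟪g' i (c • ξ i ω + s • z), ξ i ω⟫ ∂(stdGaussian E) ∂μ - c * q i
        = ∫ ω, (∫ z, ⟪g' i (c • ξ i ω + s • z), ξ i ω⟫ ∂(stdGaussian E)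
          - ∫ z, ⟪g' i ((0:ℝ) • ξ i ω + s • z), ξ i ω⟫ ∂(stdGaussian E)
          - c * secondDeriv (g' i) M N 0 (ξ i ω)) ∂μ := by
      have i1 : Integrable (fun ω => ∫ z, ⟪g' i (c • ξ i ω + s • z), ξ i ω⟫ ∂(stdGaussian E)
          - ∫ z, ⟪g' i ((0:ℝ) • ξ i ω + s • z), ξ i ω⟫ ∂(stdGaussian E)) μ := (hbi c).sub (hbi 0)
      have i2 := (hq_int i (fun _ => 0) measurable_const).const_mul c
      rw [integral_sub i1 i2, integral_const_mul, integral_sub (hbi c) (hbi 0), hb0, sub_zero]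
    change |∫ ω, ∫ z, ⟪g' i (c • ξ i ω + s • z), ξ i ω⟫ ∂(stdGaussian E) ∂μ - c * q i| ≤ _
    rw [e2, ← integral_const_mul, ← Real.norm_eq_abs]
    refine norm_integral_le_of_norm_le ((hξ.integrable_pow_three i).const_mul _)
      (Filter.Eventually.of_forall fun ω => ?_)
    -- Expansion along `r ↦ r • ξᵢ`, evaluated at `r = c`. The linear term is `c` times the second
    -- derivative at the origin, which averages to `c * q i`; the remainder carries `Λ c² / 2`.
    have ht := taylor_second_order hc
      (f := fun r => ∫ z, ⟪g' i (0 + r • ξ i ω + M z), ξ i ω⟫ ∂(stdGaussian E))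
      (f' := fun r => secondDeriv (g' i) M N (0 + r • ξ i ω) (ξ i ω)) (M := Λ * ‖ξ i ω‖ ^ 3)
      (fun r => (H' i).hasDerivAt_integral_grad hMN 0 (ξ i ω) r)
      (fun r hr => by
        have := hΛ i hi 0 (ξ i ω) (r • ξ i ω)
        rw [zero_smul, add_zero]
        refine this.trans (le_of_eq ?_)
        rw [norm_smul, Real.norm_eq_abs, abs_of_nonneg hr]
        ring)
    simp only [zero_smul, add_zero, zero_add, hMz] at ht
    rw [Real.norm_eq_abs]
    simp only [zero_smul, zero_add]
    refine ht.trans (le_of_eq (by ring))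
  -- the part coming from the Gaussian vector
  have hgz : ∀ u v : E, Integrable (fun p : Ω × E => ⟪g (U p), u⟫ * ⟪v, p.2⟫) P := by
    intro u v
    refine Integrable.bdd_mul (c := G * ‖u‖) ((hzv v).comp_snd _)
      (Measurable.aestronglyMeasurable (by fun_prop))
      (Filter.Eventually.of_forall fun p => H.abs_inner_grad_le _ _)
  -- In `∫ B (ξ i ω)` the inserted `ξᵢ` acts as a copy independent of the sum inside `U`. As the
  -- covariances add up to the identity, the contribution of the Gaussian vector also becomes a sum
  -- over `i` (see `hT2`).
  set B : E → ℝ := fun v => ∫ p, ⟪g (U p), v⟫ * ⟪v, p.2⟫ ∂P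
  have hBexp : ∀ v, B v = ∑ k, ∑ l, ⟪v, b k⟫ * ⟪v, b l⟫ * ∫ p, ⟪g (U p), b k⟫ * ⟪b l, p.2⟫ ∂P := by
    intro v
    have : ∀ p : Ω × E, ⟪g (U p), v⟫ * ⟪v, p.2⟫
        = ∑ k, ∑ l, ⟪v, b k⟫ * ⟪v, b l⟫ * (⟪g (U p), b k⟫ * ⟪b l, p.2⟫) := by
      intro p
      rw [← b.sum_inner_mul_inner (g (U p)) v, ← b.sum_inner_mul_inner v p.2, Finset.sum_mul_sum]
      refine Finset.sum_congr rfl fun k _ => Finset.sum_congr rfl fun l _ => ?_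
      rw [real_inner_comm v (b k)]
      ring
    simp only [B, this]
    rw [integral_finsetSum _ fun k _ => integrable_finsetSum _ fun l _ => (hgz _ _).const_mul _]
    refine Finset.sum_congr rfl fun k _ => ?_
    rw [integral_finsetSum _ fun l _ => (hgz _ _).const_mul _]
    exact Finset.sum_congr rfl fun l _ => integral_const_mul _ _
  have hBint : ∀ i, Integrable (fun ω => B (ξ i ω)) μ := by
    intro i
    simp only [hBexp]
    exact integrable_finsetSum _ fun k _ => integrable_finsetSum _ fun l _ =>
      ((hξ.memLp_inner i (b k)).integrable_mul (hξ.memLp_inner i (b l))).mul_const _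
  have hT2 : ∫ p, ⟪g (U p), p.2⟫ ∂P = ∑ i ∈ S, ∫ ω, B (ξ i ω) ∂μ := by
    simp only [hBexp]
    rw [hξ.sum_integral_quadratic b, ← integral_finsetSum _ fun k _ => hgz _ _]
    refine integral_congr_ae (Filter.Eventually.of_forall fun p => ?_)
    exact (b.sum_inner_mul_inner _ _).symm
  have hBq : ∀ i ∈ S, |∫ ω, B (ξ i ω) ∂μ - s * q i| ≤ s * (Λ * c) * ∫ ω, ‖ξ i ω‖ ^ 3 ∂μ := by
    intro i hi
    have hpt : ∀ v, |B v - s * secondDeriv (g' i) M N 0 v|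
        ≤ s * (Λ * c * ∫ ω, ‖ξ i ω‖ ∂μ) * ‖v‖ ^ 2 := by
      intro v
      have e1 := hξ.integral_prod_decouple H c s hi (a := fun _ => v) measurable_const
        (integrable_const _) (ψ := fun z => ⟪v, z⟫) (by fun_prop) (hzv v)
      have e2 : ∀ ω, ∫ z, ⟪g' i (c • ξ i ω + s • z), v⟫ * ⟪v, z⟫ ∂(stdGaussian E)
          = s * secondDeriv (g' i) M N (0 + c • ξ i ω) v := by
        intro ω
        rw [secondDeriv, ← integral_const_mul]
        refine integral_congr_ae (Filter.Eventually.of_forall fun z => ?_)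
        simp only [hMz, hNz, zero_add, real_inner_smul_left]
        field_simp
      have e3 : B v = ∫ ω, s * secondDeriv (g' i) M N (0 + c • ξ i ω) v ∂μ := by
        simp only [← e2]
        exact e1
      have hQi : Integrable (fun ω => secondDeriv (g' i) M N (0 + c • ξ i ω) v) μ := by
        refine Integrable.integral_prod_left (ν := stdGaussian E)
          (f := fun p : Ω × E => ⟪g' i (0 + c • ξ i p.1 + M p.2), v⟫ * ⟪N v, p.2⟫) ?_
        refine Integrable.bdd_mul (c := G * ‖v‖) ((hzv (N v)).comp_snd _)
          (Measurable.aestronglyMeasurable (by fun_prop))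
          (Filter.Eventually.of_forall fun p => (H' i).abs_inner_grad_le _ _)
      have e4 : B v - s * secondDeriv (g' i) M N 0 v
          = ∫ ω, s * (secondDeriv (g' i) M N (0 + c • ξ i ω) v
            - secondDeriv (g' i) M N 0 v) ∂μ := by
        rw [integral_const_mul, integral_sub hQi (integrable_const _), e3, integral_const_mul]
        simp
        ring
      rw [e4, ← Real.norm_eq_abs]
      have e5 : s * (Λ * c * ∫ ω, ‖ξ i ω‖ ∂μ) * ‖v‖ ^ 2
          = ∫ ω, s * (Λ * ‖v‖ ^ 2 * (c * ‖ξ i ω‖)) ∂μ := by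
        rw [integral_const_mul, integral_const_mul, integral_const_mul]
        ring
      rw [e5]
      refine norm_integral_le_of_norm_le
        ((((hξ.integrable i).norm.const_mul _).const_mul _).const_mul _)
        (Filter.Eventually.of_forall fun ω => ?_)
      rw [norm_mul, Real.norm_eq_abs, Real.norm_eq_abs, abs_of_pos hs]
      have := hΛ i hi 0 v (c • ξ i ω)
      rw [norm_smul, Real.norm_eq_abs, abs_of_nonneg hc] at this
      exact mul_le_mul_of_nonneg_left this hs.le
    have hq2 := (hq_int i (fun _ => 0) measurable_const).const_mul s
    have e6 : ∫ ω, B (ξ i ω) ∂μ - s * q i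
        = ∫ ω, (B (ξ i ω) - s * secondDeriv (g' i) M N 0 (ξ i ω)) ∂μ := by
      rw [integral_sub (hBint i) hq2, integral_const_mul]
    rw [e6, ← Real.norm_eq_abs]
    calc _ ≤ ∫ ω, s * (Λ * c * ∫ ω, ‖ξ i ω‖ ∂μ) * ‖ξ i ω‖ ^ 2 ∂μ :=
          norm_integral_le_of_norm_le ((hξ.integrable_sq i).const_mul _)
            (Filter.Eventually.of_forall fun ω => hpt _)
      _ = s * (Λ * c) * ((∫ ω, ‖ξ i ω‖ ∂μ) * ∫ ω, ‖ξ i ω‖ ^ 2 ∂μ) := by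
          rw [integral_const_mul]; ring
      _ ≤ _ := by
          refine mul_le_mul_of_nonneg_left ?_ (by positivity)
          exact integral_mul_integral_sq_le (fun ω => norm_nonneg _) (hξ.integrable i).norm
            (hξ.integrable_sq i) (hξ.integrable_pow_three i)
  -- conclusion
  have hgx : ∀ i, Integrable (fun p : Ω × E => ⟪g (U p), ξ i p.1⟫) P := by
    intro i
    refine (((hξ.integrable i).norm.const_mul G).comp_fst _).mono'
      (Measurable.aestronglyMeasurable (by fun_prop)) (Filter.Eventually.of_forall fun p => ?_)
    exact H.abs_inner_grad_le _ _
  have hgp : Integrable (fun p : Ω × E => ⟪g (U p), p.2⟫) P := by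
    refine ((hz.const_mul G).comp_snd _).mono'
      (Measurable.aestronglyMeasurable (by fun_prop)) (Filter.Eventually.of_forall fun p => ?_)
    exact H.abs_inner_grad_le _ _
  -- The terms `s * c * q i` from the sum and from the Gaussian cancel. The remainders `s c² Λ / 2`
  -- and `s c² Λ`, each times the third moment, add up to the factor `3 / 2`.
  have hsplit : interpolationDeriv μ S ξ g θ
      = ∑ i ∈ S, (-s * (∫ p, ⟪g (U p), ξ i p.1⟫ ∂P - c * q i)
        + c * (∫ ω, B (ξ i ω) ∂μ - s * q i)) := by
    have e1 : ∀ p : Ω × E, ⟪g (U p), -s • ∑ j ∈ S, ξ j p.1 + c • p.2⟫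
        = -s * ∑ i ∈ S, ⟪g (U p), ξ i p.1⟫ + c * ⟪g (U p), p.2⟫ := by
      intro p
      rw [inner_add_right, real_inner_smul_right, real_inner_smul_right, inner_sum]
    change ∫ p, ⟪g (U p), -s • ∑ j ∈ S, ξ j p.1 + c • p.2⟫ ∂P = _
    simp_rw [e1]
    rw [integral_add ((integrable_finsetSum _ fun i _ => hgx i).const_mul _) (hgp.const_mul _),
      integral_const_mul, integral_const_mul, integral_finsetSum _ fun i _ => hgx i, hT2,
      Finset.mul_sum, Finset.mul_sum, ← Finset.sum_add_distrib]
    refine Finset.sum_congr rfl fun i _ => ?_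
    ring
  rw [hsplit, thirdMoment, Finset.mul_sum]
  refine (Finset.abs_sum_le_sum_abs _ _).trans (Finset.sum_le_sum fun i hi => ?_)
  refine (abs_add_le _ _).trans ?_
  rw [abs_mul, abs_mul, abs_neg, abs_of_pos hs, abs_of_nonneg hc]
  have h1 := mul_le_mul_of_nonneg_left (hT1 i hi) hs.le
  have h2 := mul_le_mul_of_nonneg_left (hBq i hi) hc
  refine (add_le_add h1 h2).trans (le_of_eq ?_)
  ring

end IsStandardized

end Interpolation

/-! ### Closeness on convex sets and quasiconcave test functions. -/

section Closeness

open scoped RealInnerProductSpace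

variable {E : Type*} [NormedAddCommGroup E] [InnerProductSpace ℝ E] [FiniteDimensional ℝ E]
  [MeasurableSpace E] [BorelSpace E]

/-- Two measures differ by at most `κ` on every closed convex set. -/
def ConvexClose (P Q : Measure E) (κ : ℝ) : Prop :=
  ∀ A : Set E, Convex ℝ A → IsClosed A → |P.real A - Q.real A| ≤ κ

lemma ConvexClose.nonneg {P Q : Measure E} {κ : ℝ} (h : ConvexClose P Q κ) : 0 ≤ κ :=
  (abs_nonneg _).trans (h ∅ convex_empty isClosed_empty)

lemma ConvexClose.mono {P Q : Measure E} {κ κ' : ℝ} (h : ConvexClose P Q κ) (hκ : κ ≤ κ') :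
    ConvexClose P Q κ' := fun A hA hc => (h A hA hc).trans hκ

/-- Measures that are close on closed convex sets are close on quasiconcave functions. -/
lemma ConvexClose.abs_integral_sub_le {P Q : Measure E} [IsProbabilityMeasure P]
    [IsProbabilityMeasure Q] {κ : ℝ} (hPQ : ConvexClose P Q κ) {f : E → ℝ} (hf : Continuous f)
    (h0 : ∀ x, 0 ≤ f x) (h1 : ∀ x, f x ≤ 1) (hconv : ∀ t, Convex ℝ {x | t ≤ f x}) :
    |∫ x, f x ∂P - ∫ x, f x ∂Q| ≤ κ := by
  have hint : ∀ (ν : Measure E) [IsProbabilityMeasure ν], Integrable f ν := by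
    intro ν _
    refine Integrable.of_bound hf.measurable.aestronglyMeasurable 1
      (Filter.Eventually.of_forall fun x => ?_)
    rw [Real.norm_of_nonneg (h0 x)]
    exact h1 x
  -- Layer-cake formula: the superlevel sets are closed and convex, so the integrands differ by at
  -- most `κ` on an interval of length one.
  have hlay : ∀ (ν : Measure E) [IsProbabilityMeasure ν],
      (∫ x, f x ∂ν) = ∫ t in Set.Ioc (0:ℝ) 1, ν.real {x | t ≤ f x} := fun ν _ =>
    (hint ν).integral_eq_integral_Ioc_meas_le (Filter.Eventually.of_forall h0)
      (Filter.Eventually.of_forall h1)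
  have hanti : ∀ (ν : Measure E) [IsProbabilityMeasure ν],
      IntegrableOn (fun t : ℝ => ν.real {x | t ≤ f x}) (Set.Ioc 0 1) := by
    intro ν _
    have hm : Antitone fun t : ℝ => ν.real {x | t ≤ f x} := fun t t' htt' =>
      measureReal_mono (fun x hx => le_trans htt' hx)
    refine Integrable.of_bound hm.measurable.aestronglyMeasurable 1
      (Filter.Eventually.of_forall fun t => ?_)
    rw [Real.norm_of_nonneg measureReal_nonneg]
    exact measureReal_le_one
  rw [hlay P, hlay Q, ← integral_sub (hanti P) (hanti Q), ← Real.norm_eq_abs]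
  have := norm_setIntegral_le_of_norm_le_const (μ := volume) (s := Set.Ioc (0:ℝ) 1)
    (f := fun t => P.real {x | t ≤ f x} - Q.real {x | t ≤ f x}) (C := κ) (by simp)
    (fun t _ => hPQ _ (hconv t) (isClosed_le continuous_const hf))
  simpa using this

end Closeness

/-! ### Sublevel sets of functions with subgradients. -/

section Strips

open scoped RealInnerProductSpace

variable {E : Type*} [NormedAddCommGroup E] [InnerProductSpace ℝ E] [MeasurableSpace E]

namespace IsSubgradientField

variable {s : E → ℝ} {n : E → E}

lemma continuous (h : IsSubgradientField s n) : Continuous s := by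
  have : LipschitzWith 1 s := LipschitzWith.of_dist_le_mul fun x y => by
    simpa [Real.dist_eq, dist_eq_norm] using h.abs_sub_le_norm x y
  exact this.continuous

lemma convex_le (h : IsSubgradientField s n) (t : ℝ) : Convex ℝ {x | s x ≤ t} := by
  intro x hx y hy a b ha hb hab
  have hx' : s x ≤ t := hx
  have hy' : s y ≤ t := hy
  change s (a • x + b • y) ≤ t
  set z := a • x + b • y
  have h1 := h.le z x
  have h2 := h.le z y
  have h3 : a * ⟪n z, x - z⟫ + b * ⟪n z, y - z⟫ = 0 := by
    rw [← real_inner_smul_right, ← real_inner_smul_right, ← inner_add_right]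
    have : a • (x - z) + b • (y - z) = 0 := by
      rw [smul_sub, smul_sub, sub_add_sub_comm, ← add_smul, hab, one_smul, sub_self]
    rw [this, inner_zero_right]
  have h4 : a * s z + b * s z = s z := by rw [← add_mul, hab, one_mul]
  have h5 : a * t + b * t = t := by rw [← add_mul, hab, one_mul]
  have h6 := mul_le_mul_of_nonneg_left (h1.trans hx') ha
  have h7 := mul_le_mul_of_nonneg_left (h2.trans hy') hb
  linarith

lemma isClosed_le (h : IsSubgradientField s n) (t : ℝ) : IsClosed {x | s x ≤ t} :=
  _root_.isClosed_le h.continuous continuous_const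

lemma le_of_infDist_lt (h : IsSubgradientField s n) {t ε : ℝ} (hne : {x | s x ≤ t}.Nonempty)
    {x : E} (hx : Metric.infDist x {x | s x ≤ t} < ε) : s x ≤ t + ε := by
  obtain ⟨y, hy, hxy⟩ := (Metric.infDist_lt_iff hne).1 hx
  have h1 := h.sub_le_norm x y
  rw [dist_eq_norm] at hxy
  have hy' : s y ≤ t := hy
  linarith

variable [BorelSpace E]

lemma add_const (h : IsSubgradientField s n) (a : ℝ) :
    IsSubgradientField (fun x => s x + a) n where
  measurable_fun := h.measurable_fun.add_const a
  measurable_field := h.measurable_field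
  norm_le := h.norm_le
  le := fun x y => by have := h.le x y; linarith

variable [FiniteDimensional ℝ E]

/-- Composition with an affine map. -/
lemma comp_affine (h : IsSubgradientField s n) (L : E →L[ℝ] E)
    (hL : ∀ x, ‖L.adjoint x‖ ≤ ‖x‖) (a : E) :
    IsSubgradientField (fun x => s (L x + a)) (fun x => L.adjoint (n (L x + a))) where
  measurable_fun := h.measurable_fun.comp (by fun_prop)
  measurable_field := by
    have := h.measurable_field
    fun_prop
  norm_le := fun x => (hL _).trans (h.norm_le _)
  le := fun x y => by
    have := h.le (L x + a) (L y + a)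
    rw [ContinuousLinearMap.adjoint_inner_left, map_sub]
    rwa [add_sub_add_right_eq_sub] at this

end IsSubgradientField

end Strips

/-! ### Strip probabilities, Lipschitz bounds for averaged gradients, exchange of Gaussian factors.
-/

section LipschitzBounds

open scoped RealInnerProductSpace

variable {E : Type*} [NormedAddCommGroup E] [InnerProductSpace ℝ E] [FiniteDimensional ℝ E]
  [MeasurableSpace E] [BorelSpace E]

variable {Ω : Type*} [MeasurableSpace Ω] {μ : Measure Ω} [IsProbabilityMeasure μ]

/-- Probability of an affine image of a random vector lying in a strip of width `ε`. -/
lemma strip_probability_le {s : E → ℝ} {n : E → E} (hs : IsSubgradientField s n)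
    (hn : ∀ x, ‖n x‖ = 1) {ε : ℝ} (hε : 0 ≤ ε) {V : Ω → E} (hV : Measurable V) {κ : ℝ}
    (hκ : ConvexClose (μ.map V) (stdGaussian E) κ) (L : E →L[ℝ] E)
    (hL : ∀ x, ‖L.adjoint x‖ ≤ ‖x‖) {m : ℝ} (hm : 0 < m) (hLm : ∀ x, m * ‖x‖ ≤ ‖L.adjoint x‖)
    (a : E) :
    μ.real {ω | 0 < s (L (V ω) + a) ∧ s (L (V ω) + a) ≤ ε}
      ≤ 2 * κ + Real.sqrt (Module.finrank ℝ E) * ε / m ^ 2 := by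
  have hs' := hs.comp_affine L hL a
  -- The strip is a difference of two closed convex sets, so passing to the Gaussian costs `2κ`. The
  -- pulled-back subgradients have norm at least `m`, which gives `m²` in the Gaussian strip bound.
  have h1 := hκ _ (hs'.convex_le 0) (hs'.isClosed_le 0)
  have h2 := hκ _ (hs'.convex_le ε) (hs'.isClosed_le ε)
  have hmeas : ∀ t, MeasurableSet {x | s (L x + a) ≤ t} := fun t => (hs'.isClosed_le t).measurableSet
  have hmap : ∀ t, (μ.map V).real {x | s (L x + a) ≤ t} = μ.real {ω | s (L (V ω) + a) ≤ t} :=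
    fun t => map_measureReal_apply hV (hmeas t)
  rw [hmap] at h1 h2
  have h3 : μ.real {ω | 0 < s (L (V ω) + a) ∧ s (L (V ω) + a) ≤ ε}
      = μ.real {ω | s (L (V ω) + a) ≤ ε} - μ.real {ω | s (L (V ω) + a) ≤ 0} := by
    rw [← measureReal_sdiff (s₂ := {ω | s (L (V ω) + a) ≤ 0}) (s₁ := {ω | s (L (V ω) + a) ≤ ε})
      (fun ω hω => le_trans hω hε) (hV (hmeas 0))]
    congr 1
    ext ω
    simp [and_comm]
  have h4 : (stdGaussian E).real {x | s (L x + a) ≤ ε}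
      ≤ (stdGaussian E).real {x | s (L x + a) ≤ 0}
        + (stdGaussian E).real {x | 0 ≤ s (L x + a) ∧ s (L x + a) ≤ ε} := by
    refine (measureReal_mono (fun x hx => ?_)).trans (measureReal_union_le _ _)
    rcases le_total (s (L x + a)) 0 with h0 | h0
    · exact Or.inl h0
    · exact Or.inr ⟨h0, hx⟩
  have h5 := stdGaussian_strip_le hs' hm.le
    (fun x => by have := hLm (n (L x + a)); rwa [hn, mul_one] at this) hε
  have h6 : (stdGaussian E).real {x | 0 ≤ s (L x + a) ∧ s (L x + a) ≤ ε}
      ≤ Real.sqrt (Module.finrank ℝ E) * ε / m ^ 2 := by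
    rw [le_div_iff₀ (by positivity), mul_comm]
    exact h5
  have h7 := (abs_le.1 h1).1
  have h8 := (abs_le.1 h2).2
  linarith

namespace IsSmoothing

variable {A : Set E} {ε : ℝ} {h : E → ℝ} {g : E → E}

lemma norm_grad_le (H : IsSmoothing A ε h g) (hε : 0 < ε) (hne : A.Nonempty) (x : E) :
    ‖g x‖ ≤ 4 / ε := by
  rcases lt_or_ge (Metric.infDist x A) ε with hx | hx
  · obtain ⟨y, hy, hxy⟩ := (Metric.infDist_lt_iff hne).1 hx
    have h1 := H.lipschitz x y
    rw [H.grad_eq_zero_of_mem y hy, sub_zero, ← dist_eq_norm] at h1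
    refine h1.trans ?_
    calc 4 / ε ^ 2 * dist x y ≤ 4 / ε ^ 2 * ε := by gcongr
      _ = 4 / ε := by field_simp
  · rw [H.grad_eq_zero x hx, norm_zero]
    positivity

lemma isSmoothPair (H : IsSmoothing A ε h g) (hε : 0 < ε) (hne : A.Nonempty) :
    IsSmoothPair h g (4 / ε) where
  abs_le_one := fun x => abs_le.2 ⟨by linarith [H.nonneg x], H.le_one x⟩
  hasFDerivAt := H.hasFDerivAt
  continuous_grad := H.continuous_grad
  norm_grad_le := H.norm_grad_le hε hne

/-- The averaged gradient of a smoothed indicator is Lipschitz with a constant proportional to the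
probability of the boundary strip. -/
lemma norm_average_grad_sub_le (H : IsSmoothing A ε h g) (hε : 0 < ε) (hne : A.Nonempty)
    {Y : Ω → E} (hY : Measurable Y) {p : ℝ} {S : Set E} (hS : MeasurableSet S)
    (hAS : ∀ x, x ∉ A → Metric.infDist x A < ε → x ∈ S)
    (hp : ∀ x, μ.real {ω | Y ω + x ∈ S} ≤ p) (x y : E) :
    ‖∫ ω, g (Y ω + x) ∂μ - ∫ ω, g (Y ω + y) ∂μ‖ ≤ 8 * p / ε ^ 2 * ‖x - y‖ := by
  have hgm := H.continuous_grad.measurable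
  have hgi : ∀ x, Integrable (fun ω => g (Y ω + x)) μ := fun x =>
    Integrable.of_bound (Measurable.aestronglyMeasurable (by fun_prop)) (4 / ε)
      (Filter.Eventually.of_forall fun ω => H.norm_grad_le hε hne _)
  have hzero : ∀ z, z ∉ S → g z = 0 := by
    intro z hz
    by_cases hzA : z ∈ A
    · exact H.grad_eq_zero_of_mem z hzA
    · exact H.grad_eq_zero z (not_lt.1 fun hlt => hz (hAS z hzA hlt))
  have hmS : ∀ x, MeasurableSet {ω | Y ω + x ∈ S} := fun x => (hY.add_const x) hS
  have hind : ∀ x, Integrable ({ω | Y ω + x ∈ S}.indicator (fun _ => (1:ℝ))) μ := fun x =>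
    (integrable_const _).indicator (hmS x)
  rw [← integral_sub (hgi x) (hgi y)]
  -- The increment of `g` vanishes unless one of the two points lies in `S`; two points, each with
  -- probability at most `p`, turn `4` into `8`.
  calc _ ≤ ∫ ω, 4 / ε ^ 2 * ‖x - y‖ * ({ω | Y ω + x ∈ S}.indicator (fun _ => (1:ℝ)) ω
          + {ω | Y ω + y ∈ S}.indicator (fun _ => (1:ℝ)) ω) ∂μ := by
        refine norm_integral_le_of_norm_le (((hind x).add (hind y)).const_mul _)
          (Filter.Eventually.of_forall fun ω => ?_)
        have h1 := H.lipschitz (Y ω + x) (Y ω + y)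
        rw [add_sub_add_left_eq_sub] at h1
        have h2 : 0 ≤ 4 / ε ^ 2 * ‖x - y‖ := by positivity
        have h3 : ∀ z, 0 ≤ {ω | Y ω + z ∈ S}.indicator (fun _ => (1:ℝ)) ω := fun z =>
          Set.indicator_nonneg (fun _ _ => zero_le_one) _
        by_cases hx : Y ω + x ∈ S
        · have e : {ω | Y ω + x ∈ S}.indicator (fun _ => (1:ℝ)) ω = 1 :=
            Set.indicator_of_mem (s := {ω | Y ω + x ∈ S}) hx _
          rw [e]
          exact h1.trans (le_mul_of_one_le_right h2 (by linarith [h3 y]))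
        by_cases hy : Y ω + y ∈ S
        · have e : {ω | Y ω + y ∈ S}.indicator (fun _ => (1:ℝ)) ω = 1 :=
            Set.indicator_of_mem (s := {ω | Y ω + y ∈ S}) hy _
          rw [e]
          exact h1.trans (le_mul_of_one_le_right h2 (by linarith [h3 x]))
        · rw [hzero _ hx, hzero _ hy, sub_zero, norm_zero]
          exact mul_nonneg h2 (add_nonneg (h3 x) (h3 y))
    _ = 4 / ε ^ 2 * ‖x - y‖ * (μ.real {ω | Y ω + x ∈ S} + μ.real {ω | Y ω + y ∈ S}) := by
        rw [integral_const_mul, integral_add (hind x) (hind y), integral_indicator_const _ (hmS x),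
          integral_indicator_const _ (hmS y)]
        simp
    _ ≤ 4 / ε ^ 2 * ‖x - y‖ * (p + p) := by
        gcongr
        · exact hp x
        · exact hp y
    _ = _ := by ring

end IsSmoothing

namespace IsSmoothPair

variable {h : E → ℝ} {g : E → E} {G : ℝ}

/-- The roles of two independent Gaussian perturbations in `secondDeriv` can be exchanged. -/
lemma secondDeriv_swap (H : IsSmoothPair h g G) {M N M' N' : E →L[ℝ] E}
    (hMN : ∀ v, M (N v) = v) (hMN' : ∀ v, M' (N' v) = v) (x v : E) :
    secondDeriv (fun y => ∫ z, g (M' z + y) ∂(stdGaussian E)) M N x v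
      = secondDeriv (fun y => ∫ z, g (M z + y) ∂(stdGaussian E)) M' N' x v := by
  have hgm := H.continuous_grad.measurable
  -- Both sides are the derivative at `r = 0` of the average of `⟪g (x + r • v + M z + M' z'), v⟫`
  -- over independent Gaussians `z` and `z'`.
  have h1 := (H.average (μ := stdGaussian E) (Y := M') (by fun_prop)).hasDerivAt_integral_grad
    hMN x v 0
  have h2 := (H.average (μ := stdGaussian E) (Y := M) (by fun_prop)).hasDerivAt_integral_grad
    hMN' x v 0
  have hgi : ∀ (L : E →L[ℝ] E) y, Integrable (fun z => g (L z + y)) (stdGaussian E) := fun L y =>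
    Integrable.of_bound (Measurable.aestronglyMeasurable (by fun_prop)) G
      (Filter.Eventually.of_forall fun ω => H.norm_grad_le _)
  have e : ∀ (L : E →L[ℝ] E) y, ⟪∫ z, g (L z + y) ∂(stdGaussian E), v⟫
      = ∫ z, ⟪g (L z + y), v⟫ ∂(stdGaussian E) := by
    intro L y
    rw [real_inner_comm, ← integral_inner (𝕜 := ℝ) (hgi L y)]
    simp_rw [real_inner_comm]
  simp_rw [e] at h1 h2
  have e2 : ∀ r : ℝ, ∫ z, ∫ z', ⟪g (M' z' + (x + r • v + M z)), v⟫ ∂(stdGaussian E) ∂(stdGaussian E)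
      = ∫ z', ∫ z, ⟪g (M z + (x + r • v + M' z')), v⟫ ∂(stdGaussian E) ∂(stdGaussian E) := by
    intro r
    rw [integral_integral_swap]
    · refine integral_congr_ae (Filter.Eventually.of_forall fun z' =>
        integral_congr_ae (Filter.Eventually.of_forall fun z => ?_))
      simp only
      congr 2
      abel
    · refine Integrable.of_bound (Measurable.aestronglyMeasurable ?_) (G * ‖v‖)
        (Filter.Eventually.of_forall fun p => H.abs_inner_grad_le _ _)
      simp only [Function.uncurry_def]
      fun_prop
  simp_rw [e2] at h1
  simpa using h1.unique h2

end IsSmoothPair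

end LipschitzBounds

/-! ### Second derivatives averaged over the leave-one-out sums. -/

section LeaveOneOut

open scoped RealInnerProductSpace

variable {E : Type*} [NormedAddCommGroup E] [InnerProductSpace ℝ E] [FiniteDimensional ℝ E]
  [MeasurableSpace E] [BorelSpace E]

variable {Ω ι : Type*} [MeasurableSpace Ω] {μ : Measure Ω} {S : Finset ι} {ξ : ι → Ω → E}

/-- After a renormalization by an operator of norm at most `b`, the random vector `V` is `κ`-close
to the standard Gaussian on convex sets. -/
def IsNearlyGaussian (μ : Measure Ω) (V : Ω → E) (b κ : ℝ) : Prop :=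
  ∃ B D : E →L[ℝ] E, (∀ v, D (B v) = v) ∧ (∀ v, B (D v) = v) ∧ D.adjoint = D ∧
    (∀ x, ‖D x‖ ≤ ‖x‖) ∧ (∀ x, ‖B x‖ ≤ b * ‖x‖) ∧
    ConvexClose (μ.map fun ω => B (V ω)) (stdGaussian E) κ

variable [IsProbabilityMeasure μ]

/-- As `V = D (B V)`, the strip is pulled back along `c • D` to the nearly Gaussian vector `B V`.
The adjoint of `c • D` shrinks norms at most by `c / b`, and `b² / c² ≤ (25/24) / 0.97 ≤ 1.1`. -/
lemma IsNearlyGaussian.strip_le {V : Ω → E} {b κ : ℝ} (hV : Measurable V)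
    (hVG : IsNearlyGaussian μ V b κ) (hb0 : 0 < b) (hb : b ^ 2 ≤ 25 / 24) {s : E → ℝ} {n : E → E}
    (hs : IsSubgradientField s n) (hn : ∀ x, ‖n x‖ = 1) {ε : ℝ} (hε : 0 ≤ ε) {c : ℝ}
    (hc0 : 0 < c) (hc1 : c ≤ 1) (hc : 0.97 ≤ c ^ 2) (a : E) :
    μ.real {ω | c • V ω + a ∈ {x | 0 < s x ∧ s x ≤ ε}}
      ≤ 2 * κ + 1.1 * Real.sqrt (Module.finrank ℝ E) * ε := by
  obtain ⟨B, D, hDB, hBD, hD, hD1, hB, hclose⟩ := hVG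
  have hadj : (c • D).adjoint = c • D := by
    rw [map_smulₛₗ, hD]
    simp
  have hnorm : ∀ x, ‖(c • D).adjoint x‖ = c * ‖D x‖ := fun x => by
    rw [hadj, smul_apply, norm_smul, Real.norm_of_nonneg hc0.le]
  have h1 := strip_probability_le hs hn hε (V := fun ω => B (V ω)) (by fun_prop) hclose (c • D)
    (fun x => by
      rw [hnorm]
      exact (mul_le_of_le_one_left (norm_nonneg _) hc1).trans (hD1 x))
    (m := c / b) (by positivity)
    (fun x => by
      rw [hnorm, div_mul_eq_mul_div, div_le_iff₀ hb0]
      have := hB (D x)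
      rw [hBD] at this
      calc c * ‖x‖ ≤ c * (b * ‖D x‖) := by gcongr
        _ = _ := by ring) a
  have e : {ω | c • V ω + a ∈ {x | 0 < s x ∧ s x ≤ ε}}
      = {ω | 0 < s ((c • D) (B (V ω)) + a) ∧ s ((c • D) (B (V ω)) + a) ≤ ε} := by
    ext ω
    simp [hDB]
  rw [e]
  refine h1.trans ?_
  gcongr
  rw [div_le_iff₀ (by positivity), div_pow]
  have h2 : (1:ℝ) ≤ 1.1 * (c ^ 2 / b ^ 2) := by
    rw [← mul_div_assoc, le_div_iff₀ (by positivity)]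
    nlinarith
  have h3 : 0 ≤ Real.sqrt (Module.finrank ℝ E) * ε := by positivity
  nlinarith

lemma IsSmoothing.convex_preimage {A : Set E} {ε : ℝ} {h : E → ℝ} {g : E → E}
    (H : IsSmoothing A ε h g) (L : E →L[ℝ] E) (a : E) (t : ℝ) : Convex ℝ {x | t ≤ h (L x + a)} := by
  have h1 : Convex ℝ ((fun x => x + a) ⁻¹' {x | t ≤ h x}) := (H.convex t).translate_preimage_left a
  exact h1.linear_preimage (L : E →ₗ[ℝ] E)

namespace IsSmoothing

variable {A : Set E} {ε : ℝ} {h : E → ℝ} {g : E → E}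

lemma abs_average_sub_le (H : IsSmoothing A ε h g) {V : Ω → E} (hV : Measurable V) {κ : ℝ}
    (hκ : ConvexClose (μ.map V) (stdGaussian E) κ) (L : E →L[ℝ] E) (a : E) :
    |∫ ω, h (L (V ω) + a) ∂μ - ∫ z, h (L z + a) ∂(stdGaussian E)| ≤ κ := by
  have : IsProbabilityMeasure (μ.map V) := Measure.isProbabilityMeasure_map hV.aemeasurable
  have hhc := H.continuous
  have hhm := hhc.measurable
  have h1 := hκ.abs_integral_sub_le (f := fun x => h (L x + a)) (by fun_prop) (fun x => H.nonneg _)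
    (fun x => H.le_one _) (fun t => H.convex_preimage L a t)
  rwa [integral_map hV.aemeasurable (f := fun x => h (L x + a))
    (Measurable.aestronglyMeasurable (by fun_prop))] at h1

/-- Lipschitz bound for the second derivative of the averaged smoothed indicator, valid at all
angles. -/
lemma abs_secondDeriv_average_sub_le (H : IsSmoothing A ε h g) (hε : 0 < ε) (hne : A.Nonempty)
    {V : Ω → E} (hV : Measurable V) {b κ : ℝ} (hVG : IsNearlyGaussian μ V b κ) (hb0 : 0 < b)
    {c t : ℝ} (hc : 0 ≤ c) (ht : 0 < t) {r : ℝ} (hr0 : 0 ≤ r)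
    (hr : 1 ≤ r * t ^ 3 ∨ 0 < c ∧ b ^ 3 ≤ r * c ^ 3) (x v w : E) :
    |secondDeriv (fun x => ∫ ω, g (c • V ω + x) ∂μ) (t • ContinuousLinearMap.id ℝ E)
          (t⁻¹ • ContinuousLinearMap.id ℝ E) (x + w) v
        - secondDeriv (fun x => ∫ ω, g (c • V ω + x) ∂μ) (t • ContinuousLinearMap.id ℝ E)
          (t⁻¹ • ContinuousLinearMap.id ℝ E) x v|
      ≤ 3.42 * (κ / t ^ 3 + r) * ‖v‖ ^ 2 * ‖w‖ := by
  obtain ⟨B, D, hDB, hBD, hD, hD1, hB, hclose⟩ := hVG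
  have P := H.isSmoothPair hε hne
  have hMN : ∀ v, (t • ContinuousLinearMap.id ℝ E) ((t⁻¹ • ContinuousLinearMap.id ℝ E) v) = v :=
    fun v => by simp [smul_smul, ht.ne']
  have hNn : ∀ v : E, ‖(t⁻¹ • ContinuousLinearMap.id ℝ E) v‖ = t⁻¹ * ‖v‖ := fun v => by
    simp [norm_smul, abs_of_pos ht]
  have hBV : Measurable fun ω => B (V ω) := by fun_prop
  have P1 := P.average (μ := μ) (Y := fun ω => c • V ω) (by fun_prop)
  have P2 := P.average (μ := stdGaussian E) (Y := (c • D : E →L[ℝ] E)) (by fun_prop)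
  have hk : ∀ x, |∫ ω, h (c • V ω + x) ∂μ - ∫ z, h ((c • D) z + x) ∂(stdGaussian E)| ≤ κ := by
    intro x
    have := H.abs_average_sub_le hBV hclose (c • D) x
    simpa [hDB] using this
  have h1 := P1.abs_secondDeriv_sub_le_of_close P2 hk hMN x v w
  rw [hNn, hNn] at h1
  refine h1.trans ?_
  have h2 : |secondDeriv (fun x => ∫ z, g ((c • D) z + x) ∂(stdGaussian E))
          (t • ContinuousLinearMap.id ℝ E) (t⁻¹ • ContinuousLinearMap.id ℝ E) (x + w) v
        - secondDeriv (fun x => ∫ z, g ((c • D) z + x) ∂(stdGaussian E))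
          (t • ContinuousLinearMap.id ℝ E) (t⁻¹ • ContinuousLinearMap.id ℝ E) x v|
      ≤ 3.42 * r * ‖v‖ ^ 2 * ‖w‖ := by
    -- Once the leave-one-out sum is replaced by a Gaussian, two independent Gaussians are
    -- available, with scales `t` and about `c`. All three derivatives go on one of them, at the
    -- price `t⁻³` or `(b / c)³`.
    rcases hr with hr | ⟨hc', hr⟩
    · refine (P2.abs_secondDeriv_sub_le hMN x v w).trans ?_
      rw [hNn, hNn]
      have : t⁻¹ ^ 3 ≤ r := by
        rw [inv_pow, inv_le_iff_one_le_mul₀ (by positivity)]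
        exact hr
      calc 3.42 * (t⁻¹ * ‖v‖) ^ 2 * (t⁻¹ * ‖w‖) = 3.42 * t⁻¹ ^ 3 * ‖v‖ ^ 2 * ‖w‖ := by ring
        _ ≤ _ := by gcongr
    · have hMN' : ∀ v, (c • D) ((c⁻¹ • B) v) = v := fun v => by
        simp [smul_smul, hDB, hc'.ne']
      have hN' : ∀ v : E, ‖(c⁻¹ • B) v‖ ≤ c⁻¹ * b * ‖v‖ := fun v => by
        rw [smul_apply, norm_smul, Real.norm_of_nonneg (by positivity), mul_assoc]
        gcongr
        exact hB v
      rw [P.secondDeriv_swap hMN hMN', P.secondDeriv_swap hMN hMN']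
      have P3 := P.average (μ := stdGaussian E) (Y := (t • ContinuousLinearMap.id ℝ E : E →L[ℝ] E))
        (by fun_prop)
      refine (P3.abs_secondDeriv_sub_le hMN' x v w).trans ?_
      have : (c⁻¹ * b) ^ 3 ≤ r := by
        rw [mul_pow, inv_pow, inv_mul_le_iff₀ (by positivity)]
        linarith
      calc 3.42 * ‖(c⁻¹ • B) v‖ ^ 2 * ‖(c⁻¹ • B) w‖
          ≤ 3.42 * (c⁻¹ * b * ‖v‖) ^ 2 * (c⁻¹ * b * ‖w‖) := by
            gcongr
            · exact hN' v
            · exact hN' w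
        _ = 3.42 * (c⁻¹ * b) ^ 3 * ‖v‖ ^ 2 * ‖w‖ := by ring
        _ ≤ _ := by gcongr
  calc _ ≤ 3.42 * κ * (t⁻¹ * ‖v‖) ^ 2 * (t⁻¹ * ‖w‖) + 3.42 * r * ‖v‖ ^ 2 * ‖w‖ := by
        gcongr
    _ = _ := by
      field_simp

/-- Lipschitz bound for the second derivative of the averaged smoothed indicator of a sublevel set,
for small angles. -/
lemma abs_secondDeriv_average_sub_le_strip {s : E → ℝ} {n : E → E} {τ : ℝ}
    (H : IsSmoothing {x | s x ≤ 0} ε h g) (hε : 0 < ε) (hne : {x | s x ≤ 0}.Nonempty)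
    (hs : IsSubgradientField s n) (hn : ∀ x, ‖n x‖ = 1)
    {V : Ω → E} (hV : Measurable V) {b κ : ℝ} (hVG : IsNearlyGaussian μ V b κ) (hb0 : 0 < b)
    (hb : b ^ 2 ≤ 25 / 24) {c t : ℝ} (hc0 : 0 < c) (hc1 : c ≤ 1) (hc : 0.97 ≤ c ^ 2) (ht : 0 < t)
    (hτ : τ = 2 * κ + 1.1 * Real.sqrt (Module.finrank ℝ E) * ε) (x v w : E) :
    |secondDeriv (fun x => ∫ ω, g (c • V ω + x) ∂μ) (t • ContinuousLinearMap.id ℝ E)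
          (t⁻¹ • ContinuousLinearMap.id ℝ E) (x + w) v
        - secondDeriv (fun x => ∫ ω, g (c • V ω + x) ∂μ) (t • ContinuousLinearMap.id ℝ E)
          (t⁻¹ • ContinuousLinearMap.id ℝ E) x v|
      ≤ 8 * τ / ε ^ 2 / t * ‖v‖ ^ 2 * ‖w‖ := by
  have hκ : 0 ≤ κ := by
    obtain ⟨B, D, -, -, -, -, -, hclose⟩ := hVG
    exact hclose.nonneg
  have P := H.isSmoothPair hε hne
  have hsm := hs.measurable_fun
  have hτ0 : 0 ≤ τ := by rw [hτ]; positivity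
  have hNn : ∀ v : E, ‖(t⁻¹ • ContinuousLinearMap.id ℝ E) v‖ = t⁻¹ * ‖v‖ := fun v => by
    simp [norm_smul, abs_of_pos ht]
  have P1 := P.average (μ := μ) (Y := fun ω => c • V ω) (by fun_prop)
  -- Only one derivative is put on the Gaussian, so the singularity is `1 / t` instead of `1 / t³`.
  -- The gradient of the smoothed indicator lives in `0 < s ≤ ε`, whose probability is at most `τ`.
  have hL := H.norm_average_grad_sub_le hε hne (μ := μ) (Y := fun ω => c • V ω) (by fun_prop)
    (p := τ) (S := {x | 0 < s x ∧ s x ≤ ε})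
    ((measurableSet_lt measurable_const hsm).inter (measurableSet_le hsm measurable_const))
    (fun x hx hxε => ⟨not_le.1 hx, by simpa using hs.le_of_infDist_lt hne hxε⟩)
    (fun x => by rw [hτ]; exact hVG.strip_le hV hb0 hb hs hn hε.le hc0 hc1 hc x)
  refine (P1.abs_secondDeriv_sub_le_of_lipschitz (L := 8 * τ / ε ^ 2) (by positivity) hL _ _ x v
    w).trans (le_of_eq ?_)
  rw [hNn]
  field_simp

end IsSmoothing

lemma abs_sub_le_of_abs_deriv_le {F F' Φ Φ' : ℝ → ℝ} {a b : ℝ} (hab : a ≤ b)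
    (hF : ∀ t, HasDerivAt F (F' t) t) (hΦ : ∀ t ∈ Set.Icc a b, HasDerivAt Φ (Φ' t) t)
    (h : ∀ t ∈ Set.Ioo a b, |F' t| ≤ Φ' t) : |F b - F a| ≤ Φ b - Φ a := by
  have key : ∀ G G' : ℝ → ℝ, (∀ t ∈ Set.Icc a b, HasDerivAt G (G' t) t) →
      (∀ t ∈ Set.Ioo a b, 0 ≤ G' t) → G a ≤ G b := by
    intro G G' hG hG'
    refine monotoneOn_of_deriv_nonneg (convex_Icc a b)
      (fun t ht => (hG t ht).continuousAt.continuousWithinAt)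
      (fun t ht => (hG t (interior_subset ht)).differentiableAt.differentiableWithinAt)
      (fun t ht => ?_) (Set.left_mem_Icc.2 hab) (Set.right_mem_Icc.2 hab) hab
    rw [(hG t (interior_subset ht)).deriv]
    rw [interior_Icc] at ht
    exact hG' t ht
  have h1 := key (fun t => Φ t - F t) _ (fun t ht => (hΦ t ht).sub (hF t))
    (fun t ht => by linarith [(abs_le.1 (h t ht)).2])
  have h2 := key (fun t => Φ t + F t) _ (fun t ht => (hΦ t ht).add (hF t))
    (fun t ht => by linarith [(abs_le.1 (h t ht)).1])
  rw [abs_le]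
  constructor <;> linarith

end LeaveOneOut

/-! ### One step of the Berry–Esseen induction. -/

section Comparison

open scoped RealInnerProductSpace

variable {E : Type*} [NormedAddCommGroup E] [InnerProductSpace ℝ E] [FiniteDimensional ℝ E]
  [MeasurableSpace E] [BorelSpace E]

variable {Ω ι : Type*} [MeasurableSpace Ω] {μ : Measure Ω} [IsProbabilityMeasure μ] {S : Finset ι}
  {ξ : ι → Ω → E} {h : E → ℝ} {g : E → E}

lemma measureReal_le_integral {α : Type*} [MeasurableSpace α] {ν : Measure α}
    [IsProbabilityMeasure ν] {f : α → ℝ} {A : Set α} (hA : MeasurableSet A) (hf : Integrable f ν)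
    (h0 : ∀ x, 0 ≤ f x) (h1 : ∀ x ∈ A, f x = 1) : ν.real A ≤ ∫ x, f x ∂ν := by
  rw [← integral_indicator_one hA]
  refine integral_mono ((integrable_const 1).indicator hA) hf fun x => ?_
  by_cases hx : x ∈ A
  · rw [Set.indicator_of_mem hx, h1 x hx]; simp
  · rw [Set.indicator_of_notMem hx]; exact h0 x

lemma integral_le_measureReal {α : Type*} [MeasurableSpace α] {ν : Measure α}
    [IsProbabilityMeasure ν] {f : α → ℝ} {A : Set α} (hA : MeasurableSet A) (hf : Integrable f ν)
    (h0 : ∀ x, f x ≤ 1) (h1 : ∀ x, x ∉ A → f x = 0) : ∫ x, f x ∂ν ≤ ν.real A := by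
  rw [← integral_indicator_one hA]
  refine integral_mono hf ((integrable_const 1).indicator hA) fun x => ?_
  by_cases hx : x ∈ A
  · rw [Set.indicator_of_mem hx]; exact h0 x
  · rw [Set.indicator_of_notMem hx, h1 x hx]

lemma interpolation_zero : interpolation μ S ξ h 0 = ∫ ω, h (∑ j ∈ S, ξ j ω) ∂μ := by
  unfold interpolation
  simp only [Real.cos_zero, Real.sin_zero, one_smul, zero_smul, add_zero]
  rw [integral_fun_fst (fun ω => h (∑ j ∈ S, ξ j ω))]
  simp

lemma interpolation_pi_div_two :
    interpolation μ S ξ h (Real.pi / 2) = ∫ z, h z ∂(stdGaussian E) := by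
  unfold interpolation
  simp only [Real.cos_pi_div_two, Real.sin_pi_div_two, one_smul, zero_smul, zero_add]
  rw [integral_fun_snd h]
  simp

namespace IsStandardized

variable [DecidableEq ι]

/-- Derivative bound of the interpolation valid at all angles. -/
lemma abs_interpolationDeriv_le_of_isSmoothing (hξ : IsStandardized μ S ξ) {A : Set E} {ε : ℝ}
    (H : IsSmoothing A ε h g) (hε : 0 < ε) (hne : A.Nonempty) {b κ : ℝ} (hb0 : 0 < b)
    (hb : b ^ 2 ≤ 25 / 24) (hκ : 0 ≤ κ)
    (hV : ∀ i ∈ S, IsNearlyGaussian μ (fun ω => ∑ j ∈ S.erase i, ξ j ω) b κ)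
    {θ : ℝ} (hc : 0 ≤ Real.cos θ) (hs : 0 < Real.sin θ) :
    |interpolationDeriv μ S ξ g θ|
      ≤ 5.13 * thirdMoment μ S ξ * (κ * (Real.cos θ / Real.sin θ ^ 2) + 1.064) := by
  have hγ := thirdMoment_nonneg μ S ξ
  have hc1 := Real.cos_le_one θ
  set c := Real.cos θ
  set t := Real.sin θ
  have hb3 : b ^ 3 ≤ 1.064 := by
    have h1 : b ≤ 1.021 := by nlinarith
    calc b ^ 3 = b * b ^ 2 := by ring
      _ ≤ 1.021 * (25 / 24) := by gcongr
      _ ≤ _ := by norm_num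
  -- The Gaussian with the larger coefficient takes the derivatives, so `t c² r` stays bounded by
  -- `1.064 ≥ b³` at every angle.
  obtain ⟨r, hr0, hr, hr'⟩ : ∃ r : ℝ, 0 ≤ r ∧ (1 ≤ r * t ^ 3 ∨ 0 < c ∧ b ^ 3 ≤ r * c ^ 3) ∧
      t * c ^ 2 * r ≤ 1.064 := by
    rcases le_total c t with h | h
    · refine ⟨(t ^ 3)⁻¹, by positivity, Or.inl ?_, ?_⟩
      · rw [inv_mul_cancel₀ (by positivity)]
      · calc t * c ^ 2 * (t ^ 3)⁻¹ ≤ t * t ^ 2 * (t ^ 3)⁻¹ := by gcongr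
          _ = 1 := by field_simp
          _ ≤ _ := by norm_num
    · have hc' : 0 < c := hs.trans_le h
      refine ⟨1.064 * (c ^ 3)⁻¹, by positivity, Or.inr ⟨hc', ?_⟩, ?_⟩
      · rw [mul_assoc, inv_mul_cancel₀ (by positivity), mul_one]
        exact hb3
      · calc t * c ^ 2 * (1.064 * (c ^ 3)⁻¹) ≤ c * c ^ 2 * (1.064 * (c ^ 3)⁻¹) := by gcongr
          _ = 1.064 := by field_simp
  have hm : ∀ i, Measurable fun ω => ∑ j ∈ S.erase i, ξ j ω := fun i => hξ.measurable_sum _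
  refine (hξ.abs_interpolationDeriv_le (H.isSmoothPair hε hne) hc hs
    (Λ := 3.42 * (κ / t ^ 3 + r)) (by positivity) fun i hi x v w =>
      H.abs_secondDeriv_average_sub_le hε hne (hm i) (hV i hi) hb0 hc hs hr0 hr x v w).trans ?_
  have h1 : κ * (c ^ 2 / t ^ 2) ≤ κ * (c / t ^ 2) := by
    gcongr
    nlinarith
  calc 3 / 2 * t * c ^ 2 * (3.42 * (κ / t ^ 3 + r)) * thirdMoment μ S ξ
      = 5.13 * thirdMoment μ S ξ * (κ * (c ^ 2 / t ^ 2) + t * c ^ 2 * r) := by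
        field_simp
        ring
    _ ≤ _ := by gcongr

/-- Derivative bound of the interpolation for small angles. -/
lemma abs_interpolationDeriv_le_of_strip (hξ : IsStandardized μ S ξ) {s : E → ℝ} {n : E → E}
    {ε τ : ℝ} (H : IsSmoothing {x | s x ≤ 0} ε h g) (hε : 0 < ε) (hne : {x | s x ≤ 0}.Nonempty)
    (hs : IsSubgradientField s n) (hn : ∀ x, ‖n x‖ = 1) {b κ : ℝ} (hb0 : 0 < b)
    (hb : b ^ 2 ≤ 25 / 24) (hκ : 0 ≤ κ)
    (hV : ∀ i ∈ S, IsNearlyGaussian μ (fun ω => ∑ j ∈ S.erase i, ξ j ω) b κ)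
    (hτ : τ = 2 * κ + 1.1 * Real.sqrt (Module.finrank ℝ E) * ε)
    {θ : ℝ} (hc0 : 0 < Real.cos θ) (hc : 0.97 ≤ Real.cos θ ^ 2) (ht : 0 < Real.sin θ) :
    |interpolationDeriv μ S ξ g θ| ≤ 12 * τ / ε ^ 2 * thirdMoment μ S ξ := by
  have hγ := thirdMoment_nonneg μ S ξ
  have hc1 := Real.cos_le_one θ
  have hτ0 : 0 ≤ τ := by rw [hτ]; positivity
  have hm : ∀ i, Measurable fun ω => ∑ j ∈ S.erase i, ξ j ω := fun i => hξ.measurable_sum _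
  refine (hξ.abs_interpolationDeriv_le (H.isSmoothPair hε hne) hc0.le ht
    (Λ := 8 * τ / ε ^ 2 / Real.sin θ) (by positivity) fun i hi x v w =>
      H.abs_secondDeriv_average_sub_le_strip hε hne hs hn (hm i) (hV i hi) hb0 hb hc0 hc1 hc ht
        hτ x v w).trans ?_
  calc _ = 12 * τ / ε ^ 2 * thirdMoment μ S ξ * Real.cos θ ^ 2 := by
        field_simp
        ring
    _ ≤ _ := by
        refine mul_le_of_le_one_right (by positivity) ?_
        nlinarith

/-- Comparison of the expectations of a smoothed indicator of a sublevel set. -/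
lemma abs_integral_isSmoothing_sub_le [Nontrivial E] (hξ : IsStandardized μ S ξ)
    (hγ : thirdMoment μ S ξ ≤ 1 / 200) {s : E → ℝ} {n : E → E}
    (H : IsSmoothing {x | s x ≤ 0} (60 * thirdMoment μ S ξ) h g)
    (hne : {x | s x ≤ 0}.Nonempty) (hs : IsSubgradientField s n) (hn : ∀ x, ‖n x‖ = 1) {b κ : ℝ}
    (hb0 : 0 < b) (hb : b ^ 2 ≤ 25 / 24) (hκ : 0 ≤ κ)
    (hV : ∀ i ∈ S, IsNearlyGaussian μ (fun ω => ∑ j ∈ S.erase i, ξ j ω) b κ) :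
    |∫ ω, h (∑ j ∈ S, ξ j ω) ∂μ - ∫ z, h z ∂(stdGaussian E)|
      ≤ 0.38 * κ + (6.6 * Real.sqrt (Module.finrank ℝ E) + 8.6) * thirdMoment μ S ξ := by
  have hγ0 := hξ.thirdMoment_pos
  set γ := thirdMoment μ S ξ
  have hε : 0 < 60 * γ := by positivity
  set τ := 2 * κ + 1.1 * Real.sqrt (Module.finrank ℝ E) * (60 * γ) with hτ
  have P := H.isSmoothPair hε hne
  have hF := hξ.hasDerivAt_interpolation P
  have hπ := Real.pi_gt_three
  have hπ4 := Real.pi_lt_d2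
  have hsin0 : ∀ θ, 0 < θ → θ < Real.pi / 2 + 1 → 0 < Real.sin θ := fun θ h0 h1 =>
    Real.sin_pos_of_pos_of_lt_pi h0 (by linarith)
  -- The angle `30γ`, half the smoothing width, separates the regimes. It is at most `0.15`, so
  -- `cos² ≥ 0.97` below it.
  have h1 := abs_sub_le_of_abs_deriv_le (F := interpolation μ S ξ h)
    (Φ := fun θ => 12 * τ / (60 * γ) ^ 2 * γ * θ) (Φ' := fun _ => 12 * τ / (60 * γ) ^ 2 * γ)
    (a := 0) (b := 30 * γ) (by positivity) hF
    (fun θ _ => by simpa using (hasDerivAt_id' θ).const_mul (12 * τ / (60 * γ) ^ 2 * γ))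
    (fun θ hθ => by
      have hs1 : 0 < Real.sin θ := hsin0 θ hθ.1 (by linarith [hθ.2])
      have hs2 : Real.sin θ < θ := Real.sin_lt hθ.1
      have hc0 : 0 < Real.cos θ := Real.cos_pos_of_mem_Ioo ⟨by linarith [hθ.1], by linarith [hθ.2]⟩
      refine hξ.abs_interpolationDeriv_le_of_strip H hε hne hs hn hb0 hb hκ hV hτ hc0 ?_ hs1
      have := Real.sin_sq_add_cos_sq θ
      have h2 := hθ.2
      nlinarith)
  have h2 := abs_sub_le_of_abs_deriv_le (F := interpolation μ S ξ h)
    (Φ := fun θ => 5.13 * γ * (-κ * (Real.sin θ)⁻¹ + 1.064 * θ))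
    (Φ' := fun θ => 5.13 * γ * (κ * (Real.cos θ / Real.sin θ ^ 2) + 1.064))
    (a := 30 * γ) (b := Real.pi / 2) (by linarith) hF
    (fun θ hθ => by
      have hs1 : 0 < Real.sin θ := hsin0 θ (by linarith [hθ.1]) (by linarith [hθ.2])
      refine ((((Real.hasDerivAt_sin θ).fun_inv hs1.ne').const_mul (-κ)).add
        ((hasDerivAt_id' θ).const_mul 1.064)).const_mul (5.13 * γ) |>.congr_deriv ?_
      ring)
    (fun θ hθ => by
      have hs1 : 0 < Real.sin θ := hsin0 θ (by linarith [hθ.1]) (by linarith [hθ.2])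
      have hc0 : 0 < Real.cos θ := Real.cos_pos_of_mem_Ioo ⟨by linarith [hθ.1], by linarith [hθ.2]⟩
      exact hξ.abs_interpolationDeriv_le_of_isSmoothing H hε hne hb0 hb hκ hV hc0.le hs1)
  rw [interpolation_pi_div_two] at h2
  rw [interpolation_zero] at h1
  have h3 : 12 * τ / (60 * γ) ^ 2 * γ * (30 * γ) = 0.1 * τ := by
    field_simp
    ring
  -- The antiderivative `-1 / sin` of `cos / sin²` is evaluated at `30γ`; `5.13 / 29.6` is below
  -- `0.175`.
  have h4 : 5.13 * γ * (κ * (Real.sin (30 * γ))⁻¹) ≤ 0.175 * κ := by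
    have h5 : 29.6 * γ ≤ Real.sin (30 * γ) := by
      have := Real.sin_gt_sub_cube (x := 30 * γ) (by positivity)
      nlinarith [mul_nonneg hγ0.le hγ0.le]
    have h6 : γ * (Real.sin (30 * γ))⁻¹ ≤ 29.6⁻¹ := by
      rw [← div_eq_mul_inv, div_le_iff₀ (by linarith), inv_mul_eq_div, le_div_iff₀ (by norm_num)]
      linarith
    calc 5.13 * γ * (κ * (Real.sin (30 * γ))⁻¹) = 5.13 * κ * (γ * (Real.sin (30 * γ))⁻¹) := by ring
      _ ≤ 5.13 * κ * 29.6⁻¹ := by gcongr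
      _ ≤ 0.175 * κ := by linarith
  have h7 : γ * Real.pi ≤ γ * 3.15 := by gcongr
  have h8 : 0 ≤ γ * κ := by positivity
  simp only [Real.sin_pi_div_two, inv_one] at h2
  have h9 := abs_sub_comm (∫ ω, h (∑ j ∈ S, ξ j ω) ∂μ) (∫ z, h z ∂(stdGaussian E))
  have h10 := abs_sub_le (∫ z, h z ∂(stdGaussian E)) (interpolation μ S ξ h (30 * γ))
    (∫ ω, h (∑ j ∈ S, ξ j ω) ∂μ)
  rw [h9]
  simp only [mul_zero, sub_zero] at h1
  rw [h3] at h1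
  -- Final count: `0.1 * 2 + 0.175 ≤ 0.38` for `κ`, `0.1 * 1.1 * 60 = 6.6` for `√d γ`, and `5.13 *
  -- 1.064 * π / 2 ≤ 8.6` for `γ`.
  have h11 : 0 ≤ Real.sqrt (Module.finrank ℝ E) * γ := by positivity
  rw [hτ] at h1
  nlinarith

/-- One step of the Berry-Esseen induction, on sublevel sets. -/
lemma abs_sub_le_of_leaveOneOut [Nontrivial E] (hξ : IsStandardized μ S ξ)
    (hγ : thirdMoment μ S ξ ≤ 1 / 200) {s : E → ℝ} {n : E → E}
    (hs : IsSubgradientField s n) (hn : ∀ x, ‖n x‖ = 1) {b κ : ℝ}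
    (hb0 : 0 < b) (hb : b ^ 2 ≤ 25 / 24) (hκ : 0 ≤ κ)
    (hV : ∀ i ∈ S, IsNearlyGaussian μ (fun ω => ∑ j ∈ S.erase i, ξ j ω) b κ) :
    |μ.real {ω | s (∑ j ∈ S, ξ j ω) ≤ 0} - (stdGaussian E).real {z | s z ≤ 0}|
      ≤ 0.38 * κ + (66.6 * Real.sqrt (Module.finrank ℝ E) + 8.6) * thirdMoment μ S ξ := by
  have hγ0 := hξ.thirdMoment_pos
  set γ := thirdMoment μ S ξ
  have hε : 0 < 60 * γ := by positivity
  have hd : 0 ≤ Real.sqrt (Module.finrank ℝ E) * γ := by positivity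
  have hW : Measurable fun ω => ∑ j ∈ S, ξ j ω := hξ.measurable_sum S
  have hsm := hs.measurable_fun
  have hWi : ∀ h : E → ℝ, ∀ g A ε, IsSmoothing A ε h g →
      Integrable (fun ω => h (∑ j ∈ S, ξ j ω)) μ ∧ Integrable h (stdGaussian E) := by
    intro h g A ε H
    have hm := H.continuous.measurable
    exact ⟨Integrable.of_bound (Measurable.aestronglyMeasurable (by fun_prop)) 1
      (Filter.Eventually.of_forall fun ω => by
        rw [Real.norm_of_nonneg (H.nonneg _)]; exact H.le_one _),
      Integrable.of_bound hm.aestronglyMeasurable 1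
      (Filter.Eventually.of_forall fun ω => by
        rw [Real.norm_of_nonneg (H.nonneg _)]; exact H.le_one _)⟩
  have hms : ∀ t, MeasurableSet {x | s x ≤ t} := fun t => measurableSet_le hsm measurable_const
  -- The smoothing layer has Gaussian measure at most `60√d γ`, which raises `6.6` to `66.6`.
  have hstrip : ∀ (s' : E → ℝ), IsSubgradientField s' n →
      (stdGaussian E).real {x | 0 ≤ s' x ∧ s' x ≤ 60 * γ}
        ≤ 60 * (Real.sqrt (Module.finrank ℝ E) * γ) := by
    intro s' hs'
    have := stdGaussian_strip_le hs' zero_le_one (fun x => (hn x).ge) hε.le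
    linarith
  rw [abs_le]
  constructor
  -- For the lower bound the shrunken set `{s ≤ -60γ}` is smoothed, so that the test function still
  -- vanishes off `{s ≤ 0}`.
  · have hs' := hs.add_const (60 * γ)
    have hst := hstrip _ hs'
    have hG : (stdGaussian E).real {z | s z ≤ 0}
        ≤ (stdGaussian E).real {z | s z + 60 * γ ≤ 0}
          + (stdGaussian E).real {x | 0 ≤ s x + 60 * γ ∧ s x + 60 * γ ≤ 60 * γ} := by
      refine (measureReal_mono (fun x hx => ?_)).trans (measureReal_union_le _ _)
      have hx' : s x ≤ 0 := hx
      rcases le_total (s x + 60 * γ) 0 with h0 | h0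
      · exact Or.inl h0
      · exact Or.inr ⟨h0, by linarith⟩
    rcases Set.eq_empty_or_nonempty {x | s x + 60 * γ ≤ 0} with he | hne
    · rw [he] at hG
      simp only [measureReal_empty, zero_add] at hG
      have := measureReal_nonneg (μ := μ) (s := {ω | s (∑ j ∈ S, ξ j ω) ≤ 0})
      linarith
    · obtain ⟨h, g, H⟩ := exists_isSmoothing (hs'.convex_le 0) (hs'.isClosed_le 0) hne hε
      have h1 := (abs_le.1 (hξ.abs_integral_isSmoothing_sub_le hγ H hne hs' hn hb0 hb hκ hV)).1
      have h2 := measureReal_le_integral (hs'.isClosed_le 0).measurableSet (hWi h g _ _ H).2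
        H.nonneg H.eq_one
      have h3 := integral_le_measureReal (A := {ω | s (∑ j ∈ S, ξ j ω) ≤ 0})
        (hW (hms 0)) (hWi h g _ _ H).1 (fun ω => H.le_one _) (fun ω hω => H.eq_zero _ (by
          by_contra hlt
          have := hs'.le_of_infDist_lt hne (not_le.1 hlt)
          exact hω (by change s _ ≤ 0; linarith)))
      linarith
  · rcases Set.eq_empty_or_nonempty {x | s x ≤ 0} with he | hne
    · have : {ω | s (∑ j ∈ S, ξ j ω) ≤ 0} = ∅ := by
        ext ω
        simpa using Set.eq_empty_iff_forall_notMem.1 he (∑ j ∈ S, ξ j ω)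
      rw [this, he]
      simp only [measureReal_empty, sub_zero]
      positivity
    · have hst := hstrip _ hs
      have hG : (stdGaussian E).real {z | s z ≤ 60 * γ}
          ≤ (stdGaussian E).real {z | s z ≤ 0}
            + (stdGaussian E).real {x | 0 ≤ s x ∧ s x ≤ 60 * γ} := by
        refine (measureReal_mono (fun x hx => ?_)).trans (measureReal_union_le _ _)
        rcases le_total (s x) 0 with h0 | h0
        · exact Or.inl h0
        · exact Or.inr ⟨h0, hx⟩
      obtain ⟨h, g, H⟩ := exists_isSmoothing (hs.convex_le 0) (hs.isClosed_le 0) hne hε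
      have h1 := (abs_le.1 (hξ.abs_integral_isSmoothing_sub_le hγ H hne hs hn hb0 hb hκ hV)).2
      have h2 := measureReal_le_integral (A := {ω | s (∑ j ∈ S, ξ j ω) ≤ 0})
        (hW (hms 0)) (hWi h g _ _ H).1 (fun ω => H.nonneg _) (fun ω hω => H.eq_one _ hω)
      have h3 := integral_le_measureReal (hms (60 * γ)) (hWi h g _ _ H).2
        H.le_one (fun x hx => H.eq_zero _ (by
          by_contra hlt
          have := hs.le_of_infDist_lt hne (not_le.1 hlt)
          exact hx (by change s _ ≤ _; linarith)))
      linarith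

end IsStandardized

end Comparison

/-! ### Maxima of affine functions with unit gradients. -/

section MaxAffine

open scoped RealInnerProductSpace

variable {E : Type*} [NormedAddCommGroup E] [InnerProductSpace ℝ E]

/-- The maximum of the affine functions `⟪u j, ·⟫ - b j` for `j ≤ N`. -/
noncomputable def maxAffine (u : ℕ → E) (b : ℕ → ℝ) : ℕ → E → ℝ
  | 0, x => ⟪u 0, x⟫ - b 0
  | N + 1, x => max (maxAffine u b N x) (⟪u (N + 1), x⟫ - b (N + 1))

open Classical in
/-- A selection of the gradient of an affine function attaining `maxAffine`. -/
noncomputable def maxAffineField (u : ℕ → E) (b : ℕ → ℝ) : ℕ → E → E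
  | 0, _ => u 0
  | N + 1, x => if ⟪u (N + 1), x⟫ - b (N + 1) ≤ maxAffine u b N x then maxAffineField u b N x
      else u (N + 1)

lemma maxAffine_le_iff (u : ℕ → E) (b : ℕ → ℝ) (N : ℕ) (x : E) (t : ℝ) :
    maxAffine u b N x ≤ t ↔ ∀ j ≤ N, ⟪u j, x⟫ - b j ≤ t := by
  induction N with
  | zero => simp [maxAffine]
  | succ N ih =>
    rw [maxAffine, max_le_iff, ih]
    constructor
    · rintro ⟨h1, h2⟩ j hj
      rcases Nat.le_succ_iff.1 hj with h | rfl
      · exact h1 j h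
      · exact h2
    · exact fun h => ⟨fun j hj => h j (hj.trans (Nat.le_succ N)), h _ le_rfl⟩

lemma norm_maxAffineField {u : ℕ → E} (hu : ∀ j, ‖u j‖ = 1) (b : ℕ → ℝ) (N : ℕ) (x : E) :
    ‖maxAffineField u b N x‖ = 1 := by
  induction N with
  | zero => exact hu 0
  | succ N ih =>
    rw [maxAffineField]
    split_ifs
    · exact ih
    · exact hu _

variable [MeasurableSpace E] [BorelSpace E]

lemma measurable_maxAffine [SecondCountableTopology E] (u : ℕ → E) (b : ℕ → ℝ) (N : ℕ) :
    Measurable (maxAffine u b N) := by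
  induction N with
  | zero =>
    change Measurable fun x => ⟪u 0, x⟫ - b 0
    fun_prop
  | succ N ih =>
    change Measurable fun x => max (maxAffine u b N x) (⟪u (N + 1), x⟫ - b (N + 1))
    fun_prop

lemma isSubgradientField_maxAffine [SecondCountableTopology E] {u : ℕ → E}
    (hu : ∀ j, ‖u j‖ = 1) (b : ℕ → ℝ) (N : ℕ) :
    IsSubgradientField (maxAffine u b N) (maxAffineField u b N) where
  measurable_fun := measurable_maxAffine u b N
  measurable_field := by
    induction N with
    | zero => exact measurable_const
    | succ N ih =>
      exact Measurable.ite (measurableSet_le (by fun_prop) (measurable_maxAffine u b N)) ih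
        measurable_const
  norm_le := fun x => (norm_maxAffineField hu b N x).le
  le := by
    induction N with
    | zero =>
      intro x y
      simp only [maxAffine, maxAffineField, inner_sub_right]
      linarith
    | succ N ih =>
      intro x y
      rw [maxAffine, maxAffine, maxAffineField]
      split_ifs with h
      · rw [max_eq_left h]
        exact (ih x y).trans (le_max_left _ _)
      · rw [max_eq_right (not_le.1 h).le]
        refine le_trans (le_of_eq ?_) (le_max_right _ _)
        rw [inner_sub_right]
        ring

end MaxAffine

/-! ### From sublevel sets to all convex sets. -/

section Polyhedra

open scoped RealInnerProductSpace

variable {E : Type*} [NormedAddCommGroup E] [InnerProductSpace ℝ E] [FiniteDimensional ℝ E]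

/-- A closed convex set is a countable intersection of half-spaces with unit normals. -/
lemma exists_unit_halfSpaces {A : Set E} (hA : Convex ℝ A) (hc : IsClosed A) (hne : A.Nonempty)
    (hA' : A ≠ Set.univ) :
    ∃ (u : ℕ → E) (b : ℕ → ℝ), (∀ j, ‖u j‖ = 1) ∧ ∀ x, x ∈ A ↔ ∀ j, ⟪u j, x⟫ - b j ≤ 0 := by
  obtain ⟨l, c, hlc⟩ := RCLike.iInter_countable_halfSpaces_eq (𝕜 := ℝ) hA hc
  have hmem : ∀ x, x ∈ A ↔ ∀ j, l j x ≤ c j := fun x => by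
    rw [← hlc]
    simp
  set w : ℕ → E := fun j => (InnerProductSpace.toDual ℝ E).symm (l j)
  have hw : ∀ j x, ⟪w j, x⟫ = l j x := fun j x => by simp [w]
  obtain ⟨y, hy⟩ := hne
  have hzero : ∀ j, w j = 0 → ∀ x, l j x ≤ c j := by
    intro j hj x
    have h1 := (hmem y).1 hy j
    rw [← hw, hj, inner_zero_left] at h1 ⊢
    exact h1
  obtain ⟨j₀, hj₀⟩ : ∃ j, w j ≠ 0 := by
    by_contra! hcon
    exact hA' (Set.eq_univ_of_forall fun x => (hmem x).2 fun j => hzero j (hcon j) x)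
  classical
  -- Since `A` is nonempty, a half-space with zero normal is the whole space; its index is
  -- redirected to a genuine half-space so that every normal can be normalized.
  set k : ℕ → ℕ := fun j => if w j = 0 then j₀ else j
  have hk : ∀ j, w (k j) ≠ 0 := by
    intro j
    by_cases h : w j = 0
    · simpa [k, h] using hj₀
    · simp [k, h]
  refine ⟨fun j => ‖w (k j)‖⁻¹ • w (k j), fun j => ‖w (k j)‖⁻¹ * c (k j), fun j => ?_, fun x => ?_⟩
  · rw [norm_smul, norm_inv, norm_norm, inv_mul_cancel₀ (norm_ne_zero_iff.2 (hk j))]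
  · have e : ∀ j, ⟪‖w (k j)‖⁻¹ • w (k j), x⟫ - ‖w (k j)‖⁻¹ * c (k j) ≤ 0 ↔ l (k j) x ≤ c (k j) := by
      intro j
      have : 0 < ‖w (k j)‖⁻¹ := inv_pos.2 (norm_pos_iff.2 (hk j))
      rw [real_inner_smul_left, hw, sub_nonpos, mul_le_mul_iff_right₀ this]
    simp_rw [e]
    rw [hmem]
    refine ⟨fun h j => h _, fun h j => ?_⟩
    by_cases hj : w j = 0
    · exact hzero j hj x
    · simpa [k, hj] using h j

variable [MeasurableSpace E] [BorelSpace E]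

/-- A closed convex set is the intersection of a decreasing sequence of sublevel sets of functions
with unit subgradients. -/
lemma exists_sublevel_sequence {A : Set E} (hA : Convex ℝ A) (hc : IsClosed A) (hne : A.Nonempty)
    (hA' : A ≠ Set.univ) :
    ∃ (s : ℕ → E → ℝ) (n : ℕ → E → E), (∀ N, IsSubgradientField (s N) (n N)) ∧
      (∀ N x, ‖n N x‖ = 1) ∧ Monotone s ∧ A = ⋂ N, {x | s N x ≤ 0} := by
  obtain ⟨u, b, hu, hmem⟩ := exists_unit_halfSpaces hA hc hne hA'
  refine ⟨maxAffine u b, maxAffineField u b, isSubgradientField_maxAffine hu b,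
    norm_maxAffineField hu b, monotone_nat_of_le_succ fun N x => le_max_left _ _, ?_⟩
  ext x
  simp only [Set.mem_iInter, Set.mem_ofPred_eq, maxAffine_le_iff]
  rw [hmem]
  exact ⟨fun h N j _ => h j, fun h j => h j j le_rfl⟩

lemma tendsto_measureReal_sublevel (P : Measure E) [IsFiniteMeasure P] {s : ℕ → E → ℝ}
    {n : ℕ → E → E} (hs : ∀ N, IsSubgradientField (s N) (n N)) (hmono : Monotone s) (t : ℝ) :
    Filter.Tendsto (fun N => P.real {x | s N x ≤ t}) Filter.atTop
      (nhds (P.real (⋂ N, {x | s N x ≤ t}))) := by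
  have h := tendsto_measure_iInter_atTop (μ := P) (s := fun N => {x | s N x ≤ t})
    (fun N => ((hs N).isClosed_le t).measurableSet.nullMeasurableSet)
    (fun M N hMN x hx => (hmono hMN x).trans hx) ⟨0, measure_ne_top _ _⟩
  exact (ENNReal.tendsto_toReal (measure_ne_top _ _)).comp h

/-- Closeness on closed convex sets follows from closeness on sublevel sets of functions with unit
subgradients. -/
lemma ConvexClose.of_sublevel {P Q : Measure E} [IsProbabilityMeasure P] [IsProbabilityMeasure Q]
    {κ : ℝ} (hκ : 0 ≤ κ)
    (h : ∀ (s : E → ℝ) (n : E → E), IsSubgradientField s n → (∀ x, ‖n x‖ = 1) →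
      |P.real {x | s x ≤ 0} - Q.real {x | s x ≤ 0}| ≤ κ) : ConvexClose P Q κ := by
  intro A hA hc
  rcases Set.eq_empty_or_nonempty A with rfl | hne
  · simpa using hκ
  by_cases hA' : A = Set.univ
  · subst hA'
    simpa using hκ
  obtain ⟨s, n, hs, hn, hmono, rfl⟩ := exists_sublevel_sequence hA hc hne hA'
  exact le_of_tendsto ((tendsto_measureReal_sublevel P hs hmono 0).sub
    (tendsto_measureReal_sublevel Q hs hmono 0)).abs
    (Filter.Eventually.of_forall fun N => h _ _ (hs N) (hn N))

/-- The points whose closed `ε`-ball is contained in `A`. -/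
def erosion (A : Set E) (ε : ℝ) : Set E := ⋂ z ∈ Metric.closedBall (0 : E) ε, {x | x + z ∈ A}

lemma convex_erosion {A : Set E} (hA : Convex ℝ A) (ε : ℝ) : Convex ℝ (erosion A ε) :=
  convex_iInter₂ fun z _ => hA.translate_preimage_left z

lemma isClosed_erosion {A : Set E} (hA : IsClosed A) (ε : ℝ) : IsClosed (erosion A ε) :=
  isClosed_biInter fun z _ => hA.preimage (continuous_add_const z)

lemma erosion_subset_interior (A : Set E) {ε : ℝ} (hε : 0 < ε) : erosion A ε ⊆ interior A := by
  intro x hx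
  rw [mem_interior_iff_mem_nhds, Metric.mem_nhds_iff]
  refine ⟨ε, hε, fun y hy => ?_⟩
  have h1 := Set.mem_iInter₂.1 hx (y - x) (by
    rw [mem_closedBall_zero_iff, ← dist_eq_norm]
    exact (Metric.mem_ball.1 hy).le)
  simpa using h1

/-- The Gaussian measure of a closed convex set exceeds the one of its erosion by at most a multiple
of the depth. -/
lemma stdGaussian_le_erosion {A : Set E} (hA : Convex ℝ A) (hc : IsClosed A) {ε : ℝ}
    (hε : 0 ≤ ε) :
    (stdGaussian E).real A
      ≤ (stdGaussian E).real (erosion A ε) + Real.sqrt (Module.finrank ℝ E) * ε := by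
  rcases Set.eq_empty_or_nonempty A with rfl | hne
  · simp only [measureReal_empty]
    positivity
  by_cases hA' : A = Set.univ
  · subst hA'
    have : erosion (Set.univ : Set E) ε = Set.univ := by simp [erosion]
    rw [this]
    linarith [mul_nonneg (Real.sqrt_nonneg (Module.finrank ℝ E)) hε]
  obtain ⟨s, n, hs, hn, hmono, rfl⟩ := exists_sublevel_sequence hA hc hne hA'
  have h1 : (stdGaussian E).real (⋂ N, {x | s N x ≤ 0})
      ≤ (stdGaussian E).real (⋂ N, {x | s N x ≤ -ε}) + Real.sqrt (Module.finrank ℝ E) * ε := by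
    refine le_of_tendsto_of_tendsto' (tendsto_measureReal_sublevel _ hs hmono 0)
      ((tendsto_measureReal_sublevel _ hs hmono (-ε)).add_const _) fun N => ?_
    have h2 := stdGaussian_strip_le ((hs N).add_const ε) zero_le_one (fun x => (hn N x).ge) hε
    rw [one_pow, one_mul] at h2
    refine le_trans ?_ (add_le_add_right h2 _)
    refine (measureReal_mono (fun x hx => ?_)).trans (measureReal_union_le _ _)
    have hx' : s N x ≤ 0 := hx
    rcases le_total (s N x) (-ε) with h0 | h0
    · exact Or.inl h0
    · exact Or.inr ⟨by linarith, by linarith⟩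
  refine h1.trans (add_le_add_left (measureReal_mono fun x hx => ?_) _)
  refine Set.mem_iInter₂.2 fun z hz => Set.mem_iInter.2 fun N => ?_
  have h3 := (hs N).sub_le_norm (x + z) x
  have h4 : s N x ≤ -ε := Set.mem_iInter.1 hx N
  rw [add_sub_cancel_left] at h3
  have h5 := mem_closedBall_zero_iff.1 hz
  change s N (x + z) ≤ 0
  linarith

/-- A convex set has the same interior as its closure. -/
lemma interior_closure_eq_of_convex {A : Set E} (hA : Convex ℝ A) :
    interior (closure A) = interior A := by
  by_cases hne : (interior A).Nonempty
  · exact hA.interior_closure_eq_interior_of_nonempty_interior hne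
  -- A convex set with empty interior lies in a proper affine subspace; this is closed in finite
  -- dimension, so it also contains the closure.
  · have h1 : ¬ (interior (closure A)).Nonempty := by
      rw [hA.closure.interior_nonempty_iff_affineSpan_eq_top]
      rw [hA.interior_nonempty_iff_affineSpan_eq_top] at hne
      intro h
      refine hne (top_le_iff.1 (h ▸ affineSpan_le.2 ?_))
      exact closure_minimal (subset_affineSpan _ _) (affineSpan ℝ A).closed_of_finiteDimensional
    rw [Set.not_nonempty_iff_eq_empty.1 h1, Set.not_nonempty_iff_eq_empty.1 hne]

/-- Closeness on closed convex sets implies closeness on all convex sets, with outer probabilities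
for the sets that are not measurable. -/
lemma ConvexClose.abs_sub_le {Ω : Type*} [MeasurableSpace Ω] {μ : Measure Ω}
    [IsProbabilityMeasure μ] {Y : Ω → E} (hY : Measurable Y) {κ : ℝ}
    (h : ConvexClose (μ.map Y) (stdGaussian E) κ) {A : Set E} (hA : Convex ℝ A) :
    |μ.real {ω | Y ω ∈ A} - (stdGaussian E).real A| ≤ κ := by
  refine le_of_forall_pos_le_add fun η hη => ?_
  set d := Real.sqrt (Module.finrank ℝ E)
  have hd : 0 ≤ d := Real.sqrt_nonneg _
  have hε : 0 < η / (d + 1) := by positivity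
  have hdε : d * (η / (d + 1)) ≤ η := by
    rw [mul_div_assoc', div_le_iff₀ (by positivity)]
    nlinarith
  set ε := η / (d + 1)
  -- Then `K ⊆ A ⊆ closure A` with closed convex outer sets whose Gaussian measures differ by at
  -- most `η`. Only monotonicity is used for `A`, so outer probabilities are enough.
  set K := erosion (closure A) ε
  have hKc : IsClosed K := isClosed_erosion isClosed_closure ε
  have hKA : K ⊆ A := (erosion_subset_interior _ hε).trans
    ((interior_closure_eq_of_convex hA).subset.trans interior_subset)
  have h1 := stdGaussian_le_erosion hA.closure isClosed_closure hε.le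
  have h2 := (abs_le.1 (h _ hA.closure isClosed_closure)).2
  have h3 := (abs_le.1 (h _ (convex_erosion hA.closure ε) hKc)).1
  rw [map_measureReal_apply hY hKc.measurableSet] at h3
  rw [map_measureReal_apply hY isClosed_closure.measurableSet] at h2
  have h4 : μ.real {ω | Y ω ∈ A} ≤ μ.real (Y ⁻¹' closure A) :=
    measureReal_mono fun ω hω => subset_closure hω
  have h5 : μ.real (Y ⁻¹' K) ≤ μ.real {ω | Y ω ∈ A} := measureReal_mono fun ω hω => hKA hω
  have h6 : (stdGaussian E).real A ≤ (stdGaussian E).real (closure A) :=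
    measureReal_mono subset_closure
  have h7 : (stdGaussian E).real K ≤ (stdGaussian E).real A := measureReal_mono hKA
  rw [abs_le]
  constructor <;> linarith

end Polyhedra

/-! ### Operators diagonal in an orthonormal basis. -/

section Diagonal

open scoped RealInnerProductSpace

variable {E κ : Type*} [NormedAddCommGroup E] [InnerProductSpace ℝ E] [Fintype κ]

/-- The operator that is diagonal in an orthonormal basis. -/
noncomputable def diagonalOp (e : OrthonormalBasis κ ℝ E) (a : κ → ℝ) : E →L[ℝ] E :=
  ∑ k, a k • (innerSL ℝ (e k)).smulRight (e k)

variable (e : OrthonormalBasis κ ℝ E)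

lemma diagonalOp_apply (a : κ → ℝ) (v : E) : diagonalOp e a v = ∑ k, (a k * ⟪e k, v⟫) • e k := by
  simp [diagonalOp, mul_smul]

lemma inner_diagonalOp (a : κ → ℝ) (v w : E) :
    ⟪diagonalOp e a v, w⟫ = ∑ k, a k * (⟪e k, v⟫ * ⟪e k, w⟫) := by
  rw [diagonalOp_apply, sum_inner]
  refine Finset.sum_congr rfl fun k _ => ?_
  rw [real_inner_smul_left, mul_assoc]

lemma inner_basis_diagonalOp (a : κ → ℝ) (v : E) (k : κ) :
    ⟪e k, diagonalOp e a v⟫ = a k * ⟪e k, v⟫ := by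
  classical
  rw [real_inner_comm, inner_diagonalOp]
  simp [OrthonormalBasis.inner_eq_ite]

lemma diagonalOp_diagonalOp (a b : κ → ℝ) (v : E) :
    diagonalOp e a (diagonalOp e b v) = diagonalOp e (a * b) v := by
  rw [diagonalOp_apply e a, diagonalOp_apply e (a * b)]
  simp_rw [inner_basis_diagonalOp, Pi.mul_apply, mul_assoc]

lemma diagonalOp_one (v : E) : diagonalOp e 1 v = v := by
  rw [diagonalOp_apply]
  simpa using e.sum_repr' v

lemma norm_diagonalOp_le {a : κ → ℝ} {M : ℝ} (hM : 0 ≤ M) (ha : ∀ k, a k ^ 2 ≤ M ^ 2) (v : E) :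
    ‖diagonalOp e a v‖ ≤ M * ‖v‖ := by
  refine le_of_sq_le_sq ?_ (by positivity)
  rw [mul_pow, ← e.sum_sq_norm_inner_right, ← e.sum_sq_norm_inner_right v, Finset.mul_sum]
  refine Finset.sum_le_sum fun k _ => ?_
  rw [inner_basis_diagonalOp, norm_mul, mul_pow, Real.norm_eq_abs, sq_abs]
  exact mul_le_mul_of_nonneg_right (ha k) (sq_nonneg _)

lemma adjoint_diagonalOp [CompleteSpace E] (a : κ → ℝ) :
    (diagonalOp e a).adjoint = diagonalOp e a := by
  refine ((ContinuousLinearMap.eq_adjoint_iff _ _).2 fun v w => ?_).symm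
  rw [inner_diagonalOp, real_inner_comm, inner_diagonalOp]
  refine Finset.sum_congr rfl fun k _ => ?_
  rw [mul_comm ⟪e k, v⟫]

end Diagonal

/-! ### Renormalized leave-one-out sums and the Berry–Esseen theorem. -/

section Renormalization

open scoped RealInnerProductSpace

variable {E : Type*} [NormedAddCommGroup E] [InnerProductSpace ℝ E] [FiniteDimensional ℝ E]

/-- A symmetric operator `T` with `b⁻² ≤ T ≤ 1` is normalized by a self-adjoint operator. -/
lemma exists_renormalization {T : E →ₗ[ℝ] E} (hT : T.IsSymmetric) {b : ℝ} (hb : 0 < b)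
    (hlow : ∀ v, ‖v‖ ^ 2 ≤ b ^ 2 * ⟪T v, v⟫) (hup : ∀ v, ⟪T v, v⟫ ≤ ‖v‖ ^ 2) :
    ∃ B D : E →L[ℝ] E, (∀ v, D (B v) = v) ∧ (∀ v, B (D v) = v) ∧ D.adjoint = D ∧ B.adjoint = B ∧
      (∀ x, ‖D x‖ ≤ ‖x‖) ∧ (∀ x, ‖B x‖ ≤ b * ‖x‖) ∧ ∀ u v, ⟪T (B u), B v⟫ = ⟪u, v⟫ := by
  set e := hT.eigenvectorBasis rfl
  set l := hT.eigenvalues rfl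
  have hTe : ∀ k, T (e k) = l k • e k := fun k => hT.apply_eigenvectorBasis rfl k
  have hl : ∀ k, ⟪T (e k), e k⟫ = l k := fun k => by
    rw [hTe, real_inner_smul_left, real_inner_self_eq_norm_sq, e.orthonormal.1]
    simp
  have hl1 : ∀ k, l k ≤ 1 := fun k => by
    have := hup (e k)
    rw [hl, e.orthonormal.1] at this
    simpa using this
  have hl2 : ∀ k, 1 ≤ b ^ 2 * l k := fun k => by
    have := hlow (e k)
    rw [hl, e.orthonormal.1] at this
    simpa using this
  have hl0 : ∀ k, 0 < l k := fun k => by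
    by_contra hneg
    have := mul_nonneg (sq_nonneg b) (neg_nonneg.2 (not_lt.1 hneg))
    linarith [hl2 k]
  have hTd : ∀ v, T v = diagonalOp e l v := by
    intro v
    conv_lhs => rw [← e.sum_repr' v]
    rw [map_sum, diagonalOp_apply]
    refine Finset.sum_congr rfl fun k _ => ?_
    rw [map_smul, hTe, smul_smul, mul_comm]
  -- `D = T^{1/2}` and `B = T^{-1/2}`, formed on an eigenbasis of `T`.
  set p : Fin (Module.finrank ℝ E) → ℝ := fun k => Real.sqrt (l k)
  set q : Fin (Module.finrank ℝ E) → ℝ := fun k => (Real.sqrt (l k))⁻¹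
  have hp : ∀ k, p k ^ 2 = l k := fun k => Real.sq_sqrt (hl0 k).le
  have hp0 : ∀ k, 0 < p k := fun k => Real.sqrt_pos.2 (hl0 k)
  have hpq : p * q = 1 := funext fun k => mul_inv_cancel₀ (hp0 k).ne'
  have hqp : q * p = 1 := by rw [mul_comm, hpq]
  refine ⟨diagonalOp e q, diagonalOp e p, fun v => ?_, fun v => ?_, adjoint_diagonalOp e p,
    adjoint_diagonalOp e q, fun x => ?_, fun x => ?_, fun u v => ?_⟩
  · rw [diagonalOp_diagonalOp, hpq, diagonalOp_one]
  · rw [diagonalOp_diagonalOp, hqp, diagonalOp_one]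
  · have := norm_diagonalOp_le e (a := p) zero_le_one (fun k => by rw [hp]; simpa using hl1 k) x
    simpa using this
  · refine norm_diagonalOp_le e hb.le (fun k => ?_) x
    change (p k)⁻¹ ^ 2 ≤ _
    rw [inv_pow, hp, inv_le_iff_one_le_mul₀ (hl0 k)]
    exact hl2 k
  · rw [hTd, diagonalOp_diagonalOp]
    have h1 := ContinuousLinearMap.adjoint_inner_left (diagonalOp e q) v (diagonalOp e (l * q) u)
    rw [adjoint_diagonalOp] at h1
    rw [← h1, diagonalOp_diagonalOp]
    have : q * (l * q) = 1 := by
      funext k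
      change q k * (l k * q k) = 1
      have h2 : p k * q k = 1 := mul_inv_cancel₀ (hp0 k).ne'
      rw [← hp]
      calc _ = (p k * q k) ^ 2 := by ring
        _ = 1 := by rw [h2, one_pow]
    rw [this, diagonalOp_one]

variable [MeasurableSpace E] [BorelSpace E]

variable {Ω ι : Type*} [MeasurableSpace Ω] {μ : Measure Ω} [IsProbabilityMeasure μ] {S : Finset ι}
  {ξ : ι → Ω → E}

/-- The covariance operator of a random vector. -/
noncomputable def covarianceOp {X : Ω → E} (hX : MemLp X 2 μ) : E →ₗ[ℝ] E where
  toFun v := ∫ ω, ⟪X ω, v⟫ • X ω ∂μ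
  map_add' v w := by
    have hi : ∀ v, Integrable (fun ω => ⟪X ω, v⟫ • X ω) μ := fun v =>
      memLp_one_iff_integrable.1 (hX.smul (hX.inner_const v))
    rw [← integral_add (hi v) (hi w)]
    simp_rw [inner_add_right, add_smul]
  map_smul' r v := by
    simp_rw [real_inner_smul_right, mul_smul]
    rw [integral_smul]
    simp

lemma inner_covarianceOp {X : Ω → E} (hX : MemLp X 2 μ) (v w : E) :
    ⟪covarianceOp hX v, w⟫ = ∫ ω, ⟪X ω, v⟫ * ⟪X ω, w⟫ ∂μ := by
  have hi : Integrable (fun ω => ⟪X ω, v⟫ • X ω) μ :=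
    memLp_one_iff_integrable.1 (hX.smul (hX.inner_const v))
  change ⟪∫ ω, ⟪X ω, v⟫ • X ω ∂μ, w⟫ = _
  rw [real_inner_comm, ← integral_inner (𝕜 := ℝ) hi]
  refine integral_congr_ae (Filter.Eventually.of_forall fun ω => ?_)
  simp only
  rw [real_inner_smul_right, real_inner_comm (X ω) w]

namespace IsStandardized

/-- Since `(2x + 0.2)(x - 0.2)² ≥ 0`, one has `0.6x² ≤ 2x³ + 0.008`. Thus removing one summand keeps
the covariance above `24/25`, the reciprocal of `b² = 25/24`. -/
lemma integral_norm_sq_le (hξ : IsStandardized μ S ξ) (hγ : thirdMoment μ S ξ ≤ 1 / 200) {i : ι}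
    (hi : i ∈ S) : ∫ ω, ‖ξ i ω‖ ^ 2 ∂μ ≤ 1 / 25 := by
  have h3 : ∫ ω, ‖ξ i ω‖ ^ 3 ∂μ ≤ thirdMoment μ S ξ :=
    Finset.single_le_sum (f := fun i => ∫ ω, ‖ξ i ω‖ ^ 3 ∂μ)
      (fun j _ => integral_nonneg fun _ => by positivity) hi
  have h1 : ∫ ω, 0.6 * ‖ξ i ω‖ ^ 2 ∂μ ≤ ∫ ω, (2 * ‖ξ i ω‖ ^ 3 + 0.008) ∂μ := by
    refine integral_mono ((hξ.integrable_sq i).const_mul _)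
      (((hξ.integrable_pow_three i).const_mul _).add (integrable_const _)) fun ω => ?_
    have hx : 0 ≤ ‖ξ i ω‖ := norm_nonneg _
    simp only
    nlinarith [mul_nonneg (by positivity : 0 ≤ 2 * ‖ξ i ω‖ + 0.2) (sq_nonneg (‖ξ i ω‖ - 0.2))]
  rw [integral_const_mul, integral_add ((hξ.integrable_pow_three i).const_mul _)
    (integrable_const _), integral_const_mul] at h1
  simp only [integral_const, probReal_univ, smul_eq_mul, one_mul] at h1
  linarith

/-- Leaving out one summand and renormalizing gives a standardized family again. -/
lemma exists_renormalization_erase [DecidableEq ι] (hξ : IsStandardized μ S ξ) (hγ : thirdMoment μ S ξ ≤ 1 / 200)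
    {i : ι} (hi : i ∈ S) {b : ℝ} (hb : 0 < b) (hb2 : b ^ 2 = 25 / 24) :
    ∃ B D : E →L[ℝ] E, (∀ v, D (B v) = v) ∧ (∀ v, B (D v) = v) ∧ D.adjoint = D ∧
      (∀ x, ‖D x‖ ≤ ‖x‖) ∧ (∀ x, ‖B x‖ ≤ b * ‖x‖) ∧
      IsStandardized μ (S.erase i) (fun j ω => B (ξ j ω)) := by
  have h2 := hξ.memLp_two i
  -- The covariance of the sum of the remaining vectors.
  set T : E →ₗ[ℝ] E := LinearMap.id - covarianceOp h2
  have hTin : ∀ v w, ⟪T v, w⟫ = ⟪v, w⟫ - ∫ ω, ⟪ξ i ω, v⟫ * ⟪ξ i ω, w⟫ ∂μ := fun v w => by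
    change ⟪v - covarianceOp h2 v, w⟫ = _
    rw [inner_sub_left, inner_covarianceOp]
  have hT : T.IsSymmetric := fun v w => by
    rw [hTin, real_inner_comm (T w) v, hTin, real_inner_comm w v]
    simp_rw [mul_comm ⟪ξ i _, v⟫]
  have hQ : ∀ v, ∫ ω, ⟪ξ i ω, v⟫ * ⟪ξ i ω, v⟫ ∂μ ≤ 1 / 25 * ‖v‖ ^ 2 := by
    intro v
    calc _ ≤ ∫ ω, ‖ξ i ω‖ ^ 2 * ‖v‖ ^ 2 ∂μ := by
          refine integral_mono_of_nonneg (Filter.Eventually.of_forall fun ω => mul_self_nonneg _)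
            ((hξ.integrable_sq i).mul_const _) (Filter.Eventually.of_forall fun ω => ?_)
          simp only
          rw [← mul_pow, ← sq, ← sq_abs]
          gcongr
          exact abs_real_inner_le_norm _ _
      _ ≤ _ := by
          rw [integral_mul_const]
          gcongr
          exact hξ.integral_norm_sq_le hγ hi
  obtain ⟨B, D, hDB, hBD, hD, hB, hD1, hBb, hTB⟩ := exists_renormalization hT hb
    (fun v => by
      rw [hTin, real_inner_self_eq_norm_sq, hb2]
      linarith [hQ v])
    (fun v => by
      rw [hTin, real_inner_self_eq_norm_sq]
      have : 0 ≤ ∫ ω, ⟪ξ i ω, v⟫ * ⟪ξ i ω, v⟫ ∂μ := integral_nonneg fun ω => mul_self_nonneg _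
      linarith)
  have hBin : ∀ x y, ⟪B x, y⟫ = ⟪x, B y⟫ := fun x y => by
    conv_lhs => rw [← hB]
    exact ContinuousLinearMap.adjoint_inner_left _ _ _
  refine ⟨B, D, hDB, hBD, hD, hD1, hBb, fun j => ?_, ?_, fun j => ?_, fun j => ?_, fun u v => ?_⟩
  · exact B.measurable.comp (hξ.measurable j)
  · exact hξ.indep.comp (fun _ => B) fun _ => B.measurable
  · exact B.comp_memLp' (hξ.memLp j)
  · rw [B.integral_comp_comm (hξ.integrable j), hξ.mean j, map_zero]
  · simp_rw [hBin]
    have h3 := Finset.add_sum_erase S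
      (fun j => ∫ ω, ⟪ξ j ω, B u⟫ * ⟪ξ j ω, B v⟫ ∂μ) hi
    rw [hξ.cov (B u) (B v)] at h3
    rw [← hTB, hTin]
    linarith

lemma thirdMoment_comp_le (hξ : IsStandardized μ S ξ) (B : E →L[ℝ] E) {b : ℝ} (hb : 0 ≤ b)
    (hB : ∀ x, ‖B x‖ ≤ b * ‖x‖) (S' : Finset ι) (hS : S' ⊆ S) :
    thirdMoment μ S' (fun j ω => B (ξ j ω)) ≤ b ^ 3 * thirdMoment μ S ξ := by
  unfold thirdMoment
  rw [Finset.mul_sum]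
  refine (Finset.sum_le_sum fun j _ => ?_).trans
    (Finset.sum_le_sum_of_subset_of_nonneg hS fun j _ _ => ?_)
  · rw [← integral_const_mul]
    refine integral_mono_of_nonneg (Filter.Eventually.of_forall fun ω => by positivity)
      ((hξ.integrable_pow_three j).const_mul _) (Filter.Eventually.of_forall fun ω => ?_)
    simp only
    rw [← mul_pow]
    gcongr
    exact hB _
  · exact mul_nonneg (by positivity) (integral_nonneg fun _ => by positivity)

/-- Multivariate Berry-Esseen bound over convex sets. -/
theorem berryEsseen [Nontrivial E] (hξ : IsStandardized μ S ξ) :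
    ConvexClose (μ.map fun ω => ∑ j ∈ S, ξ j ω) (stdGaussian E)
      (200 * Real.sqrt (Module.finrank ℝ E) * thirdMoment μ S ξ) := by
  classical
  -- The vectors must vary, since the hypothesis is applied to `B ∘ ξ`. No base case is needed: for
  -- empty `S` the covariance condition is contradictory.
  induction S using Finset.strongInduction generalizing ξ with
  | H S ih =>
    have hγ0 := hξ.thirdMoment_pos
    have hW : Measurable fun ω => ∑ j ∈ S, ξ j ω := hξ.measurable_sum S
    have : IsProbabilityMeasure (μ.map fun ω => ∑ j ∈ S, ξ j ω) :=
      Measure.isProbabilityMeasure_map hW.aemeasurable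
    set γ := thirdMoment μ S ξ
    set d := Real.sqrt (Module.finrank ℝ E)
    have hd : 1 ≤ d := by
      rw [Real.one_le_sqrt]
      exact_mod_cast Module.finrank_pos (R := ℝ) (M := E)
    have hdγ : γ ≤ d * γ := le_mul_of_one_le_left hγ0.le hd
    rcases le_or_gt 1 (200 * d * γ) with hlarge | hsmall
    -- The bound is trivial once it reaches one; otherwise `γ ≤ 1/200`, because `d ≥ 1`.
    · intro A _ _
      refine le_trans ?_ hlarge
      rw [abs_le]
      have h1 := measureReal_nonneg (μ := μ.map fun ω => ∑ j ∈ S, ξ j ω) (s := A)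
      have h2 := measureReal_nonneg (μ := stdGaussian E) (s := A)
      have h3 := measureReal_le_one (μ := μ.map fun ω => ∑ j ∈ S, ξ j ω) (s := A)
      have h4 := measureReal_le_one (μ := stdGaussian E) (s := A)
      constructor <;> linarith
    · have hγ : γ ≤ 1 / 200 := by nlinarith
      set b := Real.sqrt (25 / 24)
      have hb0 : 0 < b := Real.sqrt_pos.2 (by norm_num)
      have hb2 : b ^ 2 = 25 / 24 := Real.sq_sqrt (by norm_num)
      have hb3 : b ^ 3 ≤ 1.064 := by
        have h1 : b ≤ 1.021 := by nlinarith
        calc b ^ 3 = b * b ^ 2 := by ring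
          _ ≤ 1.021 * (25 / 24) := by rw [hb2]; gcongr
          _ ≤ _ := by norm_num
      have hV : ∀ i ∈ S, IsNearlyGaussian μ (fun ω => ∑ j ∈ S.erase i, ξ j ω) b
          (200 * d * (1.064 * γ)) := by
        intro i hi
        obtain ⟨B, D, hDB, hBD, hD, hD1, hBb, hst⟩ :=
          hξ.exists_renormalization_erase hγ hi hb0 hb2
        refine ⟨B, D, hDB, hBD, hD, hD1, hBb, ?_⟩
        have h1 := ih (S.erase i) (Finset.erase_ssubset hi) hst
        simp_rw [← map_sum] at h1
        refine h1.mono ?_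
        have h2 := hξ.thirdMoment_comp_le B hb0.le hBb (S.erase i) (Finset.erase_subset _ _)
        gcongr
        exact h2.trans (by gcongr)
      refine ConvexClose.of_sublevel (by positivity) fun s n hs hn => ?_
      have hms : MeasurableSet {x | s x ≤ 0} := (hs.isClosed_le 0).measurableSet
      rw [map_measureReal_apply hW hms]
      refine (hξ.abs_sub_le_of_leaveOneOut hγ hs hn hb0 hb2.le (by positivity) hV).trans ?_
      -- Since `0.38 * 200 * 1.064 < 81` and `66.6 + 8.6 = 75.2`, the constant `200` reproduces
      -- itself.
      change 0.38 * (200 * d * (1.064 * γ)) + (66.6 * d + 8.6) * γ ≤ 200 * d * γ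
      nlinarith

end IsStandardized

end Renormalization

/-! ### From the linear to the nonlinear statistic. -/

section NonlinearBound

open scoped RealInnerProductSpace

variable {E : Type*} [NormedAddCommGroup E] [InnerProductSpace ℝ E] [FiniteDimensional ℝ E]
  [MeasurableSpace E] [BorelSpace E]

variable {Ω ι : Type*} [MeasurableSpace Ω] {μ : Measure Ω} [IsProbabilityMeasure μ] {S : Finset ι}
  {ξ : ι → Ω → E}

lemma ofReal_integral_le_lintegral {f : Ω → ℝ} (hf : Measurable f) (h0 : ∀ ω, 0 ≤ f ω)
    {g : Ω → ℝ≥0∞} (hfg : ∀ ω, ENNReal.ofReal (f ω) ≤ g ω) :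
    ENNReal.ofReal (∫ ω, f ω ∂μ) ≤ ∫⁻ ω, g ω ∂μ := by
  rw [integral_eq_lintegral_of_nonneg_ae (Filter.Eventually.of_forall h0) hf.aestronglyMeasurable]
  exact ENNReal.ofReal_toReal_le.trans (lintegral_mono hfg)

lemma abs_clamp_sub_clamp_le (K x y : ℝ) :
    |max 0 (min x K) - max 0 (min y K)| ≤ |x - y| := by
  refine (abs_max_sub_max_le_max _ _ _ _).trans (max_le (by simp) ?_)
  exact (abs_min_sub_min_le_max _ _ _ _).trans (max_le le_rfl (by simp))

/-- The error terms of the nonlinear statistic. -/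
noncomputable def nonlinearError (μ : Measure Ω) (S : Finset ι) (ξ : ι → Ω → E) (Δ : Ω → ℝ)
    (Δ' : ι → Ω → ℝ) : ℝ≥0∞ :=
  2 * ∫⁻ ω, ‖∑ i ∈ S, ξ i ω‖ₑ * ENNReal.ofReal (Δ ω) ∂μ
    + 2 * ∑ i ∈ S, ∫⁻ ω, ‖ξ i ω‖ₑ * ENNReal.ofReal |Δ ω - Δ' i ω| ∂μ

namespace IsStandardized

/-- The randomized concentration inequality, for arbitrary random widths. -/
lemma measure_strip_le [Nontrivial E] (hξ : IsStandardized μ S ξ) {s : E → ℝ} {n : E → E}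
    (hs : IsSubgradientField s n) (hn : ∀ x, ‖n x‖ = 1) {σ : ℝ} (hσ0 : 0 ≤ σ) (hσ1 : σ ≤ 1)
    {Δ : Ω → ℝ} (hΔ : Measurable Δ) {Δ' : ι → Ω → ℝ} (hΔ' : ∀ i, Measurable (Δ' i))
    (hindep : ∀ i ∈ S, IndepFun (ξ i) (fun ω => (Δ' i ω, ∑ j ∈ S, ξ j ω - ξ i ω)) μ) :
    μ {ω | 0 ≤ Δ ω ∧ -(σ * Δ ω) ≤ s (∑ i ∈ S, ξ i ω) ∧ s (∑ i ∈ S, ξ i ω) ≤ Δ ω - σ * Δ ω}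
      ≤ ENNReal.ofReal (15 * Real.sqrt (Module.finrank ℝ E) * thirdMoment μ S ξ)
        + nonlinearError μ S ξ Δ Δ' := by
  have hγ := hξ.thirdMoment_pos
  set γ := thirdMoment μ S ξ
  set d := Real.sqrt (Module.finrank ℝ E)
  have hd : 1 ≤ d := by
    rw [Real.one_le_sqrt]
    exact_mod_cast Module.finrank_pos (R := ℝ) (M := E)
  have hm := hξ.measurable
  have hW : Measurable fun ω => ∑ i ∈ S, ξ i ω := hξ.measurable_sum S
  set G : Set Ω := {ω | 0 ≤ Δ ω ∧ -(σ * Δ ω) ≤ s (∑ i ∈ S, ξ i ω)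
    ∧ s (∑ i ∈ S, ξ i ω) ≤ Δ ω - σ * Δ ω}
  -- The widths are truncated to `[0, K]`, which leaves `Δ` unchanged on the `K`-th event and does
  -- not increase `|Δ - Δ'|`; continuity from below removes `K`.
  have hGU : G = ⋃ K : ℕ, G ∩ {ω | Δ ω ≤ K} := by
    ext ω
    simp only [Set.mem_iUnion, Set.mem_inter_iff, Set.mem_ofPred_eq]
    refine ⟨fun hω => ?_, fun ⟨_, hω, _⟩ => hω⟩
    obtain ⟨K, hK⟩ := exists_nat_ge (Δ ω)
    exact ⟨K, hω, hK⟩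
  have hmono : Monotone fun K : ℕ => G ∩ {ω | Δ ω ≤ K} := fun K L hKL ω hω =>
    ⟨hω.1, (show Δ ω ≤ K from hω.2).trans (Nat.cast_le.2 hKL)⟩
  rw [hGU, hmono.measure_iUnion]
  refine iSup_le fun K => ?_
  set Γ : Ω → ℝ := fun ω => max 0 (min (Δ ω) K)
  set Γ' : ι → Ω → ℝ := fun i ω => max 0 (min (Δ' i ω) K)
  have hK : (0:ℝ) ≤ K := Nat.cast_nonneg K
  have hΓm : Measurable Γ := by fun_prop
  have hΓm' : ∀ i, Measurable (Γ' i) := fun i => by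
    have := hΔ' i
    fun_prop
  -- With `δ = 2γ` the factor on the left is `1/2`. Doubling gives the coefficient `2` of both error
  -- terms and `2(6√d + 1.5)γ ≤ 15√d γ`.
  have h1 := hξ.concentration hs hn hσ0 hσ1 hΓm hΓm' (K := K) (fun ω => le_max_left _ _)
    (fun ω => max_le hK (min_le_right _ _)) (fun i ω => le_max_left _ _)
    (fun i ω => max_le hK (min_le_right _ _))
    (fun i hi => by
      have hφ : Measurable fun p : ℝ × E => (max 0 (min p.1 (K:ℝ)), p.2) := by fun_prop
      exact (hindep i hi).comp measurable_id hφ) (δ := 2 * γ) (by positivity)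
  set G' : Set Ω := {ω | -(σ * Γ ω) ≤ s (∑ i ∈ S, ξ i ω) ∧ s (∑ i ∈ S, ξ i ω) ≤ Γ ω - σ * Γ ω}
  have hsub : G ∩ {ω | Δ ω ≤ K} ⊆ G' := by
    rintro ω ⟨⟨h0, h2, h3⟩, h4⟩
    have h4' : Δ ω ≤ K := h4
    have : Γ ω = Δ ω := by simp only [Γ]; rw [min_eq_left h4', max_eq_right h0]
    change -(σ * Γ ω) ≤ _ ∧ _ ≤ Γ ω - σ * Γ ω
    rw [this]
    exact ⟨h2, h3⟩
  have h2 : Real.sqrt (2 * γ * γ) ≤ 1.5 * γ := Real.sqrt_le_iff.2 ⟨by positivity, by nlinarith⟩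
  have h3 : 1 - γ / (2 * γ) = 1 / 2 := by
    field_simp
    norm_num
  rw [h3] at h1
  have h4 : γ ≤ d * γ := le_mul_of_one_le_left hγ.le hd
  set I := ∫ ω, ‖∑ i ∈ S, ξ i ω‖ * Γ ω ∂μ
  set J : ι → ℝ := fun i => ∫ ω, ‖ξ i ω‖ * |Γ ω - Γ' i ω| ∂μ
  have hI0 : 0 ≤ I := integral_nonneg fun ω => mul_nonneg (norm_nonneg _) (le_max_left _ _)
  have hJ0 : ∀ i, 0 ≤ J i := fun i => integral_nonneg fun ω => by positivity
  have h5 : μ.real G' ≤ 15 * d * γ + (2 * I + 2 * ∑ i ∈ S, J i) := by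
    have : 1 / 2 * μ.real G' ≤ I + ∑ i ∈ S, J i + 3 * (2 * γ) * d + Real.sqrt (2 * γ * γ) := h1
    nlinarith
  have hI : ENNReal.ofReal I ≤ ∫⁻ ω, ‖∑ i ∈ S, ξ i ω‖ₑ * ENNReal.ofReal (Δ ω) ∂μ := by
    refine ofReal_integral_le_lintegral (by fun_prop)
      (fun ω => mul_nonneg (norm_nonneg _) (le_max_left _ _)) fun ω => ?_
    rw [ENNReal.ofReal_mul (norm_nonneg _), ofReal_norm]
    refine mul_le_mul_right ?_ _
    change ENNReal.ofReal (max 0 (min (Δ ω) K)) ≤ _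
    rw [ENNReal.ofReal_max, ENNReal.ofReal_zero]
    exact max_le bot_le (ENNReal.ofReal_le_ofReal (min_le_left _ _))
  have hJ : ∀ i, ENNReal.ofReal (J i) ≤ ∫⁻ ω, ‖ξ i ω‖ₑ * ENNReal.ofReal |Δ ω - Δ' i ω| ∂μ := by
    intro i
    have := hΓm' i
    have := hm i
    refine ofReal_integral_le_lintegral (by fun_prop) (fun ω => by positivity) fun ω => ?_
    rw [ENNReal.ofReal_mul (norm_nonneg _), ofReal_norm]
    gcongr _ * ENNReal.ofReal ?_
    exact abs_clamp_sub_clamp_le _ _ _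
  calc μ (G ∩ {ω | Δ ω ≤ K}) ≤ μ G' := measure_mono hsub
    _ = ENNReal.ofReal (μ.real G') := (ofReal_measureReal).symm
    _ ≤ ENNReal.ofReal (15 * d * γ + (2 * I + 2 * ∑ i ∈ S, J i)) := ENNReal.ofReal_le_ofReal h5
    _ = ENNReal.ofReal (15 * d * γ)
        + (2 * ENNReal.ofReal I + 2 * ∑ i ∈ S, ENNReal.ofReal (J i)) := by
      have hs0 : 0 ≤ ∑ i ∈ S, J i := Finset.sum_nonneg fun i _ => hJ0 i
      rw [ENNReal.ofReal_add (by positivity) (by positivity),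
        ENNReal.ofReal_add (by positivity) (by positivity), ENNReal.ofReal_mul zero_le_two,
        ENNReal.ofReal_mul zero_le_two, ENNReal.ofReal_sum_of_nonneg fun i _ => hJ0 i,
        ENNReal.ofReal_ofNat]
    _ ≤ _ := by
      unfold nonlinearError
      gcongr with i
      exact hJ i

/-- Berry-Esseen bound over convex sets for a nonlinear statistic `Y` approximated by the linear
statistic `∑ i ∈ S, ξ i`. -/
theorem berryEsseen_nonlinear [Nontrivial E] (hξ : IsStandardized μ S ξ) {Y : Ω → E}
    (hY : Measurable Y) {Δ : Ω → ℝ} (hΔ : Measurable Δ) {Δ' : ι → Ω → ℝ}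
    (hΔ' : ∀ i, Measurable (Δ' i)) (hYΔ : ∀ᵐ ω ∂μ, ‖Y ω - ∑ i ∈ S, ξ i ω‖ ≤ Δ ω)
    (hindep : ∀ i ∈ S, IndepFun (ξ i) (fun ω => (Δ' i ω, ∑ j ∈ S, ξ j ω - ξ i ω)) μ)
    {A : Set E} (hA : Convex ℝ A) :
    ENNReal.ofReal |μ.real {ω | Y ω ∈ A} - (stdGaussian E).real A|
      ≤ ENNReal.ofReal (215 * Real.sqrt (Module.finrank ℝ E) * thirdMoment μ S ξ)
        + nonlinearError μ S ξ Δ Δ' := by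
  have hγ := hξ.thirdMoment_pos
  have hBE := hξ.berryEsseen
  have hstrip := fun {s : E → ℝ} {n : E → E} (hs : IsSubgradientField s n) (hn : ∀ x, ‖n x‖ = 1)
    {σ : ℝ} (hσ0 : 0 ≤ σ) (hσ1 : σ ≤ 1) => hξ.measure_strip_le hs hn hσ0 hσ1 hΔ hΔ' hindep
  have hW : Measurable fun ω => ∑ i ∈ S, ξ i ω := hξ.measurable_sum S
  set γ := thirdMoment μ S ξ
  set d := Real.sqrt (Module.finrank ℝ E)
  set R := nonlinearError μ S ξ Δ Δ'
  rcases eq_or_ne R ∞ with hR | hR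
  · rw [hR, add_top]
    exact le_top
  have hRr : R = ENNReal.ofReal R.toReal := (ENNReal.ofReal_toReal hR).symm
  have hR0 : 0 ≤ R.toReal := ENNReal.toReal_nonneg
  rw [hRr, ← ENNReal.ofReal_add (by positivity) hR0]
  refine ENNReal.ofReal_le_ofReal ?_
  have : IsProbabilityMeasure (μ.map Y) := Measure.isProbabilityMeasure_map hY.aemeasurable
  refine ConvexClose.abs_sub_le hY (ConvexClose.of_sublevel (by positivity) fun s n hs hn => ?_) hA
  -- Only the endpoints matter: `σ = 0` is the outer strip `0 ≤ s(W) ≤ Δ`, which catches `Y` inside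
  -- with `W` outside, and `σ = 1` is the inner strip for the opposite case.
  have hst : ∀ σ : ℝ, 0 ≤ σ → σ ≤ 1 → μ.real {ω | 0 ≤ Δ ω ∧ -(σ * Δ ω) ≤ s (∑ i ∈ S, ξ i ω)
      ∧ s (∑ i ∈ S, ξ i ω) ≤ Δ ω - σ * Δ ω} ≤ 15 * d * γ + R.toReal := by
    intro σ hσ0 hσ1
    refine ENNReal.toReal_le_of_le_ofReal (by positivity) ?_
    rw [ENNReal.ofReal_add (by positivity) hR0, ← hRr]
    exact hstrip hs hn hσ0 hσ1
  have hms : MeasurableSet {x | s x ≤ 0} := (hs.isClosed_le 0).measurableSet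
  have hbe := abs_le.1 (hBE _ (hs.convex_le 0) (hs.isClosed_le 0))
  rw [map_measureReal_apply hW hms] at hbe
  rw [map_measureReal_apply hY hms]
  have hae : ∀ A B : Set Ω, A ≤ᵐ[μ] B → μ.real A ≤ μ.real B := fun A B h =>
    ENNReal.toReal_mono (measure_ne_top _ _) (measure_mono_ae h)
  have h1 : μ.real (Y ⁻¹' {x | s x ≤ 0})
      ≤ μ.real ((fun ω => ∑ i ∈ S, ξ i ω) ⁻¹' {x | s x ≤ 0}) + (15 * d * γ + R.toReal) := by
    refine le_trans ((hae _ _ ?_).trans (measureReal_union_le _ _))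
      (add_le_add_right (hst 0 le_rfl zero_le_one) _)
    filter_upwards [hYΔ] with ω hω hω'
    have h2 := hs.sub_le_norm (∑ i ∈ S, ξ i ω) (Y ω)
    rw [norm_sub_rev] at h2
    have h3 : s (Y ω) ≤ 0 := hω'
    rcases le_total (s (∑ i ∈ S, ξ i ω)) 0 with h4 | h4
    · exact Or.inl h4
    · exact Or.inr ⟨(norm_nonneg _).trans hω, by simpa using h4, by linarith⟩
  have h2 : μ.real ((fun ω => ∑ i ∈ S, ξ i ω) ⁻¹' {x | s x ≤ 0})
      ≤ μ.real (Y ⁻¹' {x | s x ≤ 0}) + (15 * d * γ + R.toReal) := by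
    refine le_trans ((hae _ _ ?_).trans (measureReal_union_le _ _))
      (add_le_add_right (hst 1 zero_le_one le_rfl) _)
    filter_upwards [hYΔ] with ω hω hω'
    have h2 := hs.sub_le_norm (Y ω) (∑ i ∈ S, ξ i ω)
    have h3 : s (∑ i ∈ S, ξ i ω) ≤ 0 := hω'
    rcases le_total (s (Y ω)) 0 with h4 | h4
    · exact Or.inl h4
    · exact Or.inr ⟨(norm_nonneg _).trans hω, by linarith, by linarith⟩
  rw [abs_le]
  constructor <;> linarith [hbe.1, hbe.2]

end IsStandardized

end NonlinearBound

/-! ### Translation to coordinates and extended nonnegative reals. -/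

section Assembly

open scoped RealInnerProductSpace

variable {Ω 𝓧 : Type*} [MeasurableSpace Ω] [MeasurableSpace 𝓧] {μ : Measure Ω}
  [IsProbabilityMeasure μ] {d n : ℕ}

lemma sum_integral_inner_mul_inner {X : Fin n → Ω → 𝓧}
    {h : Fin n → 𝓧 → EuclideanSpace ℝ (Fin d)} (h_sq : ∀ i, MemLp (xi h X i) 2 μ)
    (h_cov : covarianceSum μ h X = 1) (u v : EuclideanSpace ℝ (Fin d)) :
    ∑ i, ∫ ω, ⟪xi h X i ω, u⟫ * ⟪xi h X i ω, v⟫ ∂μ = ⟪u, v⟫ := by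
  have hc : ∀ i (j : Fin d), MemLp (fun ω => xi h X i ω j) 2 μ := fun i j =>
    (EuclideanSpace.proj (𝕜 := ℝ) j).comp_memLp' (h_sq i)
  have hint : ∀ i (j k : Fin d), Integrable (fun ω => xi h X i ω j * xi h X i ω k) μ :=
    fun i j k => (hc i j).integrable_mul (hc i k)
  have e : ∀ i, ∫ ω, ⟪xi h X i ω, u⟫ * ⟪xi h X i ω, v⟫ ∂μ
      = ∑ j, ∑ k, u j * v k * ∫ ω, xi h X i ω j * xi h X i ω k ∂μ := by
    intro i
    have e1 : ∀ ω, ⟪xi h X i ω, u⟫ * ⟪xi h X i ω, v⟫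
        = ∑ j, ∑ k, u j * v k * (xi h X i ω j * xi h X i ω k) := by
      intro ω
      rw [PiLp.inner_apply, PiLp.inner_apply, Finset.sum_mul_sum]
      refine Finset.sum_congr rfl fun j _ => Finset.sum_congr rfl fun k _ => ?_
      simp only [RCLike.inner_apply, conj_trivial]
      ring
    simp_rw [e1]
    rw [integral_finsetSum _ fun j _ => integrable_finsetSum _ fun k _ => (hint i j k).const_mul _]
    refine Finset.sum_congr rfl fun j _ => ?_
    rw [integral_finsetSum _ fun k _ => (hint i j k).const_mul _]
    refine Finset.sum_congr rfl fun k _ => ?_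
    rw [integral_const_mul]
  have hjk : ∀ j k : Fin d, ∑ i, ∫ ω, xi h X i ω j * xi h X i ω k ∂μ
      = (1 : Matrix (Fin d) (Fin d) ℝ) j k := by
    intro j k
    rw [← h_cov, covarianceSum, Matrix.sum_apply]
    rfl
  simp_rw [e]
  rw [Finset.sum_comm]
  simp_rw [Finset.sum_comm (s := (Finset.univ : Finset (Fin n))), ← Finset.mul_sum, hjk]
  rw [PiLp.inner_apply]
  simp [Matrix.one_apply, mul_comm]

lemma memLp_three_of_gammaSum_ne_top {X : Fin n → Ω → 𝓧}
    {h : Fin n → 𝓧 → EuclideanSpace ℝ (Fin d)} (hm : ∀ i, Measurable (xi h X i))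
    (hγ : gammaSum μ h X ≠ ∞) (i : Fin n) : MemLp (xi h X i) 3 μ := by
  refine ⟨(hm i).aestronglyMeasurable, ?_⟩
  rw [eLpNorm_lt_top_iff_lintegral_rpow_enorm_lt_top (by simp) (by simp)]
  have h1 := ENNReal.sum_ne_top.1 hγ i (Finset.mem_univ i)
  simpa using h1.lt_top

lemma ofReal_thirdMoment {X : Fin n → Ω → 𝓧}
    {h : Fin n → 𝓧 → EuclideanSpace ℝ (Fin d)} (h3 : ∀ i, MemLp (xi h X i) 3 μ) :
    ENNReal.ofReal (thirdMoment μ Finset.univ (xi h X)) = gammaSum μ h X := by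
  unfold thirdMoment gammaSum
  rw [ENNReal.ofReal_sum_of_nonneg fun i _ => integral_nonneg fun ω => by positivity]
  refine Finset.sum_congr rfl fun i _ => ?_
  have hi : Integrable (fun ω => ‖xi h X i ω‖ ^ 3) μ := by
    exact_mod_cast (h3 i).integrable_norm_pow (by norm_num)
  rw [ofReal_integral_eq_lintegral_ofReal hi (Filter.Eventually.of_forall fun ω => by positivity)]
  simp_rw [ENNReal.ofReal_pow (norm_nonneg _), ofReal_norm]

lemma convexDistToGaussian_eq_zero (Y : Ω → EuclideanSpace ℝ (Fin 0)) :
    convexDistToGaussian μ Y = 0 := by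
  refine le_antisymm (iSup₂_le fun A _ => ?_) bot_le
  rcases Set.eq_empty_or_nonempty A with rfl | hne
  · simp
  · rw [Subsingleton.eq_univ_of_nonempty hne]
    simp

end Assembly

end NonlinearStatistic

theorem theorem2p1 {Ω 𝓧 : Type*} [MeasurableSpace Ω] [MeasurableSpace 𝓧]
    (μ : Measure Ω) [IsProbabilityMeasure μ] {d n : ℕ}
    -- independent observations and the statistics built from them
    (X : Fin n → Ω → 𝓧) (hX : ∀ i, Measurable (X i)) (hX_indep : iIndepFun X μ)
    (h : Fin n → 𝓧 → EuclideanSpace ℝ (Fin d)) (hh : ∀ i, Measurable (h i))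
    (T : (Fin n → 𝓧) → EuclideanSpace ℝ (Fin d)) (hT : Measurable T)
    -- standardization of the summands
    (h_sq : ∀ i, MemLp (NonlinearStatistic.xi h X i) 2 μ)
    (h_mean : ∀ i, ∫ ω, NonlinearStatistic.xi h X i ω ∂μ = 0)
    (h_cov : NonlinearStatistic.covarianceSum μ h X = 1)
    -- the dominating variable and its decoupled versions
    (Δ : Ω → ℝ) (hΔ : Measurable Δ)
    (hΔ_ge : ∀ᵐ ω ∂μ, ‖NonlinearStatistic.errorTerm T h X ω‖ ≤ Δ ω)
    (Δ' : Fin n → Ω → ℝ) (hΔ' : ∀ i, Measurable (Δ' i))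
    (hΔ'_indep : ∀ i, IndepFun (X i)
      (fun ω => (Δ' i ω, NonlinearStatistic.linearPart h X ω - NonlinearStatistic.xi h X i ω)) μ) :
    NonlinearStatistic.convexDistToGaussian μ (NonlinearStatistic.statistic T X) ≤
      259 * ENNReal.ofReal (Real.sqrt d) * NonlinearStatistic.gammaSum μ h X
        + 2 * ∫⁻ ω, ‖NonlinearStatistic.linearPart h X ω‖ₑ * ENNReal.ofReal (Δ ω) ∂μ
        + 2 * ∑ i, ∫⁻ ω, ‖NonlinearStatistic.xi h X i ω‖ₑ * ENNReal.ofReal |Δ ω - Δ' i ω| ∂μ := by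
  -- In dimension zero the third moment need not be positive, but there the convex distance is zero.
  rcases Nat.eq_zero_or_pos d with rfl | hd
  · rw [NonlinearStatistic.convexDistToGaussian_eq_zero]
    exact bot_le
  have hd' : 0 < Real.sqrt d := Real.sqrt_pos.2 (by exact_mod_cast hd)
  -- For `γ = ∞` the right side is infinite because `√d > 0`; otherwise the summands have finite
  -- third moments.
  rcases eq_or_ne (NonlinearStatistic.gammaSum μ h X) ∞ with hγ | hγ
  · rw [hγ, ENNReal.mul_top (mul_ne_zero (by norm_num) (ENNReal.ofReal_pos.2 hd').ne'), top_add,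
      top_add]
    exact le_top
  have : Nonempty (Fin d) := ⟨⟨0, hd⟩⟩
  have hm : ∀ i, Measurable (NonlinearStatistic.xi h X i) := fun i => (hh i).comp (hX i)
  have h3 := NonlinearStatistic.memLp_three_of_gammaSum_ne_top hm hγ
  have hξ : NonlinearStatistic.IsStandardized μ Finset.univ (NonlinearStatistic.xi h X) :=
    ⟨hm, hX_indep.comp h hh, h3, h_mean,
      NonlinearStatistic.sum_integral_inner_mul_inner h_sq h_cov⟩
  have hY : Measurable (NonlinearStatistic.statistic T X) := hT.comp (measurable_pi_lambda _ hX)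
  refine iSup₂_le fun A hA => ?_
  have key := hξ.berryEsseen_nonlinear hY hΔ hΔ' hΔ_ge
    (fun i _ => (hΔ'_indep i).comp (hh i) measurable_id) hA
  refine key.trans ?_
  rw [NonlinearStatistic.nonlinearError, ← add_assoc]
  gcongr ?_ + _ + _
  -- The constant obtained is `215 = 200 + 15`, below the stated `259`.
  rw [ENNReal.ofReal_mul (by positivity), ENNReal.ofReal_mul (by norm_num),
    NonlinearStatistic.ofReal_thirdMoment h3, finrank_euclideanSpace_fin]
  gcongr
  rw [ENNReal.ofReal_ofNat]
  norm_num
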